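/- **Setting.** Let $V$ be a Euclidean space and let $W$ be a finite reflection group on $V$, fixing only the origin, of type $A_n$ ($n\ge 2$), $B_n$ ($n\ge 2$) or $I_2(m)$ ($m\ge 3$), with root system $\Phi$ ($\Phi\cap\mathbb R\beta=\{\pm\beta\}$ for $\beta\in\Phi$), simple roots $\alpha_1,\dots,\alpha_n$ (numbered along the Coxeter diagram; in type $B_n$ the edge of label 4 joins $n-1$ and $n$) and simple reflections $s_1,\dots,s_n$. Let $S_+\cup S_-$ be a bipartition of the Coxeter diagram, $c_\pm=\prod_{s\in S_\pm}s$, $c=c_-c_+$, let $h$ be the order of $c$, and let $P$ be the Coxeter plane, on which $c$ acts as the rotation through $2\pi/h$. Let $L_\pm\subset P$ be the line in which the reflecting hyperplanes of all $s\in S_\pm$ meet $P$. Let $\Phi_{\ge-1}$ be the set of almost positive roots (positive roots and negatives of simple roots). For $\varepsilon\in\{+,-\}$ let $\tau_\varepsilon(\beta)=\beta$ if $\beta=-\alpha_i$ with $s_i\in S_{-\varepsilon}$, and $\tau_\varepsilon(\beta)=c_\varepsilon(\beta)$ for all other $\beta\in\Phi_{\ge-1}$. Compatibility is the relation on $\Phi_{\ge-1}$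 that is invariant under $\tau_+,\tau_-$ and such that $\beta$ is compatible with $-\alpha_i$ iff the coefficient of $\alpha_i$ in $\beta$ is zero. **Construction.** Let $o$ be a nontrivial $W$-orbit of least size. If $o$ projects orthogonally and one-to-one to the vertices of a regular $h$-gon in $P$ centred at the origin, insert a new vertex on each edge of the $h$-gon that is perpendicular to $L_+$ or $L_-$, and make the resulting polygon regular, keeping the distances of vertices to the origin (the result is determined up to rotation); elements of $o$ are then identified with vertices of the new polygon. The diagram of $-\alpha_i$ is the set of segments joining $x$ and $s_i(x)$, for $x\in o$ with $s_i(x)\ne x$. Let $L'_\varepsilon\subset P$ be the line through the origin, perpendicular to all segments in the diagrams of the $-\alpha_i$ with $s_i\in S_{-\varepsilon}$, such that reflection in it preserves these diagrams. Diagrams of all almost positive roots (sets of segments) are required to satisfy: the diagram of $\tau_\varepsilon(\beta)$ is the image of the diagram of $\beta$ under the reflection in $L'_\varepsilon$. **Theorem.** 1. The Coxeter number $h$ is $n+1$, $2n$, $m$ in types $A_n$, $B_n$, $I_2(m)$ respectively; $\dim P=2$; the orbit $o$ projects one-to-one to the vertices of a regular $h$-gon centred at the origin; the new polygon is an $(h+2)$-gon,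 in which distinct elements of $o$ are distinct vertices; and the lines $L'_\pm$ exist and are unique. There is exactly one assignment of diagrams to the almost positive roots satisfying the requirement. 2. (Type $A_n$.) For some cyclic labelling of the vertices of the $(n+3)$-gon by $\mathbb Z/(n+3)$, the diagrams of $-\alpha_1,-\alpha_2,-\alpha_3,\dots$ are the single diagonals $\{1,-1\},\{1,-2\},\{2,-2\},\{2,-3\},\{3,-3\},\dots$ (the snake). The positive roots are the sums $\alpha_i+\dots+\alpha_j$ ($i\le j$), and the diagram of $\alpha_i+\dots+\alpha_j$ is the unique diagonal that crosses the diagonals of $-\alpha_i,\dots,-\alpha_j$ and no other diagonal of the snake. Almost positive roots are thereby in bijection with the diagonals. 3. (Type $B_n$; for $n=2$ assume that $o$ contains a multiple of $\alpha_n$, i.e. $o=\{\pm te_1,\pm te_2\}$ in the standard realization; for $n\ge 3$ this is automatic.) Let $d_1,\dots,d_{2n-1}$ be the snake $\{1,-1\},\{1,-2\},\{2,-2\},\dots$ for a suitable cyclic labelling of the vertices of the $(2n+2)$-gon by $\mathbb Z/(2n+2)$. The diagram of $-\alpha_i$ is $\{d_i,d_{2n-i}\}$: a diameter for $i=n$ and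 a centrally symmetric pair otherwise. Almost positive roots are in bijection with the diameters and the centrally symmetric pairs of diagonals. If the root system is the crystallographic one of type $B_n$ ($\alpha_n$ short), then, for every choice of one diagonal from the diagram of each $-\alpha_k$, the diagram of a positive root $\beta$ is the unique diameter or centrally symmetric pair of diagonals such that for each $k$ the number of its segments that cross the chosen diagonal of $-\alpha_k$ is the coefficient of $\alpha_k$ in $\beta$. If it is the crystallographic one of type $C_n$ ($\alpha_n$ long), the same holds with the coefficient of the simple coroot $\alpha_k^\vee$ in the coroot $\beta^\vee$. 4. (Type $I_2(m)$.) There are $m+2$ almost positive roots, and assigning diagrams is a bijection from them onto the maximal families of parallel diagonals of the $(m+2)$-gon. 5. (Compatibility criterion.) In all these types the compatibility relation exists, and two distinct almost positive roots are compatible if and only if no segment in the diagram of one crosses a segment in the diagram of the other (two segments cross if they are distinct and their relative interiors meet). -/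

import Mathlib

/-!  Coxeter-plane diagrams for almost positive roots.

Everything lives in a finite-dimensional Euclidean space `V`.  Indices of simple reflections run
over `Fin n`, starting from `0`.  The two halves of the bipartition of the Coxeter diagram are
indexed by `Bool`, with `true` for `+` and `false` for `-`.  -/

noncomputable section

namespace CoxeterDiagrams

section Reflections

variable {n : ℕ} {V : Type*} [NormedAddCommGroup V] [InnerProductSpace ℝ V]
  [FiniteDimensional ℝ V]

/-- The reflection in the hyperplane orthogonal to the simple root `α i`. -/
def simpleReflection (α : Module.Basis (Fin n) ℝ V) (i : Fin n) : V ≃ₗᵢ[ℝ] V :=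
  ((ℝ ∙ α i)ᗮ).reflection

/-- The reflection group generated by the simple reflections. -/
def reflectionGroup (α : Module.Basis (Fin n) ℝ V) : Subgroup (V ≃ₗᵢ[ℝ] V) :=
  Subgroup.closure (Set.range (simpleReflection α))

/-- The orbit of a vector under the reflection group. -/
def orbit (α : Module.Basis (Fin n) ℝ V) (x : V) : Set V :=
  {y | ∃ g ∈ reflectionGroup α, y = g x}

/-- The roots: all images of simple roots. -/
def roots (α : Module.Basis (Fin n) ℝ V) : Set V := {β | ∃ i, β ∈ orbit α (α i)}

end Reflections

/-- A root system with a choice of simple roots, realising the Coxeter matrix `M` in `V` without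
nonzero fixed vectors (the simple roots form a basis of `V`), together with a bipartition of the
Coxeter diagram.  The lengths of the simple roots are only restricted by the requirement that the
only multiples of a root that are roots are the root and its negative. -/
structure SimpleSystem {n : ℕ} (M : CoxeterMatrix (Fin n)) (V : Type*) [NormedAddCommGroup V]
    [InnerProductSpace ℝ V] [FiniteDimensional ℝ V] where
  /-- the simple roots -/
  α : Module.Basis (Fin n) ℝ V
  inner_eq : ∀ i j, inner ℝ (α i) (α j) = -(‖α i‖ * ‖α j‖ * Real.cos (Real.pi / (M i j : ℝ)))
  reduced : ∀ β ∈ roots α, ∀ t : ℝ, t • β ∈ roots α → t = 1 ∨ t = -1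
  /-- `side i = true` means that the `i`-th simple reflection is in `S₊` -/
  side : Fin n → Bool
  bipartite : ∀ i j, i ≠ j → side i = side j → M i j = 2

section Construction

variable {n : ℕ} {M : CoxeterMatrix (Fin n)} {V : Type*} [NormedAddCommGroup V]
  [InnerProductSpace ℝ V] [FiniteDimensional ℝ V]

namespace SimpleSystem

/-- The involution `c₊` or `c₋`: the product of the (pairwise commuting) simple reflections on one
side of the bipartition. -/
def half (S : SimpleSystem M V) (ε : Bool) : V ≃ₗᵢ[ℝ] V :=
  (((List.finRange n).filter (fun i => S.side i = ε)).map (simpleReflection S.α)).prod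

/-- The bipartite Coxeter element `c = c₋ c₊`. -/
def coxeterElement (S : SimpleSystem M V) : V ≃ₗᵢ[ℝ] V := S.half false * S.half true

/-- The Coxeter number `h`, the order of the Coxeter element. -/
def coxeterNumber (S : SimpleSystem M V) : ℕ := orderOf S.coxeterElement

/-- The Coxeter plane, on which `c` acts as the rotation through `2π/h`: it consists of all `x` with
`c x + c⁻¹ x = 2 cos(2π/h) x`. -/
def coxeterPlane (S : SimpleSystem M V) : Submodule ℝ V where
  carrier := {x | S.coxeterElement x + S.coxeterElement⁻¹ x =
    (2 * Real.cos (2 * Real.pi / (S.coxeterNumber : ℝ))) • x}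
  zero_mem' := by simp
  add_mem' := by
    intro x y hx hy
    simp only [Set.mem_ofPred_eq, map_add, smul_add] at hx hy ⊢
    rw [← hx, ← hy]
    abel
  smul_mem' := by
    intro t x hx
    simp only [Set.mem_ofPred_eq, map_smul] at hx ⊢
    rw [← smul_add, hx, smul_comm]

/-- Orthogonal projection to the Coxeter plane. -/
def proj (S : SimpleSystem M V) (x : V) : V := S.coxeterPlane.starProjection x

/-- The line `L₊` or `L₋` in the Coxeter plane, in which the reflecting hyperplanes of the simple
reflections of one side meet the plane. -/
def line (S : SimpleSystem M V) (ε : Bool) : Submodule ℝ V :=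
  S.coxeterPlane ⊓ ⨅ (i : Fin n) (_ : S.side i = ε), (ℝ ∙ S.α i)ᗮ

/-- The positive roots. -/
def positiveRoots (S : SimpleSystem M V) : Set V := {β ∈ roots S.α | ∀ i, 0 ≤ S.α.repr β i}

/-- The almost positive roots: the positive roots and the negatives of the simple roots. -/
def almostPositiveRoots (S : SimpleSystem M V) : Set V :=
  S.positiveRoots ∪ Set.range (fun i => -S.α i)

open Classical in
/-- The involutions `τ₊` and `τ₋` of the set of almost positive roots. -/
def tau (S : SimpleSystem M V) (ε : Bool) (β : V) : V :=
  if ∃ i, S.side i = !ε ∧ β = -S.α i then β else S.half ε β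

/-- `R` restricts to the compatibility relation on almost positive roots: it is invariant under
`τ₊` and `τ₋`, and `β` is compatible with `-αᵢ` iff the coefficient of `αᵢ` in `β` is zero. -/
def IsCompatibility (S : SimpleSystem M V) (R : V → V → Prop) : Prop :=
  (∀ ε, ∀ β ∈ S.almostPositiveRoots, ∀ γ ∈ S.almostPositiveRoots,
    (R (S.tau ε β) (S.tau ε γ) ↔ R β γ)) ∧
  ∀ i, ∀ β ∈ S.almostPositiveRoots, (R β (-S.α i) ↔ S.α.repr β i = 0)

/-- `o` is a nontrivial orbit of the least possible size. -/
def IsSmallestOrbit (S : SimpleSystem M V) (o : Set V) : Prop :=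
  (∃ x, x ≠ 0 ∧ o = orbit S.α x) ∧ ∀ y, y ≠ 0 → o.encard ≤ (orbit S.α y).encard

end SimpleSystem

/-- The `k`-th vertex of the regular `N`-gon with centre at the origin, circumradius `r` and phase
`θ`, in the plane with orthonormal basis `u, w`. -/
def ngon (u w : V) (r θ : ℝ) (N : ℕ) (k : ℤ) : V :=
  r • (Real.cos (2 * Real.pi * k / N + θ) • u + Real.sin (2 * Real.pi * k / N + θ) • w)

/-- The projection of `o` to the Coxeter plane is one-to-one, with image the vertex set of a regular
`h`-gon centred at the origin; `v 0, v 1, …, v (h - 1)`, continued periodically, are the elements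
of `o` in the cyclic order of the vertices. -/
structure OrbitPolygon (S : SimpleSystem M V) (o : Set V) where
  u : V
  w : V
  u_mem : u ∈ S.coxeterPlane
  w_mem : w ∈ S.coxeterPlane
  norm_u : ‖u‖ = 1
  norm_w : ‖w‖ = 1
  inner_u_w : inner ℝ u w = 0
  radius : ℝ
  radius_pos : 0 < radius
  v : ℕ → V
  range_v : Set.range v = o
  v_add : ∀ k, v (k + S.coxeterNumber) = v k
  proj_v : ∀ k : ℕ, S.proj (v k) = ngon u w radius 0 S.coxeterNumber k

/-- The edge of the `h`-gon from the `k`-th to the next vertex is distinguished if it is perpendicular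
to `L₊` or to `L₋`. -/
def OrbitPolygon.Distinguished {S : SimpleSystem M V} {o : Set V} (G : OrbitPolygon S o) (k : ℕ) :
    Prop :=
  ∃ ε, ∀ x ∈ S.line ε, inner ℝ (S.proj (G.v (k + 1)) - S.proj (G.v k)) x = 0

open Classical in
/-- The position of the `k`-th old vertex after one new vertex has been inserted on each
distinguished edge. -/
def OrbitPolygon.index {S : SimpleSystem M V} {o : Set V} (G : OrbitPolygon S o) : ℕ → ℕ
  | 0 => 0
  | k + 1 => G.index k + if G.Distinguished k then 2 else 1

/-- The expanded diagram: the `h`-gon with the new vertices on its distinguished edges is made into a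
regular `(h + 2)`-gon, with the same distance of vertices to the origin and with some phase `θ`; `q`
sends each element of the orbit to its vertex of the `(h + 2)`-gon. -/
structure Expansion (S : SimpleSystem M V) (o : Set V) where
  polygon : OrbitPolygon S o
  θ : ℝ
  q : V → V
  q_v : ∀ k : ℕ, q (polygon.v k) =
    ngon polygon.u polygon.w polygon.radius θ (S.coxeterNumber + 2) (polygon.index k)

namespace Expansion

variable {S : SimpleSystem M V} {o : Set V}

/-- The vertices of the `(h + 2)`-gon, in cyclic order. -/
def vertex (E : Expansion S o) (k : ℤ) : V :=
  ngon E.polygon.u E.polygon.w E.polygon.radius E.θ (S.coxeterNumber + 2) k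

/-- The diagonals of the `(h + 2)`-gon: pairs of distinct, non-adjacent vertices. -/
def diagonals (E : Expansion S o) : Set (Sym2 V) :=
  {d | ∃ a b : ℤ, ¬ ((S.coxeterNumber + 2 : ℕ) : ℤ) ∣ b - a ∧
    ¬ ((S.coxeterNumber + 2 : ℕ) : ℤ) ∣ b - a - 1 ∧
    ¬ ((S.coxeterNumber + 2 : ℕ) : ℤ) ∣ b - a + 1 ∧ d = s(E.vertex a, E.vertex b)}

/-- The diagram of the negative simple root `-αᵢ`: segments (given by their pairs of endpoints)
joining the vertices of elements of the orbit that the simple reflection interchanges. -/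
def negDiagram (E : Expansion S o) (i : Fin n) : Set (Sym2 V) :=
  {d | ∃ x ∈ o, simpleReflection S.α i x ≠ x ∧ d = s(E.q x, E.q (simpleReflection S.α i x))}

/-- `ℓ` is the line `L'₊` or `L'₋` for the sign `ε`: a line in the Coxeter plane, perpendicular to
all segments in the diagrams of the `-αᵢ` of the side opposite to `ε`, the reflection in which
preserves these diagrams. -/
def IsMirror (E : Expansion S o) (ε : Bool) (ℓ : Submodule ℝ V) : Prop :=
  ℓ ≤ S.coxeterPlane ∧ Module.finrank ℝ ℓ = 1 ∧
  ∀ i, (S.side i = !ε) →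
    (∀ a b, s(a, b) ∈ E.negDiagram i → ∀ x ∈ ℓ, inner ℝ (b - a) x = 0) ∧
    Sym2.map ℓ.reflection '' E.negDiagram i = E.negDiagram i

/-- `Δ` assigns to each almost positive root its diagram: the diagrams of the negative simple roots
are the given ones, and `τ₊`, `τ₋` act on diagrams as the reflections in `L'₊`, `L'₋`. -/
def IsDiagramMap (E : Expansion S o) (Δ : V → Set (Sym2 V)) : Prop :=
  (∀ i, Δ (-S.α i) = E.negDiagram i) ∧
  ∀ ε ℓ, E.IsMirror ε ℓ → ∀ β ∈ S.almostPositiveRoots,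
    Δ (S.tau ε β) = Sym2.map ℓ.reflection '' Δ β

end Expansion

/-- Two segments cross if they are distinct and their relative interiors meet. -/
def Crosses (d e : Sym2 V) : Prop :=
  d ≠ e ∧ ∃ a b a' b' : V, d = s(a, b) ∧ e = s(a', b') ∧
    (openSegment ℝ a b ∩ openSegment ℝ a' b').Nonempty

/-- Two segments are parallel. -/
def Parallel (d e : Sym2 V) : Prop :=
  ∃ a b a' b' : V, d = s(a, b) ∧ e = s(a', b') ∧ ∃ t : ℝ, b' - a' = t • (b - a)

/-- The number of segments in `F` that cross `e`. -/
def crossCount (F : Set (Sym2 V)) (e : Sym2 V) : ℕ := {d ∈ F | Crosses d e}.ncard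

/-- The `i`-th diagonal, `i = 0, 1, 2, …`, of the snake
`{1, -1}, {1, -2}, {2, -2}, {2, -3}, {3, -3}, …` in a polygon with vertices `Q k`. -/
def snake (Q : ℤ → V) (i : ℕ) : Sym2 V :=
  s(Q ((i / 2 + 1 : ℕ) : ℤ), Q (-(((i + 1) / 2 + 1 : ℕ) : ℤ)))

namespace Expansion

variable {S : SimpleSystem M V} {o : Set V}

/-- The snake model of type `A`: the negative simple roots are the diagonals of a snake, and
`αᵢ + ⋯ + αⱼ` is the unique diagonal that crosses the diagonals of `-αᵢ, …, -αⱼ` and no other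
diagonals in the snake.  Almost positive roots are in bijection with diagonals. -/
def IsSnakeModelA (E : Expansion S o) (Δ : V → Set (Sym2 V)) : Prop :=
  (∃ (a : ℤ) (σ : ℤˣ), ∀ i : Fin n, Δ (-S.α i) = {snake (fun k => E.vertex (a + σ * k)) i}) ∧
  (∀ β, β ∈ S.positiveRoots ↔ ∃ i j : Fin n, i ≤ j ∧ β = ∑ k ∈ Finset.Icc i j, S.α k) ∧
  (∀ i j : Fin n, i ≤ j → ∃ d ∈ E.diagonals, Δ (∑ k ∈ Finset.Icc i j, S.α k) = {d} ∧
    (∀ k, (∃ e ∈ Δ (-S.α k), Crosses d e) ↔ i ≤ k ∧ k ≤ j) ∧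
    ∀ d' ∈ E.diagonals, (∀ k, (∃ e ∈ Δ (-S.α k), Crosses d' e) ↔ i ≤ k ∧ k ≤ j) → d' = d) ∧
  Set.BijOn Δ S.almostPositiveRoots {F | ∃ d ∈ E.diagonals, F = {d}}

/-- The diameters (as one-element sets) and the centrally symmetric pairs of diagonals. -/
def centralFamilies (E : Expansion S o) : Set (Set (Sym2 V)) :=
  {F | ∃ d ∈ E.diagonals, F = {d, Sym2.map (fun x => -x) d}}

/-- For every choice of one diagonal in the diagram of each negative simple root, `F` is the unique
diameter or centrally symmetric pair of diagonals such that the number of segments in `F` that cross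
the `k`-th chosen diagonal is `m k`. -/
def IsFamilyWithCrossings (E : Expansion S o) (Δ : V → Set (Sym2 V)) (m : Fin n → ℝ)
    (F : Set (Sym2 V)) : Prop :=
  ∀ g : Fin n → Sym2 V, (∀ k, g k ∈ Δ (-S.α k)) →
    (F ∈ E.centralFamilies ∧ ∀ k, (crossCount F (g k) : ℝ) = m k) ∧
    ∀ F' ∈ E.centralFamilies, (∀ k, (crossCount F' (g k) : ℝ) = m k) → F' = F

/-- The snake model of type `B`.  The negative simple roots are a diameter (for the last one) and
centrally symmetric pairs of diagonals forming a snake; almost positive roots are in bijection with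
the diameters and the centrally symmetric pairs of diagonals.  For the roots of type `B` (the last
simple root is shorter) numbers of crossings are coefficients of positive roots in the simple roots.
For the roots of type `C` (the last simple root is longer) they are coefficients of positive
coroots `2β/⟨β, β⟩` in the simple coroots. -/
def IsSnakeModelB (E : Expansion S o) (Δ : V → Set (Sym2 V)) : Prop :=
  (∃ (a : ℤ) (σ : ℤˣ), ∀ i : Fin n, Δ (-S.α i) =
    {snake (fun k => E.vertex (a + σ * k)) i,
      snake (fun k => E.vertex (a + σ * k)) (2 * n - 2 - i)}) ∧
  Set.BijOn Δ S.almostPositiveRoots E.centralFamilies ∧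
  ((∀ i j : Fin n, (i : ℕ) + 1 < n → (j : ℕ) + 1 = n → ‖S.α i‖ ^ 2 = 2 * ‖S.α j‖ ^ 2) →
    ∀ β ∈ S.positiveRoots, E.IsFamilyWithCrossings Δ (fun k => S.α.repr β k) (Δ β)) ∧
  ((∀ i j : Fin n, (i : ℕ) + 1 < n → (j : ℕ) + 1 = n → ‖S.α j‖ ^ 2 = 2 * ‖S.α i‖ ^ 2) →
    ∀ β ∈ S.positiveRoots, E.IsFamilyWithCrossings Δ
      (fun k => S.α.repr β k * ‖S.α k‖ ^ 2 / ‖β‖ ^ 2) (Δ β))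

/-- The maximal families of parallel diagonals. -/
def maximalParallelFamilies (E : Expansion S o) : Set (Set (Sym2 V)) :=
  {F | ∃ d ∈ E.diagonals, F = {e ∈ E.diagonals | Parallel d e}}

end Expansion

end Construction

/-- The types `Aₙ` and `Bₙ` (`n ≥ 2`) and `I₂(m)` (`m ≥ 3`), with their Coxeter numbers. -/
inductive IsTypeABI : (n : ℕ) → CoxeterMatrix (Fin n) → ℕ → Prop
  | A (n : ℕ) (hn : 2 ≤ n) : IsTypeABI n (CoxeterMatrix.A n) (n + 1)
  | B (n : ℕ) (hn : 2 ≤ n) : IsTypeABI n (CoxeterMatrix.B n) (2 * n)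
  | I (m : ℕ) (hm : 3 ≤ m) : IsTypeABI 2 (CoxeterMatrix.I (m - 2)) m

end CoxeterDiagrams

end

/-!
The idea is to describe everything by one path. In the three types a smallest orbit `o` can be
numbered as `x 0, …, x (h - 1)` such that consecutive members are interchanged by a simple reflection
and no other simple reflection moves them, where the two sides of the bipartition alternate
(`OrbitPath`). Each half `c_±` of the Coxeter element then interchanges the ends of every other edge of
this path, so that `c` permutes the orbit cyclically, and the path is a zigzag with respect to the
cyclic order (`OrbitPath.z_zag`). Hence `c` has order `h`. The Coxeter plane is nonzero: a trigonometric
combination of the vertices lies in it, and summation by parts shows that it does not vanish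
(`OrbitPath.exists_mem_plane_ne_zero`). By the recurrence that defines the plane, the orbit projects to
a regular `h`-gon.

The edges perpendicular to `L_±` are those whose endpoints are interchanged by one of the halves
(`OrbitPath.distinguished_iff`), and the two new vertices prolong the zigzag at its two ends
(`OrbitPath.exists_zigzag`). So the edges of the path become the snake, each half of the Coxeter element
corresponds to a reflection of the `(h + 2)`-gon (`Labelling.isMirror_iff`), and this reflection moves
position `k` of the prolonged zigzag, whose first position is `0`, in the same direction as the half
moves `x k` on the path.

The differences of the vertices of the path are linear combinations of simple roots with coefficients
of one sign, and every root is a multiple of such a difference. Attach to the chord between the positions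
`i < j` of the zigzag the vector `x i - x (j - 2)`, up to the sign which is common to all of them. The
diagram of a root consists of the diagonals whose vector is a positive multiple of the root
(`Labelling.diagram`). For the edges of the snake this gives the diagrams of the negative simple roots,
and for the others the reflections correspond to the involutions `τ_±`
(`Labelling.reflection_mem_diagram`). Successive reflections turn every diagonal into an edge of the
snake (`Labelling.exists_reachable`), so the diagrams are unique, every diagonal occurs in exactly one
of them, and everything that the reflections preserve can be checked on the snake.

A chord crosses those edges of the snake that lie strictly between its endpoints
(`Labelling.crosses_snake_iff`), which are the edges that carry the simple roots in the support of its
vector (`Labelling.exists_crosses_iff`). Hence the relation of not crossing satisfies the requirements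
on compatibility. The shape of the diagrams in the single types follows from that of the snake: in type
`A` the labels of its edges are distinct, in type `B` it is centrally symmetric, and in type `I₂(m)` the
edges with the same label form a family of parallel diagonals. In types `A` and `B` the numbers of
crossings are compared with the coefficients of the differences of vertices.

It remains to see that smallest orbits are paths. The orbit of a vector on all simple mirrors but
the first, in rank two of a vector on a simple mirror, is a path by a computation of the distances
to the mirrors. An orbit which is not larger is a regular simplex in type `A`, and it is contained
in a system of orthogonal lines in type `B` of rank at least three, since the operator `∑ y, ⟪y,
·⟫ y` is a scalar (`exists_frame_eq_smul`), and so contains such a vector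
(`exists_mem_of_card_le_A`), respectively a multiple of the last simple root, which belongs to the
path (`exists_mem_of_card_le_B`). In rank two, such an orbit consists of the images of one vector
under the powers of `c`, and a reflection composed with a suitable power fixes one of them
(`OrbitPath.exists_mem_mirror`).
-/


set_option linter.unusedSectionVars false

noncomputable section

namespace CoxeterDiagrams

/-! ### Simple reflections and the two halves of the Coxeter element -/

section Basic

variable {n : ℕ} {M : CoxeterMatrix (Fin n)} {V : Type*} [NormedAddCommGroup V]
  [InnerProductSpace ℝ V] [FiniteDimensional ℝ V]

theorem simpleReflection_apply (α : Module.Basis (Fin n) ℝ V) (i : Fin n) (x : V) :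
    simpleReflection α i x = x - (2 * inner ℝ (α i) x / ‖α i‖ ^ 2) • α i := by
  rw [simpleReflection, Submodule.reflection_orthogonal_apply,
    Submodule.reflection_singleton_apply, two_smul, mul_div_assoc, two_mul, add_smul]
  simp

theorem simpleReflection_simpleReflection (α : Module.Basis (Fin n) ℝ V) (i : Fin n) (x : V) :
    simpleReflection α i (simpleReflection α i x) = x :=
  Submodule.reflection_reflection _ x

theorem simpleReflection_self (α : Module.Basis (Fin n) ℝ V) (i : Fin n) :
    simpleReflection α i (α i) = -α i :=
  Submodule.reflection_orthogonalComplement_singleton_eq_neg _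

theorem simpleReflection_eq_self_iff (α : Module.Basis (Fin n) ℝ V) (i : Fin n) (x : V) :
    simpleReflection α i x = x ↔ inner ℝ (α i) x = 0 := by
  have h : ‖α i‖ ≠ 0 := norm_ne_zero_iff.2 (α.ne_zero i)
  rw [simpleReflection_apply, sub_eq_self, smul_eq_zero_iff_left (α.ne_zero i)]
  field_simp
  simp

theorem simpleReflection_mem (α : Module.Basis (Fin n) ℝ V) (i : Fin n) :
    simpleReflection α i ∈ reflectionGroup α :=
  Subgroup.subset_closure ⟨i, rfl⟩

theorem mem_orbit_self (α : Module.Basis (Fin n) ℝ V) (x : V) : x ∈ orbit α x :=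
  ⟨1, one_mem _, rfl⟩

theorem apply_mem_orbit {α : Module.Basis (Fin n) ℝ V} {x y : V} (hy : y ∈ orbit α x)
    {g : V ≃ₗᵢ[ℝ] V} (hg : g ∈ reflectionGroup α) : g y ∈ orbit α x := by
  obtain ⟨g', hg', rfl⟩ := hy
  exact ⟨g * g', mul_mem hg hg', rfl⟩

theorem orbit_eq_of_mem {α : Module.Basis (Fin n) ℝ V} {x y : V} (hy : y ∈ orbit α x) :
    orbit α y = orbit α x := by
  obtain ⟨g, hg, rfl⟩ := hy
  ext z
  constructor
  · rintro ⟨k, hk, rfl⟩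
    exact ⟨k * g, mul_mem hk hg, rfl⟩
  · rintro ⟨k, hk, rfl⟩
    exact ⟨k * g⁻¹, mul_mem hk (inv_mem hg), by simp⟩

/-- A set stable under the simple reflections is stable under the reflection group. -/
theorem apply_mem_of_stable {α : Module.Basis (Fin n) ℝ V} {s : Set V}
    (hs : ∀ i, ∀ x ∈ s, simpleReflection α i x ∈ s) {g : V ≃ₗᵢ[ℝ] V}
    (hg : g ∈ reflectionGroup α) {x : V} (hx : x ∈ s) : g x ∈ s := by
  have key : (∀ x ∈ s, g x ∈ s) ∧ ∀ x ∈ s, g⁻¹ x ∈ s := by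
    induction hg using Subgroup.closure_induction with
    | mem g hg =>
      obtain ⟨i, rfl⟩ := hg
      refine ⟨hs i, fun x hx => ?_⟩
      exact hs i x hx
    | one => simp
    | mul a b _ _ ha hb =>
      refine ⟨fun x hx => ha.1 _ (hb.1 x hx), fun x hx => ?_⟩
      rw [mul_inv_rev]
      exact hb.2 _ (ha.2 x hx)
    | inv a _ ha => exact ⟨ha.2, by simpa using ha.1⟩
  exact key.1 x hx

theorem apply_mem_roots {α : Module.Basis (Fin n) ℝ V} {β : V} (hβ : β ∈ roots α)
    {g : V ≃ₗᵢ[ℝ] V} (hg : g ∈ reflectionGroup α) : g β ∈ roots α := by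
  obtain ⟨i, hi⟩ := hβ
  exact ⟨i, apply_mem_orbit hi hg⟩

theorem basis_mem_roots (α : Module.Basis (Fin n) ℝ V) (i : Fin n) : α i ∈ roots α :=
  ⟨i, mem_orbit_self _ _⟩

theorem neg_mem_roots {α : Module.Basis (Fin n) ℝ V} {β : V} (hβ : β ∈ roots α) :
    -β ∈ roots α := by
  obtain ⟨i, g, hg, rfl⟩ := hβ
  exact ⟨i, g * simpleReflection α i, mul_mem hg (simpleReflection_mem α i), by
    simp [simpleReflection_self]⟩

/-- A vector orthogonal to all simple roots vanishes. -/
theorem eq_zero_of_inner_eq_zero (α : Module.Basis (Fin n) ℝ V) {x : V}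
    (h : ∀ i, inner ℝ (α i) x = 0) : x = 0 :=
  InnerProductSpace.ext_inner_left_basis α (fun i => by simp [h i])

namespace SimpleSystem

variable (S : SimpleSystem M V)

theorem inner_eq_zero {i j : Fin n} (hij : i ≠ j) (hs : S.side i = S.side j) :
    inner ℝ (S.α i) (S.α j) = 0 := by
  rw [S.inner_eq, S.bipartite i j hij hs]
  simp

theorem half_mem (ε : Bool) : S.half ε ∈ reflectionGroup S.α :=
  Subgroup.list_prod_mem _ (by simp [simpleReflection_mem])

/-- Since the simple roots of one side are pairwise orthogonal, the product of their reflections is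
an orthogonal reflection in the intersection of their mirrors. -/
theorem half_apply (ε : Bool) (x : V) : S.half ε x =
    x - ∑ i with S.side i = ε, (2 * inner ℝ (S.α i) x / ‖S.α i‖ ^ 2) • S.α i := by
  have key : ∀ l : List (Fin n), l.Nodup → (∀ i ∈ l, S.side i = ε) →
      (l.map (simpleReflection S.α)).prod x =
        x - (l.map fun i => (2 * inner ℝ (S.α i) x / ‖S.α i‖ ^ 2) • S.α i).sum := by
    intro l
    induction l with
    | nil => simp
    | cons a l ih =>
      intro hl hs
      rw [List.nodup_cons] at hl
      have hsum : simpleReflection S.α a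
          (l.map fun i => (2 * inner ℝ (S.α i) x / ‖S.α i‖ ^ 2) • S.α i).sum =
          (l.map fun i => (2 * inner ℝ (S.α i) x / ‖S.α i‖ ^ 2) • S.α i).sum := by
        rw [map_list_sum, List.map_map]
        congr 1
        refine List.map_congr_left fun i hi => ?_
        have hai : a ≠ i := fun h => hl.1 (h ▸ hi)
        simp only [Function.comp, map_smul]
        congr 1
        rw [simpleReflection_eq_self_iff]
        exact S.inner_eq_zero hai ((hs a (by simp)).trans (hs i (by simp [hi])).symm)
      rw [List.map_cons, List.prod_cons, LinearIsometryEquiv.coe_mul, Function.comp,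
        ih hl.2 (fun i hi => hs i (by simp [hi])), map_sub, hsum, simpleReflection_apply,
        List.map_cons, List.sum_cons]
      abel
  have hnd : ((List.finRange n).filter (fun i => S.side i = ε)).Nodup :=
    (List.nodup_finRange n).filter _
  rw [half, key _ hnd (by simp), ← List.sum_toFinset _ hnd]
  congr 2
  ext i
  simp

theorem half_half (ε : Bool) (x : V) : S.half ε (S.half ε x) = x := by
  have h : ∀ j, S.side j = ε → inner ℝ (S.α j) (S.half ε x) = -inner ℝ (S.α j) x := by
    intro j hj
    rw [half_apply, inner_sub_right, inner_sum, Finset.sum_eq_single j]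
    · have := norm_ne_zero_iff.2 (S.α.ne_zero j)
      rw [inner_smul_right, real_inner_self_eq_norm_sq]
      field_simp
      ring
    · intro i hi hij
      rw [inner_smul_right, S.inner_eq_zero hij.symm (hj.trans (Finset.mem_filter.1 hi).2.symm),
        mul_zero]
    · simp [hj]
  rw [half_apply S ε (S.half ε x), Finset.sum_congr rfl (fun j hj => by
    rw [h j (Finset.mem_filter.1 hj).2, mul_neg, neg_div, neg_smul]),
    Finset.sum_neg_distrib, half_apply]
  abel

theorem half_eq_self_iff (ε : Bool) (x : V) :
    S.half ε x = x ↔ ∀ i, S.side i = ε → inner ℝ (S.α i) x = 0 := by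
  constructor
  · intro h i hi
    rw [half_apply, sub_eq_self, Finset.sum_filter] at h
    have h2 := Fintype.linearIndependent_iff.1 S.α.linearIndependent
      (fun i => if S.side i = ε then 2 * inner ℝ (S.α i) x / ‖S.α i‖ ^ 2 else 0)
      (by simpa [ite_smul] using h) i
    have := norm_ne_zero_iff.2 (S.α.ne_zero i)
    simpa [hi, this] using h2
  · intro h
    rw [half_apply, Finset.sum_eq_zero, sub_zero]
    intro i hi
    simp [h i (Finset.mem_filter.1 hi).2]

/-- A simple reflection acts like its half on a vector moved by no other simple reflection of the
same side. -/
theorem half_eq_simpleReflection {ε : Bool} {x : V} {j : Fin n} (hj : S.side j = ε)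
    (h : ∀ i, S.side i = ε → i ≠ j → simpleReflection S.α i x = x) :
    S.half ε x = simpleReflection S.α j x := by
  rw [half_apply, Finset.sum_eq_single j, simpleReflection_apply]
  · intro i hi hij
    have := h i (Finset.mem_filter.1 hi).2 hij
    rw [simpleReflection_eq_self_iff] at this
    simp [this]
  · simp [hj]

theorem half_inv (ε : Bool) : (S.half ε)⁻¹ = S.half ε := by
  refine inv_eq_of_mul_eq_one_left (LinearIsometryEquiv.ext fun x => ?_)
  simp [half_half]

theorem inner_half_half (ε : Bool) (x y : V) :
    inner ℝ (S.half ε x) y = inner ℝ x (S.half ε y) := by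
  rw [← LinearIsometryEquiv.inner_map_map (S.half ε) x, half_half]

end SimpleSystem

end Basic

/-! ### Orbits that form a path -/

section Path

variable {n : ℕ} {M : CoxeterMatrix (Fin n)} {V : Type*} [NormedAddCommGroup V]
  [InnerProductSpace ℝ V] [FiniteDimensional ℝ V]

/-- The orbit `o` consists of the vertices `x 0, …, x (h - 1)` of a path: the simple reflection with
label `lab k` interchanges `x k` and `x (k + 1)`, and apart from this the simple reflections fix all
vertices.  The labels alternate between the two sides of the bipartition.  The differences
`x k - x (k + 1)` are multiples of simple roots with coefficients of one and the same sign, that of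
the factor `κ`. -/
structure OrbitPath (S : SimpleSystem M V) (o : Set V) (h : ℕ) where
  x : ℕ → V
  lab : ℕ → Fin n
  κ : ℝ
  coef : ℕ → ℝ
  three_le : 3 ≤ h
  coef_pos : ∀ k, k + 1 < h → 0 < coef k
  diff : ∀ k, k + 1 < h → κ • (x k - x (k + 1)) = coef k • S.α (lab k)
  step : ∀ k, k + 1 < h → simpleReflection S.α (lab k) (x k) = x (k + 1)
  fix : ∀ k < h, ∀ i, (k + 1 < h → lab k ≠ i) → (∀ j, j + 1 = k → lab j ≠ i) →
    simpleReflection S.α i (x k) = x k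
  alt : ∀ k, k + 2 < h → S.side (lab (k + 1)) = !S.side (lab k)
  surj : ∀ i, ∃ k, k + 1 < h ∧ lab k = i
  mem_iff : ∀ y, y ∈ o ↔ ∃ k < h, x k = y

namespace OrbitPath

variable {S : SimpleSystem M V} {o : Set V} {h : ℕ} (Γ : OrbitPath S o h)

/-- The side of the label of the first edge. -/
def firstSide : Bool := S.side (Γ.lab 0)

theorem step_back {k : ℕ} (hk : k + 1 < h) :
    simpleReflection S.α (Γ.lab k) (Γ.x (k + 1)) = Γ.x k := by
  rw [← Γ.step k hk, simpleReflection_simpleReflection]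

theorem side_lab {k : ℕ} (hk : k + 1 < h) :
    S.side (Γ.lab k) = if k % 2 = 0 then Γ.firstSide else !Γ.firstSide := by
  induction k with
  | zero => simp [firstSide]
  | succ k ih =>
    rw [Γ.alt k hk, ih (by omega)]
    rcases Nat.mod_two_eq_zero_or_one k with h0 | h0
    · rw [if_pos h0, if_neg (by omega)]
    · rw [if_neg (by omega), if_pos (by omega), Bool.not_not]

theorem x_mem {k : ℕ} (hk : k < h) : Γ.x k ∈ o := (Γ.mem_iff _).2 ⟨k, hk, rfl⟩

theorem half_of_lab {ε : Bool} {k : ℕ} (hk : k + 1 < h) (hs : S.side (Γ.lab k) = ε) :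
    S.half ε (Γ.x k) = Γ.x (k + 1) := by
  rw [S.half_eq_simpleReflection hs, Γ.step k hk]
  intro i hi hik
  refine Γ.fix k (by omega) i (fun _ => hik.symm) ?_
  rintro j rfl rfl
  rw [Γ.alt j hk, hi] at hs
  simp at hs

theorem half_of_lab_back {ε : Bool} {k : ℕ} (hk : k + 1 < h) (hs : S.side (Γ.lab k) = ε) :
    S.half ε (Γ.x (k + 1)) = Γ.x k := by
  rw [← Γ.half_of_lab hk hs, S.half_half]

theorem half_first_even {k : ℕ} (hk : k + 1 < h) (he : k % 2 = 0) :
    S.half Γ.firstSide (Γ.x k) = Γ.x (k + 1) :=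
  Γ.half_of_lab hk (by rw [Γ.side_lab hk, if_pos he])

theorem half_second_odd {k : ℕ} (hk : k + 1 < h) (he : k % 2 = 1) :
    S.half (!Γ.firstSide) (Γ.x k) = Γ.x (k + 1) :=
  Γ.half_of_lab hk (by rw [Γ.side_lab hk, if_neg (by omega)])

theorem half_second_zero : S.half (!Γ.firstSide) (Γ.x 0) = Γ.x 0 := by
  rw [S.half_eq_self_iff]
  intro i hi
  rw [← simpleReflection_eq_self_iff]
  have h3 := Γ.three_le
  refine Γ.fix 0 (by omega) i ?_ (by omega)
  rintro - rfl
  simp [firstSide] at hi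

/-- The last vertex of the path is fixed by the half which does not contain the last label. -/
theorem half_last {k : ℕ} (hk : k + 1 = h) {ε : Bool}
    (hε : ε = if k % 2 = 0 then Γ.firstSide else !Γ.firstSide) :
    S.half ε (Γ.x k) = Γ.x k := by
  rw [S.half_eq_self_iff]
  intro i hi
  rw [← simpleReflection_eq_self_iff]
  refine Γ.fix k (by omega) i (by omega) ?_
  rintro j rfl rfl
  rw [Γ.side_lab (by omega), hε] at hi
  rcases Nat.mod_two_eq_zero_or_one j with h0 | h0
  · rw [if_pos h0, if_neg (by omega)] at hi
    simp at hi
  · rw [if_neg (by omega), if_pos (by omega)] at hi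
    simp at hi

/-- The simple roots are multiples of differences of vertices, so the orbit spans. -/
theorem ext_of_eq_on {f g : V →ₗ[ℝ] V} (hfg : ∀ k < h, f (Γ.x k) = g (Γ.x k)) : f = g := by
  refine S.α.ext fun i => ?_
  obtain ⟨k, hk, rfl⟩ := Γ.surj i
  have h1 : S.α (Γ.lab k) = (Γ.coef k)⁻¹ • Γ.κ • (Γ.x k - Γ.x (k + 1)) := by
    rw [Γ.diff k hk, smul_smul, inv_mul_cancel₀ (Γ.coef_pos k hk).ne', one_smul]
  rw [h1]
  simp [hfg k (by omega), hfg (k + 1) hk]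

theorem eq_zero_of_inner {y : V} (hy : ∀ k < h, inner ℝ (Γ.x k) y = 0) : y = 0 := by
  refine eq_zero_of_inner_eq_zero S.α fun i => ?_
  obtain ⟨k, hk, rfl⟩ := Γ.surj i
  have h1 := congrArg (fun v => inner ℝ v y) (Γ.diff k hk)
  simp only [inner_smul_left, inner_sub_left, hy k (by omega), hy (k + 1) hk] at h1
  have := (Γ.coef_pos k hk).ne'
  simpa [this] using h1.symm

/-- Differences of vertices are positive combinations of simple roots. -/
theorem smul_sub_eq_sum {a b : ℕ} (hab : a ≤ b) (hb : b < h) :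
    Γ.κ • (Γ.x a - Γ.x b) = ∑ k ∈ Finset.Ico a b, Γ.coef k • S.α (Γ.lab k) := by
  induction b, hab using Nat.le_induction with
  | base => simp
  | succ b hab ih =>
    rw [Finset.sum_Ico_succ_top hab, ← ih (by omega), ← Γ.diff b hb, ← smul_add]
    congr 1
    abel

theorem repr_smul_sub {a b : ℕ} (hab : a ≤ b) (hb : b < h) (i : Fin n) :
    S.α.repr (Γ.κ • (Γ.x a - Γ.x b)) i =
      ∑ k ∈ Finset.Ico a b, if Γ.lab k = i then Γ.coef k else 0 := by
  rw [Γ.smul_sub_eq_sum hab hb, map_sum, Finset.sum_apply']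
  refine Finset.sum_congr rfl fun k _ => ?_
  simp [Finsupp.single_apply]

theorem repr_smul_sub_nonneg {a b : ℕ} (hab : a ≤ b) (hb : b < h) (i : Fin n) :
    0 ≤ S.α.repr (Γ.κ • (Γ.x a - Γ.x b)) i := by
  rw [Γ.repr_smul_sub hab hb]
  refine Finset.sum_nonneg fun k hk => ?_
  rw [Finset.mem_Ico] at hk
  split_ifs
  exacts [(Γ.coef_pos k (by omega)).le, le_rfl]

theorem repr_smul_sub_pos_iff {a b : ℕ} (hab : a ≤ b) (hb : b < h) (i : Fin n) :
    0 < S.α.repr (Γ.κ • (Γ.x a - Γ.x b)) i ↔ ∃ k, a ≤ k ∧ k < b ∧ Γ.lab k = i := by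
  rw [Γ.repr_smul_sub hab hb, Finset.sum_pos_iff_of_nonneg]
  · constructor
    · rintro ⟨k, hk, h0⟩
      rw [Finset.mem_Ico] at hk
      refine ⟨k, hk.1, hk.2, ?_⟩
      by_contra hne
      simp [hne] at h0
    · rintro ⟨k, h1, h2, rfl⟩
      exact ⟨k, Finset.mem_Ico.2 ⟨h1, h2⟩, by simpa using Γ.coef_pos k (by omega)⟩
  · intro k hk
    rw [Finset.mem_Ico] at hk
    split_ifs
    exacts [(Γ.coef_pos k (by omega)).le, le_rfl]

theorem x_inj {a b : ℕ} (ha : a < h) (hb : b < h) (hab : Γ.x a = Γ.x b) : a = b := by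
  wlog hlt : a ≤ b generalizing a b
  · exact (this hb ha hab.symm (by omega)).symm
  by_contra hne
  have := (Γ.repr_smul_sub_pos_iff hlt hb (Γ.lab a)).2 ⟨a, le_rfl, by omega, rfl⟩
  simp [hab] at this

end OrbitPath

end Path

/-! ### The rotation of a path orbit -/

/-- The zigzag `0, 1, -1, 2, -2, …`. -/
def zag (k : ℕ) : ℤ := if k % 2 = 0 then -((k / 2 : ℕ) : ℤ) else (((k + 1) / 2 : ℕ) : ℤ)

theorem zag_even {k : ℕ} (hk : k % 2 = 0) : zag k = -((k / 2 : ℕ) : ℤ) := if_pos hk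

theorem zag_odd {k : ℕ} (hk : k % 2 = 1) : zag k = (((k + 1) / 2 : ℕ) : ℤ) :=
  if_neg (by omega)

/-- The first `h` terms of the zigzag represent all residue classes modulo `h`. -/
theorem exists_dvd_sub_zag {h : ℕ} (hh : 0 < h) (j : ℤ) : ∃ k < h, (h : ℤ) ∣ j - zag k := by
  have h1 := Int.emod_nonneg j (b := (h : ℤ)) (by omega)
  have h2 := Int.emod_lt_of_pos j (b := (h : ℤ)) (by omega)
  have h3 : (h : ℤ) ∣ j - j % h := Int.dvd_self_sub_emod
  obtain ⟨r, hr⟩ := Int.eq_ofNat_of_zero_le h1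
  rw [hr] at h2 h3
  rcases Nat.eq_zero_or_pos r with h0 | h0
  · exact ⟨0, hh, by simpa [zag, h0] using h3⟩
  by_cases hrh : 2 * r ≤ h
  · refine ⟨2 * r - 1, by omega, ?_⟩
    rw [zag_odd (by omega)]
    convert h3 using 3
    omega
  · refine ⟨2 * (h - r), by omega, ?_⟩
    rw [zag_even (by omega)]
    have : j - -((2 * (h - r) / 2 : ℕ) : ℤ) = (j - r) + h := by omega
    rw [this]
    exact dvd_add h3 dvd_rfl

theorem zag_inj_of_dvd {h a b : ℕ} (ha : a < h) (hb : b < h) (hab : (h : ℤ) ∣ zag a - zag b) :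
    a = b := by
  have h1 : |zag a - zag b| < h := by
    unfold zag
    split_ifs <;> rw [abs_lt] <;> omega
  have h2 := Int.eq_zero_of_abs_lt_dvd hab h1
  unfold zag at h2
  split_ifs at h2 <;> omega

section Path

variable {n : ℕ} {M : CoxeterMatrix (Fin n)} {V : Type*} [NormedAddCommGroup V]
  [InnerProductSpace ℝ V] [FiniteDimensional ℝ V] {S : SimpleSystem M V} {o : Set V} {h : ℕ}

namespace OrbitPath

variable (Γ : OrbitPath S o h)

/-- The Coxeter element or its inverse, such that the second factor fixes the first vertex. -/
def turn : V ≃ₗᵢ[ℝ] V := S.half Γ.firstSide * S.half (!Γ.firstSide)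

theorem turn_eq : Γ.turn = S.coxeterElement ∨ Γ.turn = S.coxeterElement⁻¹ := by
  rw [turn, SimpleSystem.coxeterElement, mul_inv_rev, S.half_inv, S.half_inv]
  cases Γ.firstSide <;> simp

theorem turn_inv : Γ.turn⁻¹ = S.half (!Γ.firstSide) * S.half Γ.firstSide := by
  rw [turn, mul_inv_rev, S.half_inv (!Γ.firstSide), S.half_inv Γ.firstSide]

theorem half_mul_turn (ε : Bool) : S.half ε * Γ.turn = Γ.turn⁻¹ * S.half ε := by
  have hm : ∀ ε, S.half ε * S.half ε = 1 := fun ε =>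
    LinearIsometryEquiv.ext fun x => S.half_half ε x
  rw [turn_inv, turn]
  by_cases hε : ε = Γ.firstSide
  · rw [hε, ← mul_assoc, hm, one_mul, mul_assoc, hm, mul_one]
  · rw [Bool.eq_not_of_ne hε, mul_assoc]

/-- The vertices of the path in their cyclic order. -/
def z (j : ℤ) : V := (Γ.turn ^ j) (Γ.x 0)

theorem turn_zpow_z (i j : ℤ) : (Γ.turn ^ i) (Γ.z j) = Γ.z (i + j) := by
  rw [z, z, zpow_add, LinearIsometryEquiv.coe_mul, Function.comp]

theorem turn_z (j : ℤ) : Γ.turn (Γ.z j) = Γ.z (j + 1) := by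
  have := Γ.turn_zpow_z 1 j
  rwa [zpow_one, add_comm] at this

theorem turn_inv_z (j : ℤ) : Γ.turn⁻¹ (Γ.z j) = Γ.z (j - 1) := by
  have := Γ.turn_zpow_z (-1) j
  rwa [zpow_neg_one, neg_add_eq_sub] at this

theorem half_second_turn_zpow (j : ℤ) (v : V) : S.half (!Γ.firstSide) ((Γ.turn ^ j) v) =
    (Γ.turn ^ (-j)) (S.half (!Γ.firstSide) v) := by
  have h1 : S.half (!Γ.firstSide) * Γ.turn ^ j * (S.half (!Γ.firstSide))⁻¹ = Γ.turn ^ (-j) := by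
    rw [← conj_zpow, zpow_neg, ← inv_zpow, half_mul_turn, mul_inv_cancel_right]
  rw [← h1, S.half_inv]
  simp [S.half_half]

theorem half_second_z (j : ℤ) : S.half (!Γ.firstSide) (Γ.z j) = Γ.z (-j) := by
  rw [z, half_second_turn_zpow, half_second_zero, z]

theorem half_first_z (j : ℤ) : S.half Γ.firstSide (Γ.z j) = Γ.z (1 - j) := by
  have h1 := Γ.turn_z (-j)
  rw [← Γ.half_second_z, turn, LinearIsometryEquiv.coe_mul, Function.comp, S.half_half] at h1
  rw [h1, neg_add_eq_sub]

/-- Each half of the Coxeter element reverses the cyclic order. -/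
theorem half_z (ε : Bool) (j : ℤ) :
    S.half ε (Γ.z j) = Γ.z ((if ε = Γ.firstSide then 1 else 0) - j) := by
  by_cases hε : ε = Γ.firstSide
  · rw [if_pos hε, hε, half_first_z]
  · rw [if_neg hε, Bool.eq_not_of_ne hε, half_second_z, zero_sub]

theorem z_zag {k : ℕ} (hk : k < h) : Γ.z (zag k) = Γ.x k := by
  induction k with
  | zero => simp [z, zag]
  | succ k ih =>
    rcases Nat.mod_two_eq_zero_or_one k with h0 | h0
    · rw [← Γ.half_first_even hk h0, ← ih (by omega), half_first_z, zag_even h0,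
        zag_odd (by omega)]
      congr 1
      omega
    · rw [← Γ.half_second_odd hk h0, ← ih (by omega), half_second_z, zag_odd h0,
        zag_even (by omega)]

/-- The cyclic order closes up after `h` steps, since the last vertex of the path is fixed by one of
the two halves of the Coxeter element. -/
theorem z_add_h (j : ℤ) : Γ.z (j + h) = Γ.z j := by
  have h3 := Γ.three_le
  have key : ∃ a, Γ.z (a + h) = Γ.z a := by
    have hlast := Γ.half_last (k := h - 1) (by omega) rfl
    rw [← Γ.z_zag (by omega)] at hlast
    rcases Nat.mod_two_eq_zero_or_one (h - 1) with h0 | h0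
    · rw [if_pos h0, half_first_z] at hlast
      refine ⟨zag (h - 1), ?_⟩
      rw [← hlast, zag_even h0]
      congr 1
      omega
    · rw [if_neg (by omega), half_second_z] at hlast
      refine ⟨-zag (h - 1), ?_⟩
      rw [hlast, zag_odd h0]
      congr 1
      omega
  obtain ⟨a, ha⟩ := key
  have h1 := congrArg (Γ.turn ^ (j - a)) ha
  rw [turn_zpow_z, turn_zpow_z] at h1
  convert h1 using 2 <;> ring

theorem z_add_mul (j t : ℤ) : Γ.z (j + h * t) = Γ.z j := by
  induction t using Int.induction_on with
  | zero => simp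
  | succ t ih => rw [← ih, ← Γ.z_add_h (j + h * t)]; congr 1; ring
  | pred t ih => rw [← ih, ← Γ.z_add_h (j + h * (-t - 1))]; congr 1; ring

theorem z_eq_iff (i j : ℤ) : Γ.z i = Γ.z j ↔ (h : ℤ) ∣ i - j := by
  have h3 := Γ.three_le
  constructor
  · intro hij
    obtain ⟨a, ha, s, hs⟩ := exists_dvd_sub_zag (h := h) (by omega) i
    obtain ⟨b, hb, t, ht⟩ := exists_dvd_sub_zag (h := h) (by omega) j
    have ha' : Γ.z i = Γ.x a := by rw [← Γ.z_zag ha, ← Γ.z_add_mul (zag a) s]; congr 1; omega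
    have hb' : Γ.z j = Γ.x b := by rw [← Γ.z_zag hb, ← Γ.z_add_mul (zag b) t]; congr 1; omega
    have hab := Γ.x_inj ha hb (by rw [← ha', hij, hb'])
    subst hab
    exact ⟨s - t, by rw [mul_sub]; omega⟩
  · rintro ⟨t, ht⟩
    rw [← Γ.z_add_mul j t]
    congr 1
    omega

theorem z_mem (j : ℤ) : Γ.z j ∈ o := by
  have h3 := Γ.three_le
  obtain ⟨a, ha, hs⟩ := exists_dvd_sub_zag (h := h) (by omega) j
  rw [(Γ.z_eq_iff _ _).2 hs, Γ.z_zag ha]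
  exact Γ.x_mem ha

theorem exists_z {y : V} (hy : y ∈ o) : ∃ j, Γ.z j = y := by
  obtain ⟨k, hk, rfl⟩ := (Γ.mem_iff y).1 hy
  exact ⟨zag k, Γ.z_zag hk⟩

theorem orderOf_turn : orderOf Γ.turn = h := by
  refine Nat.dvd_antisymm (orderOf_dvd_of_pow_eq_one ?_) ?_
  -- the vertices of the path span the space
  · have h1 : ((Γ.turn ^ h : V ≃ₗᵢ[ℝ] V).toLinearEquiv : V →ₗ[ℝ] V) = LinearMap.id := by
      refine Γ.ext_of_eq_on fun k hk => ?_
      have h2 := Γ.turn_zpow_z h (zag k)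
      rw [zpow_natCast, add_comm, z_add_h, z_zag _ hk] at h2
      exact h2
    exact LinearIsometryEquiv.ext fun v => LinearMap.congr_fun h1 v
  · have h1 := Γ.turn_zpow_z (orderOf Γ.turn) 0
    rw [zpow_natCast, pow_orderOf_eq_one, add_zero] at h1
    have h2 := (Γ.z_eq_iff 0 _).1 h1
    rw [zero_sub, dvd_neg] at h2
    exact_mod_cast h2

theorem coxeterNumber_eq (Γ : OrbitPath S o h) : S.coxeterNumber = h := by
  rw [SimpleSystem.coxeterNumber, ← Γ.orderOf_turn]
  rcases Γ.turn_eq with h1 | h1 <;> rw [h1]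
  exact (orderOf_inv _).symm

/-! ### The Coxeter plane -/

theorem mem_coxeterPlane_iff (y : V) : y ∈ S.coxeterPlane ↔
    Γ.turn y + Γ.turn⁻¹ y = (2 * Real.cos (2 * Real.pi / h)) • y := by
  change S.coxeterElement y + S.coxeterElement⁻¹ y =
    (2 * Real.cos (2 * Real.pi / (S.coxeterNumber : ℝ))) • y ↔ _
  rw [Γ.coxeterNumber_eq]
  rcases Γ.turn_eq with h1 | h1 <;> rw [h1]
  rw [inv_inv, add_comm]

theorem half_turn (ε : Bool) (y : V) : S.half ε (Γ.turn y) = Γ.turn⁻¹ (S.half ε y) := by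
  exact congrArg (fun g => g y) (Γ.half_mul_turn ε)

theorem half_turn_inv (ε : Bool) (y : V) : S.half ε (Γ.turn⁻¹ y) = Γ.turn (S.half ε y) := by
  have h1 := Γ.half_turn ε (S.half ε (Γ.turn⁻¹ y))
  have h2 := congrArg Γ.turn (Γ.half_turn ε (Γ.turn⁻¹ y))
  have h3 : Γ.turn (Γ.turn⁻¹ y) = y := Γ.turn.apply_symm_apply y
  have h4 : Γ.turn (Γ.turn⁻¹ (S.half ε (Γ.turn⁻¹ y))) = S.half ε (Γ.turn⁻¹ y) :=
    Γ.turn.apply_symm_apply _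
  rw [h3, h4] at h2
  exact h2.symm

theorem half_mem_plane (Γ : OrbitPath S o h) (ε : Bool) {y : V} (hy : y ∈ S.coxeterPlane) :
    S.half ε y ∈ S.coxeterPlane := by
  rw [Γ.mem_coxeterPlane_iff] at hy ⊢
  rw [← Γ.half_turn, ← Γ.half_turn_inv, ← map_add, add_comm, hy, map_smul]

/-- The halves of the Coxeter element preserve the Coxeter plane, hence commute with the
projection. -/
theorem proj_half (Γ : OrbitPath S o h) (ε : Bool) (y : V) :
    S.proj (S.half ε y) = S.half ε (S.proj y) := by
  refine Submodule.eq_starProjection_of_mem_of_inner_eq_zero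
    (Γ.half_mem_plane ε (Submodule.starProjection_apply_mem _ _)) fun w hw => ?_
  rw [← map_sub, S.inner_half_half]
  exact Submodule.starProjection_inner_eq_zero _ _ (Γ.half_mem_plane ε hw)

theorem proj_turn (y : V) : S.proj (Γ.turn y) = Γ.turn (S.proj y) := by
  rw [turn, LinearIsometryEquiv.coe_mul, Function.comp, Function.comp, Γ.proj_half, Γ.proj_half]

theorem proj_turn_inv (y : V) : S.proj (Γ.turn⁻¹ y) = Γ.turn⁻¹ (S.proj y) := by
  rw [turn_inv, LinearIsometryEquiv.coe_mul, Function.comp,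
    Function.comp, Γ.proj_half, Γ.proj_half]

end OrbitPath

end Path

/-! ### The projection to the Coxeter plane -/

/-- A solution of a two-sided linear recurrence of order two is determined by two consecutive
values. -/
theorem eq_of_recurrence {E : Type*} [AddCommGroup E] [Module ℝ E] {C : ℝ} {f g : ℤ → E}
    (hf : ∀ j, f (j + 1) + f (j - 1) = C • f j) (hg : ∀ j, g (j + 1) + g (j - 1) = C • g j)
    (h0 : f 0 = g 0) (h1 : f 1 = g 1) : f = g := by
  have key : ∀ j : ℤ, f j = g j ∧ f (j + 1) = g (j + 1) := by
    intro j
    induction j using Int.induction_on with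
    | zero => exact ⟨h0, h1⟩
    | succ j ih =>
      refine ⟨ih.2, ?_⟩
      have h2 := hf (j + 1)
      rw [ih.2, ← hg, add_sub_cancel_right, ih.1] at h2
      exact add_right_cancel h2
    | pred j ih =>
      have h2 := hf (-j)
      rw [ih.1, ← hg, ih.2] at h2
      exact ⟨add_left_cancel h2, by rw [sub_add_cancel]; exact ih.1⟩
  exact funext fun j => (key j).1

section Path

variable {n : ℕ} {M : CoxeterMatrix (Fin n)} {V : Type*} [NormedAddCommGroup V]
  [InnerProductSpace ℝ V] [FiniteDimensional ℝ V] {S : SimpleSystem M V} {o : Set V} {h : ℕ}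

namespace OrbitPath

variable (Γ : OrbitPath S o h)

/-- The angle of the rotation which the Coxeter element induces on the Coxeter plane. -/
def angle (_ : OrbitPath S o h) : ℝ := 2 * Real.pi / h

theorem h_pos (Γ : OrbitPath S o h) : (0 : ℝ) < h := by
  have := Γ.three_le
  exact_mod_cast (by omega : 0 < h)

theorem angle_mul_h : Γ.angle * h = 2 * Real.pi := by
  have := Γ.h_pos
  rw [angle]
  field_simp

theorem angle_pos : 0 < Γ.angle := div_pos (by positivity) Γ.h_pos

theorem angle_lt_pi : Γ.angle < Real.pi := by
  have h3 : (3 : ℝ) ≤ h := by exact_mod_cast Γ.three_le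
  rw [angle, div_lt_iff₀ Γ.h_pos]
  nlinarith [Real.pi_pos]

theorem sin_angle_pos : 0 < Real.sin Γ.angle :=
  Real.sin_pos_of_pos_of_lt_pi Γ.angle_pos Γ.angle_lt_pi

theorem cos_angle_lt_one : Real.cos Γ.angle < 1 := by
  rw [← Real.cos_zero]
  exact Real.cos_lt_cos_of_nonneg_of_le_pi le_rfl Γ.angle_lt_pi.le Γ.angle_pos

theorem mem_plane_iff (y : V) : y ∈ S.coxeterPlane ↔
    Γ.turn y + Γ.turn⁻¹ y = (2 * Real.cos Γ.angle) • y :=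
  Γ.mem_coxeterPlane_iff y

theorem turn_turn_inv (y : V) : Γ.turn (Γ.turn⁻¹ y) = y := Γ.turn.apply_symm_apply y

theorem turn_inv_turn (y : V) : Γ.turn⁻¹ (Γ.turn y) = y := Γ.turn.symm_apply_apply y

open Classical in
/-- Sums over the vertices are invariant under the rotation. -/
theorem sum_turn {E : Type*} [AddCommMonoid E] (F : V → E) :
    ∑ k ∈ Finset.range h, F (Γ.turn (Γ.x k)) = ∑ k ∈ Finset.range h, F (Γ.x k) := by
  have hinj : Set.InjOn Γ.x (Finset.range h) := fun a ha b hb hab =>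
    Γ.x_inj (by simpa using ha) (by simpa using hb) hab
  have hmem : ∀ y, y ∈ (Finset.range h).image Γ.x ↔ y ∈ o := by
    intro y
    simp [Γ.mem_iff]
  rw [← Finset.sum_image (f := fun y => F (Γ.turn y)) hinj, ← Finset.sum_image (f := F) hinj]
  refine Finset.sum_nbij' Γ.turn (Γ.turn⁻¹ : V ≃ₗᵢ[ℝ] V) ?_ ?_ ?_ ?_ ?_
  · intro y hy
    rw [hmem] at hy ⊢
    obtain ⟨j, rfl⟩ := Γ.exists_z hy
    rw [Γ.turn_z]
    exact Γ.z_mem _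
  · intro y hy
    rw [hmem] at hy ⊢
    obtain ⟨j, rfl⟩ := Γ.exists_z hy
    rw [Γ.turn_inv_z]
    exact Γ.z_mem _
  · intro y _
    exact Γ.turn_inv_turn y
  · intro y _
    exact Γ.turn_turn_inv y
  · intro y _
    rfl

/-- Summation by parts along the path. -/
theorem sum_by_parts (B : ℕ → ℝ) (h0 : B 0 = 0) (m : ℕ) :
    ∑ k ∈ Finset.range (m + 1), (B (k + 1) - B k) • Γ.x k =
      B (m + 1) • Γ.x m + ∑ k ∈ Finset.range m, B (k + 1) • (Γ.x k - Γ.x (k + 1)) := by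
  induction m with
  | zero => simp [h0]
  | succ m ih =>
    rw [Finset.sum_range_succ, ih, Finset.sum_range_succ (n := m)]
    module

/-- The Coxeter plane is nonzero: it contains the combination of the vertices of the path with the
coefficients `cos ((k + 1/2) π / h)`, which after a summation by parts becomes a combination of
simple roots with coefficients of the same sign. -/
theorem exists_mem_plane_ne_zero (Γ : OrbitPath S o h) : ∃ y ∈ S.coxeterPlane, y ≠ 0 := by
  classical
  have h3 := Γ.three_le
  have hpos := Γ.h_pos
  -- `f` is a function on the orbit with `f (z j) = cos (2 π j / h - π / (2 h))`
  obtain ⟨f, hf⟩ : ∃ f : V → ℝ, ∀ j : ℤ, f (Γ.z j) = Real.cos (Γ.angle * j - Γ.angle / 4) := by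
    refine ⟨fun y => if hy : ∃ j : ℤ, Γ.z j = y then
      Real.cos (Γ.angle * hy.choose - Γ.angle / 4) else 0, fun j => ?_⟩
    have hy : ∃ i : ℤ, Γ.z i = Γ.z j := ⟨j, rfl⟩
    simp only [dif_pos hy]
    obtain ⟨t, ht⟩ := (Γ.z_eq_iff _ _).1 hy.choose_spec
    have ht' : (hy.choose : ℝ) = j + h * t := by exact_mod_cast (by omega)
    rw [ht', ← Real.cos_add_int_mul_two_pi (Γ.angle * j - Γ.angle / 4) t, ← Γ.angle_mul_h]
    congr 1
    ring
  have hrec : ∀ j : ℤ, f (Γ.z (j - 1)) + f (Γ.z (j + 1)) =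
      2 * Real.cos Γ.angle * f (Γ.z j) := by
    intro j
    rw [hf, hf, hf, mul_right_comm, Real.two_mul_cos_mul_cos]
    push_cast
    congr 2 <;> ring
  have hfx : ∀ k < h, f (Γ.x k) = Real.cos ((k + 1 / 2) * (Γ.angle / 2)) := by
    intro k hk
    rw [← Γ.z_zag hk, hf]
    rcases Nat.mod_two_eq_zero_or_one k with h0 | h0
    · rw [zag_even h0, ← Real.cos_neg]
      obtain ⟨m, rfl⟩ : ∃ m, k = 2 * m := ⟨k / 2, by omega⟩
      rw [Nat.mul_div_cancel_left _ two_pos]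
      push_cast
      congr 1
      ring
    · rw [zag_odd h0]
      obtain ⟨m, rfl⟩ : ∃ m, k = 2 * m + 1 := ⟨k / 2, by omega⟩
      rw [show (2 * m + 1 + 1) / 2 = m + 1 by omega]
      push_cast
      congr 1
      ring
  refine ⟨∑ k ∈ Finset.range h, f (Γ.x k) • Γ.x k, ?_, ?_⟩
  · rw [Γ.mem_plane_iff]
    have h1 : Γ.turn (∑ k ∈ Finset.range h, f (Γ.x k) • Γ.x k) =
        ∑ k ∈ Finset.range h, f (Γ.turn⁻¹ (Γ.x k)) • Γ.x k := by
      rw [map_sum, ← Γ.sum_turn (fun y => f (Γ.turn⁻¹ y) • y)]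
      refine Finset.sum_congr rfl fun k _ => ?_
      rw [map_smul, turn_inv_turn]
    have h2 : Γ.turn⁻¹ (∑ k ∈ Finset.range h, f (Γ.x k) • Γ.x k) =
        ∑ k ∈ Finset.range h, f (Γ.turn (Γ.x k)) • Γ.x k := by
      rw [map_sum, ← Γ.sum_turn (fun y => Γ.turn⁻¹ (f y • y))]
      refine Finset.sum_congr rfl fun k _ => ?_
      rw [map_smul, turn_inv_turn]
    rw [h1, h2, ← Finset.sum_add_distrib, Finset.smul_sum]
    refine Finset.sum_congr rfl fun k hk => ?_
    rw [← add_smul, smul_smul, ← Γ.z_zag (Finset.mem_range.1 hk), turn_z, turn_inv_z, hrec]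
  -- multiplication by `2 sin (π / (2 h))` turns the coefficients into differences of sines
  · set B : ℕ → ℝ := fun k => Real.sin (k * (Γ.angle / 2)) with hB
    have hs : 0 < Real.sin (Γ.angle / 4) :=
      Real.sin_pos_of_pos_of_lt_pi (by linarith [Γ.angle_pos])
        (by linarith [Γ.angle_pos, Γ.angle_lt_pi])
    have hBpos : ∀ k, 0 < k → k < h → 0 < B k := by
      intro k hk0 hk
      have hk' : (k : ℝ) < h := by exact_mod_cast hk
      have hk0' : (0 : ℝ) < k := by exact_mod_cast hk0
      refine Real.sin_pos_of_pos_of_lt_pi (mul_pos hk0' (by linarith [Γ.angle_pos])) ?_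
      have := Γ.angle_mul_h
      nlinarith [Γ.angle_pos]
    have hBh : B h = 0 := by
      have : (h : ℝ) * (Γ.angle / 2) = Real.pi := by linarith [Γ.angle_mul_h]
      rw [hB]
      simp only [this, Real.sin_pi]
    have hmul : (2 * Real.sin (Γ.angle / 4)) • ∑ k ∈ Finset.range h, f (Γ.x k) • Γ.x k =
        ∑ k ∈ Finset.range (h - 1), B (k + 1) • (Γ.x k - Γ.x (k + 1)) := by
      have hsum := Γ.sum_by_parts B (by simp [hB]) (h - 1)
      rw [Nat.sub_add_cancel (by omega), hBh, zero_smul, zero_add] at hsum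
      rw [← hsum, Finset.smul_sum]
      refine Finset.sum_congr rfl fun k hk => ?_
      rw [smul_smul, hfx k (Finset.mem_range.1 hk), Real.two_mul_sin_mul_cos, hB]
      congr 1
      rw [← neg_sub, Real.sin_neg]
      push_cast
      rw [neg_add_eq_sub]
      congr 2 <;> ring
    intro h0
    rw [h0, smul_zero] at hmul
    have h1 := congrArg (fun v => S.α.repr (Γ.κ • v) (Γ.lab 0)) hmul
    simp only [smul_zero, map_zero, Finsupp.zero_apply, Finset.smul_sum, map_sum,
      Finset.sum_apply'] at h1
    refine absurd h1.symm (ne_of_gt (Finset.sum_pos' ?_ ⟨0, ?_, ?_⟩))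
    · intro k hk
      rw [Finset.mem_range] at hk
      rw [smul_comm, map_smul, Finsupp.smul_apply, smul_eq_mul]
      exact mul_nonneg (hBpos _ (by omega) (by omega)).le
        (Γ.repr_smul_sub_nonneg (Nat.le_succ k) (by omega) _)
    · simp only [Finset.mem_range]
      omega
    · rw [smul_comm, map_smul, Finsupp.smul_apply, smul_eq_mul]
      exact mul_pos (hBpos _ (by omega) (by omega))
        ((Γ.repr_smul_sub_pos_iff (Nat.le_succ 0) (by omega) _).2 ⟨0, le_rfl, by omega, rfl⟩)

/-- The rotation fixes no nonzero vector of the Coxeter plane. -/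
theorem eq_zero_of_turn_eq {y : V} (hy : y ∈ S.coxeterPlane) (ht : Γ.turn y = y) : y = 0 := by
  have h1 := (Γ.mem_plane_iff y).1 hy
  have h2 : Γ.turn⁻¹ y = y := by
    conv_lhs => rw [← ht]
    exact Γ.turn_inv_turn y
  rw [ht, h2, ← two_smul ℝ, ← sub_eq_zero, ← sub_smul, smul_eq_zero] at h1
  refine h1.resolve_left fun h0 => ?_
  linarith [Γ.cos_angle_lt_one]

theorem inner_turn_self {y : V} (hy : y ∈ S.coxeterPlane) :
    inner ℝ (Γ.turn y) y = Real.cos Γ.angle * ‖y‖ ^ 2 := by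
  have h1 := congrArg (inner ℝ y) ((Γ.mem_plane_iff y).1 hy)
  have h2 : inner ℝ y (Γ.turn⁻¹ y) = inner ℝ (Γ.turn y) y := by
    rw [← Γ.turn.inner_map_map y, turn_turn_inv]
  rw [inner_add_right, h2, real_inner_comm, inner_smul_right, real_inner_self_eq_norm_sq] at h1
  linarith

theorem proj_z_mem (j : ℤ) : S.proj (Γ.z j) ∈ S.coxeterPlane :=
  Submodule.starProjection_apply_mem _ _

theorem inner_proj (_ : OrbitPath S o h) {y : V} (hy : y ∈ S.coxeterPlane) (v : V) :
    inner ℝ (S.proj v) y = inner ℝ v y := by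
  rw [SimpleSystem.proj, Submodule.inner_starProjection_left_eq_right,
    Submodule.starProjection_eq_self_iff.2 hy]

theorem turn_proj_z (j : ℤ) : Γ.turn (S.proj (Γ.z j)) = S.proj (Γ.z (j + 1)) := by
  rw [← Γ.proj_turn, turn_z]

theorem turn_inv_proj_z (j : ℤ) : Γ.turn⁻¹ (S.proj (Γ.z j)) = S.proj (Γ.z (j - 1)) := by
  rw [← Γ.proj_turn_inv, turn_inv_z]

theorem norm_proj_z (j : ℤ) : ‖S.proj (Γ.z j)‖ = ‖S.proj (Γ.z 0)‖ := by
  induction j using Int.induction_on with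
  | zero => rfl
  | succ j ih => rw [← turn_proj_z, LinearIsometryEquiv.norm_map, ih]
  | pred j ih => rw [← turn_inv_proj_z, LinearIsometryEquiv.norm_map, ih]

theorem norm_proj_z_pos : 0 < ‖S.proj (Γ.z 0)‖ := by
  refine lt_of_le_of_ne (norm_nonneg _) fun h0 => ?_
  obtain ⟨y, hy, hy0⟩ := Γ.exists_mem_plane_ne_zero
  refine hy0 (Γ.eq_zero_of_inner fun k hk => ?_)
  rw [← Γ.inner_proj hy, ← Γ.z_zag hk, norm_eq_zero.1 ((Γ.norm_proj_z _).trans h0.symm),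
    inner_zero_left]

theorem proj_z_recurrence (j : ℤ) : S.proj (Γ.z (j + 1)) + S.proj (Γ.z (j - 1)) =
    (2 * Real.cos Γ.angle) • S.proj (Γ.z j) := by
  rw [← turn_proj_z, ← turn_inv_proj_z, (Γ.mem_plane_iff _).1 (Γ.proj_z_mem j)]

/-- A vector of the Coxeter plane orthogonal to the projections of two consecutive vertices
vanishes. -/
theorem eq_zero_of_inner_two {y : V} (hy : y ∈ S.coxeterPlane) {i : ℤ}
    (h0 : inner ℝ (S.proj (Γ.z i)) y = 0) (h1 : inner ℝ (S.proj (Γ.z (i + 1))) y = 0) :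
    y = 0 := by
  have key : (fun j : ℤ => inner ℝ (S.proj (Γ.z (i + j))) y) = fun _ => 0 := by
    refine eq_of_recurrence (C := 2 * Real.cos Γ.angle) (fun j => ?_) (by simp) (by simpa) h1
    rw [← add_assoc, ← add_sub_assoc, ← inner_add_left, Γ.proj_z_recurrence, inner_smul_left]
    rfl
  refine Γ.eq_zero_of_inner fun k hk => ?_
  rw [← Γ.inner_proj hy, ← Γ.z_zag hk]
  simpa using congrFun key (zag k - i)

theorem inner_proj_z (i j : ℤ) : inner ℝ (S.proj (Γ.z (i + j))) (S.proj (Γ.z i)) =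
    Real.cos (Γ.angle * j) * ‖S.proj (Γ.z i)‖ ^ 2 := by
  refine congrFun (eq_of_recurrence (C := 2 * Real.cos Γ.angle)
    (f := fun j : ℤ => inner ℝ (S.proj (Γ.z (i + j))) (S.proj (Γ.z i)))
    (g := fun j : ℤ => Real.cos (Γ.angle * j) * ‖S.proj (Γ.z i)‖ ^ 2)
    (fun j => ?_) (fun j => ?_) (by simp) ?_) j
  · rw [← add_assoc, ← add_sub_assoc, ← inner_add_left, Γ.proj_z_recurrence, inner_smul_left]
    rfl
  · have := Real.two_mul_cos_mul_cos (Γ.angle * j) Γ.angle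
    push_cast
    rw [mul_add, mul_sub, mul_one, smul_eq_mul]
    linear_combination -‖S.proj (Γ.z i)‖ ^ 2 * this
  · rw [← turn_proj_z, Γ.inner_turn_self (Γ.proj_z_mem i), Int.cast_one, mul_one]

theorem proj_z_inj {i j : ℤ} (hij : S.proj (Γ.z i) = S.proj (Γ.z j)) : (h : ℤ) ∣ i - j := by
  have h1 := Γ.inner_proj_z j (i - j)
  have hp := Γ.norm_proj_z_pos
  rw [← Γ.norm_proj_z j] at hp
  rw [add_sub_cancel, hij, real_inner_self_eq_norm_sq, eq_comm, mul_eq_right₀ (by positivity),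
    Real.cos_eq_one_iff] at h1
  obtain ⟨t, ht⟩ := h1
  refine ⟨t, ?_⟩
  rw [← Γ.angle_mul_h, mul_comm, mul_assoc] at ht
  have := mul_left_cancel₀ Γ.angle_pos.ne' ht
  exact_mod_cast this.symm

end OrbitPath

end Path

/-! ### Vectors and lines in a plane with an orthonormal basis -/

section Plane

variable {V : Type*} [NormedAddCommGroup V] [InnerProductSpace ℝ V]

/-- The unit vector with direction angle `t` in the plane with orthonormal basis `u, w`. -/
def dir (u w : V) (t : ℝ) : V := Real.cos t • u + Real.sin t • w

theorem ngon_eq_dir (u w : V) (r θ : ℝ) (N : ℕ) (k : ℤ) :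
    ngon u w r θ N k = r • dir u w (2 * Real.pi * k / N + θ) := rfl

theorem dir_add_two_pi_mul (u w : V) (t : ℝ) (k : ℤ) :
    dir u w (t + k * (2 * Real.pi)) = dir u w t := by
  rw [dir, dir, Real.cos_add_int_mul_two_pi, Real.sin_add_int_mul_two_pi]

theorem dir_recurrence (u w : V) (s t : ℝ) :
    dir u w (t + s) + dir u w (t - s) = (2 * Real.cos s) • dir u w t := by
  simp only [dir, Real.cos_add, Real.cos_sub, Real.sin_add, Real.sin_sub]
  module

theorem dir_add_pi (u w : V) (t : ℝ) : dir u w (t + Real.pi) = -dir u w t := by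
  simp only [dir, Real.cos_add_pi, Real.sin_add_pi]
  module

theorem norm_eq_one_of_inner {x : V} (hx : inner ℝ x x = 1) : ‖x‖ = 1 := by
  rw [real_inner_self_eq_norm_sq] at hx
  exact (sq_eq_sq₀ (norm_nonneg _) zero_le_one).1 (by rw [hx, one_pow])

variable {u w : V}

theorem inner_dir_dir (hu : ‖u‖ = 1) (hw : ‖w‖ = 1) (huw : inner ℝ u w = 0) (s t : ℝ) :
    inner ℝ (dir u w s) (dir u w t) = Real.cos (s - t) := by
  simp only [dir, inner_add_left, inner_add_right, inner_smul_left, inner_smul_right,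
    real_inner_self_eq_norm_sq, hu, hw, huw, real_inner_comm u w, Real.cos_sub]
  simp [mul_comm]

theorem norm_dir (hu : ‖u‖ = 1) (hw : ‖w‖ = 1) (huw : inner ℝ u w = 0) (t : ℝ) :
    ‖dir u w t‖ = 1 := by
  exact norm_eq_one_of_inner (by rw [inner_dir_dir hu hw huw, sub_self, Real.cos_zero])

theorem dir_sub_dir (u w : V) (s t : ℝ) :
    dir u w s - dir u w t =
      (2 * Real.sin ((s - t) / 2)) • dir u w ((s + t) / 2 + Real.pi / 2) := by
  have h1 := Real.cos_sub_cos s t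
  have h2 := Real.sin_sub_sin s t
  rw [dir, dir, dir, Real.cos_add_pi_div_two, Real.sin_add_pi_div_two, add_sub_add_comm, ← sub_smul,
    ← sub_smul, h1, h2]
  module

theorem dir_eq_iff (hu : ‖u‖ = 1) (hw : ‖w‖ = 1) (huw : inner ℝ u w = 0) (s t : ℝ) :
    dir u w s = dir u w t ↔ ∃ k : ℤ, s - t = k * (2 * Real.pi) := by
  constructor
  · intro hst
    have h1 := inner_dir_dir hu hw huw s t
    rw [hst, real_inner_self_eq_norm_sq, norm_dir hu hw huw, one_pow, eq_comm,
      Real.cos_eq_one_iff] at h1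
    obtain ⟨k, hk⟩ := h1
    exact ⟨k, hk.symm⟩
  · rintro ⟨k, hk⟩
    rw [← dir_add_two_pi_mul u w t k]
    congr 1
    linarith

/-- The coordinates of a vector of a plane with respect to an orthonormal basis. -/
theorem eq_smul_add_smul {P : Submodule ℝ V} (hP : Module.finrank ℝ P = 2) (huP : u ∈ P)
    (hwP : w ∈ P) (hu : ‖u‖ = 1) (hw : ‖w‖ = 1) (huw : inner ℝ u w = 0) {y : V} (hy : y ∈ P) :
    y = inner ℝ u y • u + inner ℝ w y • w := by
  have hfin : FiniteDimensional ℝ P := FiniteDimensional.of_finrank_pos (by omega)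
  have hon : Orthonormal ℝ ![(⟨u, huP⟩ : P), ⟨w, hwP⟩] := by
    rw [orthonormal_iff_ite]
    intro i j
    fin_cases i <;> fin_cases j <;>
      simp [hu, hw, huw, real_inner_comm u w]
  let b := basisOfOrthonormalOfCardEqFinrank hon (by simp [hP])
  let ob := b.toOrthonormalBasis (by simpa [b] using hon)
  have h1 := ob.sum_repr' ⟨y, hy⟩
  have h2 := congrArg (Subtype.val) h1
  simpa [ob, b, Fin.sum_univ_two] using h2.symm

/-- In a plane, a vector orthogonal to the direction `t + π / 2` is a multiple of the direction
`t`. -/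
theorem dir_coords {P : Submodule ℝ V} (hP : Module.finrank ℝ P = 2) (huP : u ∈ P)
    (hwP : w ∈ P) (hu : ‖u‖ = 1) (hw : ‖w‖ = 1) (huw : inner ℝ u w = 0) {y : V} (hy : y ∈ P)
    (t : ℝ) (ht : inner ℝ (dir u w (t + Real.pi / 2)) y = 0) :
    y = inner ℝ (dir u w t) y • dir u w t := by
  have h1 := eq_smul_add_smul hP huP hwP hu hw huw hy
  rw [dir, Real.cos_add_pi_div_two, Real.sin_add_pi_div_two, inner_add_left, inner_smul_left,
    inner_smul_left] at ht
  rw [dir, inner_add_left, inner_smul_left, inner_smul_left]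
  simp only [conj_trivial] at ht ⊢
  generalize inner ℝ u y = a at *
  generalize inner ℝ w y = b at *
  rw [h1, smul_add, smul_smul, smul_smul]
  have h2 := Real.sin_sq_add_cos_sq t
  congr 2
  · linear_combination -Real.sin t * ht - a * h2
  · linear_combination Real.cos t * ht - b * h2

end Plane

section Path

variable {n : ℕ} {M : CoxeterMatrix (Fin n)} {V : Type*} [NormedAddCommGroup V]
  [InnerProductSpace ℝ V] [FiniteDimensional ℝ V] {S : SimpleSystem M V} {o : Set V} {h : ℕ}

namespace OrbitPath

variable (Γ : OrbitPath S o h)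

/-- The projected orbit is a regular `h`-gon. -/
theorem exists_orthonormal : ∃ u w : V, u ∈ S.coxeterPlane ∧ w ∈ S.coxeterPlane ∧ ‖u‖ = 1 ∧
    ‖w‖ = 1 ∧ inner ℝ u w = 0 ∧
    ∀ j : ℤ, S.proj (Γ.z j) = ‖S.proj (Γ.z 0)‖ • dir u w (Γ.angle * j) := by
  have hr := Γ.norm_proj_z_pos
  have hs := Γ.sin_angle_pos
  set r := ‖S.proj (Γ.z 0)‖ with hrdef
  set p := S.proj (Γ.z 0) with hp
  set p' := S.proj (Γ.z 1) with hp'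
  have hpP : p ∈ S.coxeterPlane := Γ.proj_z_mem 0
  have hp'P : p' ∈ S.coxeterPlane := Γ.proj_z_mem 1
  have hpp : inner ℝ p p = r ^ 2 := real_inner_self_eq_norm_sq _
  have hpp' : inner ℝ p' p = Real.cos Γ.angle * r ^ 2 := by
    simpa using Γ.inner_proj_z 0 1
  have hp'p' : inner ℝ p' p' = r ^ 2 := by
    rw [real_inner_self_eq_norm_sq, hp', Γ.norm_proj_z]
  have hcs := Real.sin_sq_add_cos_sq Γ.angle
  refine ⟨r⁻¹ • p, (r * Real.sin Γ.angle)⁻¹ • (p' - Real.cos Γ.angle • p),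
    Submodule.smul_mem _ _ hpP,
    Submodule.smul_mem _ _ (Submodule.sub_mem _ hp'P (Submodule.smul_mem _ _ hpP)), ?_, ?_, ?_,
    ?_⟩
  · rw [norm_smul, norm_inv, Real.norm_of_nonneg hr.le, inv_mul_cancel₀ hr.ne']
  · refine norm_eq_one_of_inner ?_
    simp only [inner_smul_left, inner_smul_right, inner_sub_left, inner_sub_right, hpp, hpp', hp'p',
      real_inner_comm p' p, conj_trivial]
    field_simp
    linarith
  · simp only [inner_smul_left, inner_smul_right, inner_sub_right, hpp, hpp',
      real_inner_comm p' p, conj_trivial]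
    ring
  · refine congrFun (eq_of_recurrence (C := 2 * Real.cos Γ.angle) Γ.proj_z_recurrence
      (fun j => ?_) ?_ ?_)
    · rw [← smul_add, smul_comm, ← dir_recurrence]
      push_cast
      rw [mul_add, mul_sub, mul_one]
    · rw [Int.cast_zero, mul_zero, dir, Real.cos_zero, Real.sin_zero, zero_smul, add_zero, one_smul,
        smul_smul, mul_inv_cancel₀ hr.ne', one_smul]
    · rw [Int.cast_one, mul_one, dir, smul_add, smul_smul, smul_smul, smul_smul, smul_smul]
      have e1 : r * Real.cos Γ.angle * r⁻¹ = Real.cos Γ.angle := by field_simp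
      have e2 : r * Real.sin Γ.angle * (r * Real.sin Γ.angle)⁻¹ = 1 := by field_simp
      rw [e1, e2, one_smul]
      abel

theorem finrank_coxeterPlane (Γ : OrbitPath S o h) : Module.finrank ℝ S.coxeterPlane = 2 := by
  obtain ⟨u, w, hu, hw, hu1, hw1, huw, hz⟩ := Γ.exists_orthonormal
  have hr := Γ.norm_proj_z_pos
  have hs := Γ.sin_angle_pos
  have hon : Orthonormal ℝ ![u, w] := by
    rw [orthonormal_iff_ite]
    intro i j
    fin_cases i <;> fin_cases j <;>
      simp [hu1, hw1, huw, real_inner_comm u w]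
  have hspan : S.coxeterPlane = Submodule.span ℝ (Set.range ![u, w]) := by
    refine le_antisymm (fun y hy => ?_) (Submodule.span_le.2 ?_)
    · have huS : u ∈ Submodule.span ℝ (Set.range ![u, w]) := Submodule.subset_span ⟨0, rfl⟩
      have hwS : w ∈ Submodule.span ℝ (Set.range ![u, w]) := Submodule.subset_span ⟨1, rfl⟩
      have h0 : y - (inner ℝ u y • u + inner ℝ w y • w) = 0 := by
        have hiu : inner ℝ u (y - (inner ℝ u y • u + inner ℝ w y • w)) = 0 := by
          simp [inner_sub_right, inner_add_right, inner_smul_right, huw, hu1]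
        have hiw : inner ℝ w (y - (inner ℝ u y • u + inner ℝ w y • w)) = 0 := by
          simp [inner_sub_right, inner_add_right, inner_smul_right, real_inner_comm u w, huw, hw1]
        refine Γ.eq_zero_of_inner_two (i := 0) (Submodule.sub_mem _ hy (Submodule.add_mem _
          (Submodule.smul_mem _ _ hu) (Submodule.smul_mem _ _ hw))) ?_ ?_ <;>
        rw [hz, dir, inner_smul_left, inner_add_left, inner_smul_left, inner_smul_left, hiu,
          hiw] <;> simp
      rw [sub_eq_zero.1 h0]
      exact Submodule.add_mem _ (Submodule.smul_mem _ _ huS) (Submodule.smul_mem _ _ hwS)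
    · rintro _ ⟨i, rfl⟩
      fin_cases i
      exacts [hu, hw]
  rw [hspan, finrank_span_eq_card hon.linearIndependent, Fintype.card_fin]

theorem nonempty_orbitPolygon (Γ : OrbitPath S o h) : Nonempty (OrbitPolygon S o) := by
  obtain ⟨u, w, hu, hw, hu1, hw1, huw, hz⟩ := Γ.exists_orthonormal
  have h3 := Γ.three_le
  refine ⟨⟨u, w, hu, hw, hu1, hw1, huw, _, Γ.norm_proj_z_pos, fun k => Γ.z k, ?_, ?_, ?_⟩⟩
  · ext y
    constructor
    · rintro ⟨k, rfl⟩
      exact Γ.z_mem k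
    · intro hy
      obtain ⟨j, rfl⟩ := Γ.exists_z hy
      refine ⟨(j % h).toNat, ?_⟩
      have h1 := Int.emod_nonneg j (b := (h : ℤ)) (by omega)
      show Γ.z _ = _
      rw [Int.toNat_of_nonneg h1, Γ.z_eq_iff, ← dvd_neg, neg_sub]
      exact Int.dvd_self_sub_emod
  · intro k
    rw [Γ.coxeterNumber_eq]
    push_cast
    exact Γ.z_add_h _
  · intro k
    rw [hz, ngon_eq_dir, Γ.coxeterNumber_eq, angle]
    congr 2
    push_cast
    ring

end OrbitPath

end Path

/-! ### Insertion of the two new vertices -/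

/-- The position in the `(h + 2)`-gon of the vertex with position `j` in the `h`-gon, when the new
vertices are inserted after the positions divisible by `h` and those congruent to `⌊h/2⌋`. -/
def expandedPos (h : ℕ) (j : ℤ) : ℤ := j + (j - 1) / h + (j - 1 - (h / 2 : ℕ)) / h + 2

theorem dvd_iff_of_lt_two_mul {h m : ℤ} (h0 : 0 ≤ m) (h1 : m < 2 * h) :
    h ∣ m ↔ m = 0 ∨ m = h := by
  constructor
  · rintro ⟨t, rfl⟩
    have hh : 0 < h := by omega
    have h2 : 0 ≤ t := by
      by_contra hneg
      nlinarith
    have h3 : t < 2 := by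
      by_contra hneg
      nlinarith
    have : t = 0 ∨ t = 1 := by omega
    rcases this with rfl | rfl <;> simp
  · rintro (rfl | rfl)
    exacts [dvd_zero _, dvd_rfl]

theorem expandedPos_add_mul {h : ℕ} (hh : 0 < h) (j t : ℤ) :
    expandedPos h (j + h * t) = expandedPos h j + (h + 2 : ℕ) * t := by
  have h0 : (h : ℤ) ≠ 0 := by omega
  have e1 : j + h * t - 1 = (j - 1) + h * t := by ring
  have e2 : j + h * t - 1 - (h / 2 : ℕ) = (j - 1 - (h / 2 : ℕ)) + h * t := by ring
  rw [expandedPos, expandedPos, e2, e1, Int.add_mul_ediv_left _ _ h0,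
    Int.add_mul_ediv_left _ _ h0]
  push_cast
  ring

theorem ediv_eq_neg_one {h x : ℤ} (h0 : x < 0) (h1 : -h ≤ x) : x / h = -1 := by
  have h2 := Int.add_mul_ediv_left x 1 (b := h) (by omega)
  rw [mul_one, Int.ediv_eq_zero_of_lt (by omega) (by omega)] at h2
  omega

/-- A new vertex lies between the positions `j` and `j + 1` if and only if `h` divides `2 j` or
`2 j + 1`. -/
theorem expandedPos_succ {h : ℕ} (h3 : 3 ≤ h) (j : ℤ) :
    expandedPos h (j + 1) =
      expandedPos h j + if (h : ℤ) ∣ 2 * j ∨ (h : ℤ) ∣ 2 * j + 1 then 2 else 1 := by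
  obtain ⟨r, t, hr0, hrh, rfl⟩ : ∃ r t : ℤ, 0 ≤ r ∧ r < h ∧ j = r + h * t :=
    ⟨j % h, j / h, Int.emod_nonneg _ (by omega), Int.emod_lt_of_pos _ (by omega),
      (Int.emod_add_mul_ediv j h).symm⟩
  have e1 : (h : ℤ) ∣ 2 * (r + h * t) ↔ (h : ℤ) ∣ 2 * r := by
    rw [show 2 * (r + h * t) = 2 * r + h * (2 * t) by ring]
    exact dvd_add_left (dvd_mul_right _ _)
  have e2 : (h : ℤ) ∣ 2 * (r + h * t) + 1 ↔ (h : ℤ) ∣ 2 * r + 1 := by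
    rw [show 2 * (r + h * t) + 1 = 2 * r + 1 + h * (2 * t) by ring]
    exact dvd_add_left (dvd_mul_right _ _)
  rw [show r + h * t + 1 = r + 1 + h * t by ring, expandedPos_add_mul (by omega),
    expandedPos_add_mul (by omega)]
  simp only [e1, e2,
    dvd_iff_of_lt_two_mul (show 0 ≤ 2 * r by omega) (show _ < 2 * (h : ℤ) by omega),
    dvd_iff_of_lt_two_mul (show 0 ≤ 2 * r + 1 by omega) (show _ < 2 * (h : ℤ) by omega),
    expandedPos]
  have k1 : (r + 1 - 1) / (h : ℤ) = 0 := Int.ediv_eq_zero_of_lt (by omega) (by omega)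
  have k2 : (r - 1) / (h : ℤ) = if r = 0 then -1 else 0 := by
    split_ifs with h0
    · exact ediv_eq_neg_one (by omega) (by omega)
    · exact Int.ediv_eq_zero_of_lt (by omega) (by omega)
  have k3 : (r + 1 - 1 - (h / 2 : ℕ)) / (h : ℤ) = if r < (h / 2 : ℕ) then -1 else 0 := by
    split_ifs with h0
    · exact ediv_eq_neg_one (by omega) (by omega)
    · exact Int.ediv_eq_zero_of_lt (by omega) (by omega)
  have k4 : (r - 1 - (h / 2 : ℕ)) / (h : ℤ) = if r ≤ (h / 2 : ℕ) then -1 else 0 := by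
    split_ifs with h0
    · exact ediv_eq_neg_one (by omega) (by omega)
    · exact Int.ediv_eq_zero_of_lt (by omega) (by omega)
  rw [k1, k2, k3, k4]
  split_ifs <;> omega

/-- The zigzag `0, -1, 1, -2, 2, …`. -/
def zig (k : ℕ) : ℤ := if k % 2 = 0 then ((k / 2 : ℕ) : ℤ) else -(((k + 1) / 2 : ℕ) : ℤ)

/-- The path, a zigzag in the `h`-gon, remains a zigzag in the `(h + 2)`-gon, with room for one more
vertex at each end. -/
theorem expandedPos_zag {h m : ℕ} (hm : m < h) : expandedPos h (zag m) = zig (m + 1) + 1 := by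
  rw [expandedPos, zag, zig]
  rcases Nat.mod_two_eq_zero_or_one m with h0 | h0
  · rw [if_pos h0, if_neg (by omega), ediv_eq_neg_one (by omega) (by omega),
      ediv_eq_neg_one (by omega) (by omega)]
    omega
  · rw [if_neg (by omega), if_pos (by omega), Int.ediv_eq_zero_of_lt (by omega) (by omega),
      ediv_eq_neg_one (by omega) (by omega)]
    omega

section Path

variable {n : ℕ} {M : CoxeterMatrix (Fin n)} {V : Type*} [NormedAddCommGroup V]
  [InnerProductSpace ℝ V] [FiniteDimensional ℝ V] {S : SimpleSystem M V} {o : Set V} {h : ℕ}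

namespace OrbitPath

variable (Γ : OrbitPath S o h)

/-- The cyclic order of the vertices of the `h`-gon is that given by the Coxeter element. -/
theorem exists_polygon_eq_z (G : OrbitPolygon S o) :
    ∃ (b : ℤ) (σ : ℤˣ), ∀ k : ℕ, G.v k = Γ.z (σ * (k - b)) := by
  obtain ⟨i, hi⟩ := Γ.exists_z (y := G.v 0) (G.range_v.subset ⟨0, rfl⟩)
  have hr := G.radius_pos
  have hN := Γ.coxeterNumber_eq
  have hp0 : S.proj (Γ.z i) = G.radius • G.u := by
    rw [hi, G.proj_v 0, ngon_eq_dir]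
    simp [dir]
  have hnorm : ‖S.proj (Γ.z i)‖ = G.radius := by
    rw [hp0, norm_smul, G.norm_u, Real.norm_of_nonneg hr.le, mul_one]
  have hp1 : ∃ σ : ℤˣ,
      S.proj (Γ.z (i + 1)) = G.radius • dir G.u G.w (Γ.angle * ((σ : ℤ) : ℝ)) := by
    have hc := eq_smul_add_smul Γ.finrank_coxeterPlane G.u_mem G.w_mem G.norm_u G.norm_w
      G.inner_u_w (Γ.proj_z_mem (i + 1))
    have h1 := Γ.inner_proj_z i 1
    rw [hnorm, hp0, inner_smul_right, real_inner_comm] at h1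
    have h2 : inner ℝ G.u (S.proj (Γ.z (i + 1))) = G.radius * Real.cos Γ.angle := by
      rw [Int.cast_one, mul_one] at h1
      exact mul_left_cancel₀ hr.ne' (by linarith)
    have h3 : inner ℝ G.w (S.proj (Γ.z (i + 1))) ^ 2 = (G.radius * Real.sin Γ.angle) ^ 2 := by
      have h4 : inner ℝ (S.proj (Γ.z (i + 1))) (S.proj (Γ.z (i + 1))) = G.radius ^ 2 := by
        rw [real_inner_self_eq_norm_sq, Γ.norm_proj_z, ← Γ.norm_proj_z i, hnorm]
      have h5 := congrArg (fun v => inner ℝ v (S.proj (Γ.z (i + 1)))) hc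
      simp only [inner_add_left, inner_smul_left, h4, h2, conj_trivial] at h5
      nlinarith [Real.sin_sq_add_cos_sq Γ.angle]
    rw [h2] at hc
    rcases sq_eq_sq_iff_eq_or_eq_neg.1 h3 with h4 | h4
    · refine ⟨1, ?_⟩
      rw [hc, h4, dir]
      simp only [Units.val_one, Int.cast_one, mul_one]
      module
    · refine ⟨-1, ?_⟩
      rw [hc, h4, dir]
      simp only [Units.val_neg, Units.val_one, Int.cast_one, Int.cast_neg, mul_neg, mul_one,
        Real.cos_neg, Real.sin_neg]
      module
  obtain ⟨σ, hσ⟩ := hp1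
  have hall : (fun j : ℤ => S.proj (Γ.z (i + j))) =
      fun j : ℤ => G.radius • dir G.u G.w (Γ.angle * ((σ : ℤ) : ℝ) * j) := by
    refine eq_of_recurrence (C := 2 * Real.cos Γ.angle) (fun j => ?_) (fun j => ?_) ?_ ?_
    · rw [← add_assoc, ← add_sub_assoc]
      exact Γ.proj_z_recurrence _
    · have hcos : Real.cos Γ.angle = Real.cos (Γ.angle * ((σ : ℤ) : ℝ)) := by
        rcases Int.units_eq_one_or σ with rfl | rfl <;> simp
      rw [← smul_add, smul_comm, hcos, ← dir_recurrence]
      push_cast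
      rw [mul_add, mul_sub, mul_one]
    · simp [hp0, dir]
    · simp [hσ]
  have hσσ : (σ : ℤ) * σ = 1 := by rw [← Units.val_mul, Int.units_mul_self, Units.val_one]
  refine ⟨-(σ * i), σ, fun k => ?_⟩
  obtain ⟨j, hj⟩ := Γ.exists_z (y := G.v k) (G.range_v.subset ⟨k, rfl⟩)
  rw [← hj, Γ.z_eq_iff]
  refine Γ.proj_z_inj ?_
  rw [hj, G.proj_v, ngon_eq_dir, hN]
  have h1 := congrFun hall (σ * k)
  have h2 : (σ : ℤ) * (k - -(σ * i)) = i + σ * k := by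
    linear_combination i * hσσ
  have h3 : ((σ : ℤ) : ℝ) * ((σ : ℤ) : ℝ) = 1 := by exact_mod_cast hσσ
  rw [h2, h1, angle]
  congr 2
  push_cast
  linear_combination -(2 * Real.pi / h * k * h3)

theorem mem_line_iff (ε : Bool) (y : V) :
    y ∈ S.line ε ↔ y ∈ S.coxeterPlane ∧ S.half ε y = y := by
  rw [SimpleSystem.line, Submodule.mem_inf, S.half_eq_self_iff]
  simp [Submodule.mem_iInf, Submodule.mem_orthogonal_singleton_iff_inner_right]

/-- An edge of the `h`-gon is perpendicular to one of the lines `L` if and only if one of the halves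
of the Coxeter element interchanges its endpoints. -/
theorem distinguished_iff {G : OrbitPolygon S o} {b : ℤ} {σ : ℤˣ}
    (hG : ∀ k : ℕ, G.v k = Γ.z (σ * (k - b))) (k : ℕ) :
    G.Distinguished k ↔ (h : ℤ) ∣ 2 * (σ * (k - b)) + σ ∨ (h : ℤ) ∣ 2 * (σ * (k - b)) + σ - 1 := by
  have hG1 : G.v (k + 1) = Γ.z (σ * (k - b) + σ) := by
    rw [hG]
    push_cast
    congr 1
    ring
  have key : ∀ ε, (∀ x ∈ S.line ε, inner ℝ (S.proj (G.v (k + 1)) - S.proj (G.v k)) x = 0) ↔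
      (h : ℤ) ∣ 2 * (σ * (k - b)) + σ - (if ε = Γ.firstSide then 1 else 0) := by
    intro ε
    rw [hG1, hG]
    generalize (σ : ℤ) * (k - b) = j
    set a : ℤ := if ε = Γ.firstSide then 1 else 0 with ha
    constructor
    · intro hperp
      set e := S.proj (Γ.z (j + σ)) - S.proj (Γ.z j) with he
      have heP : e ∈ S.coxeterPlane := Submodule.sub_mem _ (Γ.proj_z_mem _) (Γ.proj_z_mem _)
      -- `x + half ε x` lies on the line for every `x` in the plane
      have h1 : ∀ x ∈ S.coxeterPlane, inner ℝ (e + S.half ε e) x = 0 := by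
        intro x hx
        rw [inner_add_left, S.inner_half_half, ← inner_add_right]
        refine hperp _ ((mem_line_iff ε _).2
          ⟨Submodule.add_mem _ hx (Γ.half_mem_plane ε hx), ?_⟩)
        rw [map_add, S.half_half, add_comm]
      have h2 : e + S.half ε e = 0 :=
        inner_self_eq_zero.1 (h1 _ (Submodule.add_mem _ heP (Γ.half_mem_plane ε heP)))
      rw [he, map_sub, ← Γ.proj_half, ← Γ.proj_half, Γ.half_z, Γ.half_z, ← ha] at h2
      have hy : S.proj (Γ.z j) - S.proj (Γ.z (a - j - σ)) ∈ S.coxeterPlane :=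
        Submodule.sub_mem _ (Γ.proj_z_mem _) (Γ.proj_z_mem _)
      have h3 : S.proj (Γ.z j) - S.proj (Γ.z (a - j - σ)) = 0 := by
        refine Γ.eq_zero_of_turn_eq hy ?_
        rcases Int.units_eq_one_or σ with rfl | rfl
        · rw [map_sub, turn_proj_z, turn_proj_z]
          rw [Units.val_one, ← sub_sub] at h2
          rw [Units.val_one, sub_add_cancel, ← sub_eq_zero, ← h2]
          abel
        · rw [Units.val_neg, Units.val_one, ← sub_eq_add_neg] at h2
          have h5 : Γ.turn⁻¹ (S.proj (Γ.z j) - S.proj (Γ.z (a - j - (-1 : ℤˣ)))) =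
              S.proj (Γ.z j) - S.proj (Γ.z (a - j - (-1 : ℤˣ))) := by
            rw [map_sub, turn_inv_proj_z, turn_inv_proj_z, Units.val_neg, Units.val_one,
              ← sub_eq_zero, ← h2, show a - (j - 1) = a - j - -1 by ring,
              show a - j - -1 - 1 = a - j by ring]
            abel
          have h6 := Γ.turn_turn_inv (S.proj (Γ.z j) - S.proj (Γ.z (a - j - (-1 : ℤˣ))))
          rwa [h5] at h6
      have h4 := Γ.proj_z_inj (sub_eq_zero.1 h3)
      convert h4 using 1
      ring
    · intro hd x hx
      rw [mem_line_iff] at hx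
      have h1 : Γ.z (j + σ) = S.half ε (Γ.z j) := by
        rw [Γ.half_z, ← ha, Γ.z_eq_iff]
        convert hd using 1
        ring
      rw [h1, inner_sub_left, Γ.inner_proj hx.1, Γ.inner_proj hx.1, S.inner_half_half, hx.2,
        sub_self]
  rw [OrbitPolygon.Distinguished]
  simp only [key]
  constructor
  · rintro ⟨ε, hε⟩
    split_ifs at hε with h0
    · exact Or.inr hε
    · rw [sub_zero] at hε
      exact Or.inl hε
  · rintro (h0 | h0)
    · exact ⟨!Γ.firstSide, by simpa using h0⟩
    · exact ⟨Γ.firstSide, by simpa using h0⟩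

/-- The indices count the old and the new vertices passed on the way along the polygon. -/
theorem index_eq {G : OrbitPolygon S o} {b : ℤ} {σ : ℤˣ}
    (hG : ∀ k : ℕ, G.v k = Γ.z (σ * (k - b))) (k : ℕ) :
    (G.index k : ℤ) = σ * (expandedPos h (σ * (k - b)) - expandedPos h (-(σ * b))) := by
  induction k with
  | zero => simp [OrbitPolygon.index]
  | succ k ih =>
    have hd := Γ.distinguished_iff hG k
    rw [OrbitPolygon.index, Nat.cast_add, ih]
    rcases Int.units_eq_one_or σ with rfl | rfl
    · have h1 := expandedPos_succ Γ.three_le (k - b)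
      simp only [Units.val_one, one_mul, add_sub_cancel_right] at hd ⊢
      rw [show ((k + 1 : ℕ) : ℤ) - b = k - b + 1 by push_cast; ring, h1, hd, or_comm]
      split_ifs <;> push_cast <;> ring
    · have h1 := expandedPos_succ Γ.three_le (-1 * (k - b) - 1)
      simp only [Units.val_neg, Units.val_one, sub_add_cancel] at hd h1 ⊢
      rw [show 2 * (-1 * ((k : ℤ) - b)) + -1 = 2 * (-1 * (k - b) - 1) + 1 by ring,
        show 2 * (-1 * ((k : ℤ) - b) - 1) + 1 - 1 = 2 * (-1 * (k - b) - 1) by ring,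
        or_comm] at hd
      rw [show -1 * (((k + 1 : ℕ) : ℤ) - b) = -1 * (k - b) - 1 by push_cast; ring, h1, hd]
      split_ifs <;> push_cast <;> ring

theorem index_add_h (Γ : OrbitPath S o h) (G : OrbitPolygon S o) (k : ℕ) :
    G.index (k + h) = G.index k + (h + 2) := by
  obtain ⟨b, σ, hG⟩ := Γ.exists_polygon_eq_z G
  have h3 := Γ.three_le
  have hσσ : (σ : ℤ) * σ = 1 := by rw [← Units.val_mul, Int.units_mul_self, Units.val_one]
  have h1 := Γ.index_eq hG (k + h)
  rw [show (σ : ℤ) * (((k + h : ℕ) : ℤ) - b) = σ * (k - b) + h * σ by push_cast; ring,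
    expandedPos_add_mul (by omega), add_sub_right_comm, mul_add, ← Γ.index_eq hG k,
    mul_left_comm, hσσ, mul_one] at h1
  exact_mod_cast h1

theorem ngon_add_mul (u w : V) (r θ : ℝ) {N : ℕ} (hN : 0 < N) (k t : ℤ) :
    ngon u w r θ N (k + N * t) = ngon u w r θ N k := by
  have hN' : (N : ℝ) ≠ 0 := by exact_mod_cast hN.ne'
  have e : 2 * Real.pi * ((k + N * t : ℤ) : ℝ) / N + θ =
      2 * Real.pi * k / N + θ + t * (2 * Real.pi) := by
    push_cast
    field_simp
    ring
  rw [ngon_eq_dir, ngon_eq_dir, e, dir_add_two_pi_mul]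

/-- The identification of the orbit with vertices of the `(h + 2)`-gon is well defined, as the
indices are periodic. -/
theorem exists_expansion (Γ : OrbitPath S o h) (G : OrbitPolygon S o) (θ : ℝ) :
    ∃ E : Expansion S o, E.polygon = G ∧ E.θ = θ := by
  classical
  have h3 := Γ.three_le
  obtain ⟨b, σ, hG⟩ := Γ.exists_polygon_eq_z G
  refine ⟨⟨G, θ, fun y => if hy : ∃ k, G.v k = y then
    ngon G.u G.w G.radius θ (S.coxeterNumber + 2) (G.index hy.choose) else 0, fun k => ?_⟩,
    rfl, rfl⟩
  have hy : ∃ i, G.v i = G.v k := ⟨k, rfl⟩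
  simp only [dif_pos hy]
  have h1 := hy.choose_spec
  generalize hy.choose = i at h1 ⊢
  rw [hG, hG, Γ.z_eq_iff] at h1
  obtain ⟨t, ht⟩ := h1
  rw [Γ.coxeterNumber_eq, Γ.index_eq hG, Γ.index_eq hG, eq_add_of_sub_eq' ht,
    expandedPos_add_mul (by omega), add_sub_right_comm, mul_add, mul_left_comm,
    ngon_add_mul _ _ _ _ (by omega)]

/-- In the `(h + 2)`-gon, the path becomes a zigzag between the two new vertices. -/
theorem exists_zigzag (E : Expansion S o) : ∃ (A : ℤ) (σ : ℤˣ), ∀ m < h,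
    E.q (Γ.x m) = E.vertex (A + σ * zig (m + 1)) := by
  have h3 := Γ.three_le
  obtain ⟨b, σ, hG⟩ := Γ.exists_polygon_eq_z E.polygon
  have hσσ : (σ : ℤ) * σ = 1 := by rw [← Units.val_mul, Int.units_mul_self, Units.val_one]
  refine ⟨σ * (1 - expandedPos h (-(σ * b))), σ, fun m hm => ?_⟩
  -- a natural number in the residue class of the position of `x m`
  obtain ⟨k, t, hk⟩ : ∃ (k : ℕ) (t : ℤ), (σ : ℤ) * (k - b) = zag m + h * t := by
    refine ⟨(b + σ * zag m + h * (|b| + |zag m|)).toNat, σ * (|b| + |zag m|), ?_⟩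
    have h4 : (1 : ℤ) ≤ h := by omega
    have h5 : |(σ : ℤ) * zag m| = |zag m| := by
      rcases Int.units_eq_one_or σ with rfl | rfl <;> simp
    rw [Int.toNat_of_nonneg]
    · linear_combination zag m * hσσ
    · nlinarith [neg_abs_le b, neg_abs_le ((σ : ℤ) * zag m), abs_nonneg b, abs_nonneg (zag m)]
  have h1 := E.q_v k
  have h2 : Γ.z (zag m + h * t) = Γ.x m := by rw [Γ.z_add_mul, Γ.z_zag hm]
  rw [hG, Γ.coxeterNumber_eq, Γ.index_eq hG, hk, h2, expandedPos_add_mul (by omega),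
    expandedPos_zag hm, add_sub_right_comm, mul_add, mul_left_comm,
    ngon_add_mul _ _ _ _ (by omega)] at h1
  rw [h1, Expansion.vertex, Γ.coxeterNumber_eq]
  congr 1
  ring

end OrbitPath

end Path

/-! ### Crossing chords of a regular polygon -/

section Plane

variable {V : Type*} [NormedAddCommGroup V] [InnerProductSpace ℝ V]

theorem crosses_mk_iff (a b a' b' : V) : Crosses s(a, b) s(a', b') ↔
    s(a, b) ≠ s(a', b') ∧ (openSegment ℝ a b ∩ openSegment ℝ a' b').Nonempty := by
  constructor
  · rintro ⟨hne, p, q, p', q', h1, h2, h3⟩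
    refine ⟨hne, ?_⟩
    have e1 : openSegment ℝ a b = openSegment ℝ p q := by
      rcases Sym2.eq_iff.1 h1 with ⟨rfl, rfl⟩ | ⟨rfl, rfl⟩
      exacts [rfl, openSegment_symm ..]
    have e2 : openSegment ℝ a' b' = openSegment ℝ p' q' := by
      rcases Sym2.eq_iff.1 h2 with ⟨rfl, rfl⟩ | ⟨rfl, rfl⟩
      exacts [rfl, openSegment_symm ..]
    rwa [e1, e2]
  · rintro ⟨hne, h3⟩
    exact ⟨hne, a, b, a', b', rfl, rfl, h3⟩

theorem crosses_map_iff (f : V ≃ₗᵢ[ℝ] V) (d e : Sym2 V) :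
    Crosses (Sym2.map f d) (Sym2.map f e) ↔ Crosses d e := by
  induction d with | _ a b
  induction e with | _ a' b'
  rw [Sym2.map_mk, Sym2.map_mk, crosses_mk_iff, crosses_mk_iff, ← Sym2.map_mk, ← Sym2.map_mk,
    (Sym2.map.injective f.injective).ne_iff]
  have h1 : ∀ a b : V, openSegment ℝ (f a) (f b) = f '' openSegment ℝ a b := fun a b =>
    (image_openSegment ℝ (f.toLinearEquiv.toLinearMap.toAffineMap) a b).symm
  simp only [h1, ← Set.image_inter f.injective, Set.image_nonempty]

/-- For `|d| < N`, the number `sin (π d / N)` has the sign of `d`. -/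
theorem exists_sin_eq_mul {N : ℕ} {d : ℤ} (hd : |d| < N) :
    ∃ c > 0, Real.sin (Real.pi * d / N) = c * d := by
  wlog h0 : 0 ≤ d generalizing d
  · obtain ⟨c, hc, h1⟩ := this (d := -d) (by rwa [abs_neg]) (by omega)
    refine ⟨c, hc, ?_⟩
    push_cast at h1
    rw [mul_neg, neg_div, Real.sin_neg] at h1
    linarith
  rcases h0.eq_or_lt with rfl | hpos
  · exact ⟨1, one_pos, by simp⟩
  rw [abs_of_nonneg h0] at hd
  have hd' : (d : ℝ) < N := by exact_mod_cast hd
  have hpos' : (0 : ℝ) < d := by exact_mod_cast hpos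
  have hN : (0 : ℝ) < N := hpos'.trans hd'
  have hs : 0 < Real.sin (Real.pi * d / N) := by
    refine Real.sin_pos_of_pos_of_lt_pi (by positivity) ?_
    rw [div_lt_iff₀ hN]
    exact mul_lt_mul_of_pos_left hd' Real.pi_pos
  exact ⟨Real.sin (Real.pi * d / N) / d, div_pos hs hpos', by field_simp⟩

/-- The vertices of a regular `N`-gon, with an arbitrary first vertex and orientation. -/
def regVertex (u w : V) (r t : ℝ) (σ : ℤˣ) (N : ℕ) (k : ℤ) : V :=
  r • dir u w (t + ((σ : ℤ) : ℝ) * (2 * Real.pi / N) * k)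

variable {u w : V} {r t : ℝ} {σ : ℤˣ} {N : ℕ}

theorem units_cast_mul_self (σ : ℤˣ) : ((σ : ℤ) : ℝ) * ((σ : ℤ) : ℝ) = 1 := by
  rcases Int.units_eq_one_or σ with rfl | rfl <;> simp

theorem regVertex_eq_iff (hu : ‖u‖ = 1) (hw : ‖w‖ = 1) (huw : inner ℝ u w = 0) (hr : 0 < r)
    (hN : 0 < N) (i j : ℤ) :
    regVertex u w r t σ N i = regVertex u w r t σ N j ↔ (N : ℤ) ∣ i - j := by
  have hN' : (N : ℝ) ≠ 0 := by exact_mod_cast hN.ne'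
  have hσ := units_cast_mul_self σ
  have hpi := Real.pi_ne_zero
  have hσσ : (σ : ℤ) * σ = 1 := by exact_mod_cast hσ
  rw [regVertex, regVertex, smul_right_inj hr.ne', dir_eq_iff hu hw huw]
  constructor
  · rintro ⟨k, hk⟩
    refine ⟨σ * k, ?_⟩
    have h1 : ((σ : ℤ) : ℝ) * (i - j) = k * N := by
      field_simp at hk
      refine mul_left_cancel₀ (mul_ne_zero two_ne_zero hpi) ?_
      linear_combination hk
    have h2 : (σ : ℤ) * (i - j) = k * N := by exact_mod_cast h1
    linear_combination σ * h2 - (i - j) * hσσ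
  · rintro ⟨k, hk⟩
    refine ⟨σ * k, ?_⟩
    have h1 : (i : ℝ) - j = N * k := by exact_mod_cast hk
    push_cast
    field_simp
    linear_combination 2 * Real.pi * ((σ : ℤ) : ℝ) * h1

/-- The difference of two vertices has a direction which depends on the sum of their labels only. -/
theorem regVertex_sub (u w : V) (r t : ℝ) (σ : ℤˣ) (N : ℕ) (i j : ℤ) :
    regVertex u w r t σ N i - regVertex u w r t σ N j =
      (2 * r * (((σ : ℤ) : ℝ) * Real.sin (Real.pi * (i - j : ℤ) / N))) •
        dir u w (t + ((σ : ℤ) : ℝ) * (2 * Real.pi / N) * ((i + j) / 2) + Real.pi / 2) := by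
  have h1 : Real.sin ((t + ((σ : ℤ) : ℝ) * (2 * Real.pi / N) * i -
      (t + ((σ : ℤ) : ℝ) * (2 * Real.pi / N) * j)) / 2) =
      ((σ : ℤ) : ℝ) * Real.sin (Real.pi * (i - j : ℤ) / N) := by
    rcases Int.units_eq_one_or σ with rfl | rfl
    · push_cast
      ring_nf
    · push_cast
      rw [neg_one_mul (Real.sin _), ← Real.sin_neg]
      congr 1
      ring
  rw [regVertex, regVertex, ← smul_sub, dir_sub_dir, h1, smul_smul]
  congr 1
  · ring
  · congr 1
    ring

/-- The signed distance of the vertex `m` from the line through the vertices `k` and `l`. -/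
theorem exists_inner_sub_eq (hu : ‖u‖ = 1) (hw : ‖w‖ = 1) (huw : inner ℝ u w = 0) (hr : 0 < r)
    {k l m : ℤ} (hk : |m - k| < N) (hl : |m - l| < N) : ∃ c > 0,
    inner ℝ (dir u w (t + ((σ : ℤ) : ℝ) * (2 * Real.pi / N) * ((k + l) / 2)))
        (regVertex u w r t σ N m) =
      r * Real.cos (Real.pi * (k - l) / N) - c * ((m - k) * (m - l) : ℤ) := by
  obtain ⟨c, hc, h1⟩ := exists_sin_eq_mul hk
  obtain ⟨c', hc', h2⟩ := exists_sin_eq_mul hl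
  refine ⟨2 * r * (c * c'), by positivity, ?_⟩
  have hσ := units_cast_mul_self σ
  rw [regVertex, inner_smul_right, inner_dir_dir hu hw huw]
  have h3 : Real.cos (t + ((σ : ℤ) : ℝ) * (2 * Real.pi / N) * ((k + l) / 2) -
      (t + ((σ : ℤ) : ℝ) * (2 * Real.pi / N) * m)) =
      Real.cos (Real.pi * (m - k : ℤ) / N + Real.pi * (m - l : ℤ) / N) := by
    rcases Int.units_eq_one_or σ with rfl | rfl
    · rw [← Real.cos_neg]
      push_cast
      congr 1
      ring
    · push_cast
      congr 1
      ring
  have h4 : Real.cos (Real.pi * (k - l) / N) =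
      Real.cos (Real.pi * (m - k : ℤ) / N - Real.pi * (m - l : ℤ) / N) := by
    rw [← Real.cos_neg]
    push_cast
    congr 1
    ring
  rw [h3, h4, Real.cos_add, Real.cos_sub, h1, h2]
  push_cast
  ring

/-- Two numbers of opposite signs have a unique convex combination that vanishes, and its
coefficients are positive. -/
theorem exists_convex_comb_eq_zero {x y : ℝ} (hxy : x * y < 0) : ∃ a b : ℝ, 0 < a ∧ 0 < b ∧
    a + b = 1 ∧ a * x + b * y = 0 ∧ ∀ τ, (1 - τ) * x + τ * y = 0 → τ = b := by
  have hne : x - y ≠ 0 := by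
    intro h0
    have : x = y := by linarith
    rw [this] at hxy
    nlinarith [mul_self_nonneg y]
  have hsq : 0 < (x - y) ^ 2 := by positivity
  refine ⟨-y * (x - y) / (x - y) ^ 2, x * (x - y) / (x - y) ^ 2, div_pos (by nlinarith) hsq,
    div_pos (by nlinarith) hsq, by field_simp; ring, by field_simp; ring, fun τ hτ => ?_⟩
  have : τ * (x - y) = x := by linarith
  rw [eq_div_iff hsq.ne', pow_two, ← mul_assoc, this]

/-- Two segments of a plane meet if the line of each of them strictly separates the endpoints of the
other. -/
theorem openSegment_inter_nonempty {P : Submodule ℝ V} {f g v p q a b : V} {s s' : ℝ} (hp : p ∈ P)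
    (hq : q ∈ P) (ha : a ∈ P) (hb : b ∈ P)
    (hf : ∀ y ∈ P, inner ℝ f y = 0 → y = inner ℝ v y • v)
    (hfp : inner ℝ f p = s) (hfq : inner ℝ f q = s) (hga : inner ℝ g a = s')
    (hgb : inner ℝ g b = s') (hab : (inner ℝ f a - s) * (inner ℝ f b - s) < 0)
    (hpq : (inner ℝ g p - s') * (inner ℝ g q - s') < 0) :
    (openSegment ℝ p q ∩ openSegment ℝ a b).Nonempty := by
  obtain ⟨c, d, hc, hd, hcd, hcd0, -⟩ := exists_convex_comb_eq_zero hab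
  obtain ⟨c', d', hc', hd', hcd', hcd0', huniq⟩ := exists_convex_comb_eq_zero hpq
  refine ⟨c • a + d • b, ?_, ⟨c, d, hc, hd, hcd, rfl⟩⟩
  -- the point of the second segment that lies on the line of the first segment
  generalize hy : c • a + d • b = y
  have hyP : y ∈ P := hy ▸ P.add_mem (P.smul_mem _ ha) (P.smul_mem _ hb)
  have hfy : inner ℝ f (y - p) = 0 := by
    rw [← hy, inner_sub_right, inner_add_right, inner_smul_right, inner_smul_right, hfp]
    have : (c + d) * s = s := by rw [hcd, one_mul]
    linarith
  have e1 := hf _ (P.sub_mem hyP hp) hfy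
  have e2 := hf _ (P.sub_mem hq hp) (by rw [inner_sub_right, hfp, hfq, sub_self])
  have hμ : inner ℝ v (q - p) ≠ 0 := by
    intro h0
    rw [h0, zero_smul, sub_eq_zero] at e2
    rw [e2] at hpq
    nlinarith [mul_self_nonneg (inner ℝ g p - s')]
  obtain ⟨τ, hτ⟩ : ∃ τ : ℝ, y = (1 - τ) • p + τ • q := by
    refine ⟨inner ℝ v (y - p) / inner ℝ v (q - p), ?_⟩
    have e3 : y - p = (inner ℝ v (y - p) / inner ℝ v (q - p)) • (q - p) := by
      generalize inner ℝ v (y - p) = A at *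
      generalize inner ℝ v (q - p) = B at *
      rw [e1, e2, smul_smul, div_mul_cancel₀ _ hμ]
    generalize inner ℝ v (y - p) / inner ℝ v (q - p) = τ at e3 ⊢
    rw [eq_add_of_sub_eq e3]
    module
  have hgy : inner ℝ g y = s' := by
    rw [← hy, inner_add_right, inner_smul_right, inner_smul_right, hga, hgb, ← add_mul, hcd,
      one_mul]
  have hτb : τ = d' := by
    refine huniq τ ?_
    rw [hτ, inner_add_right, inner_smul_right, inner_smul_right] at hgy
    linarith
  rw [hτ, hτb]
  exact ⟨1 - d', d', by linarith, hd', by ring, rfl⟩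

/-- Two chords of a regular polygon cross if and only if the endpoints of one are separated by those
of the other. -/
theorem crosses_regVertex_iff {P : Submodule ℝ V} (hP : Module.finrank ℝ P = 2) (huP : u ∈ P)
    (hwP : w ∈ P) (hu : ‖u‖ = 1) (hw : ‖w‖ = 1) (huw : inner ℝ u w = 0) (hr : 0 < r)
    {k l m m' : ℤ} (hkl : |k - l| < N) (hmk : |m - k| < N) (hml : |m - l| < N)
    (hmk' : |m' - k| < N) (hml' : |m' - l| < N) (hmm' : |m - m'| < N) (hm : m ≠ m') :
    Crosses s(regVertex u w r t σ N k, regVertex u w r t σ N l)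
        s(regVertex u w r t σ N m, regVertex u w r t σ N m') ↔
      ((m - k) * (m - l)) * ((m' - k) * (m' - l)) < 0 := by
  obtain ⟨c1, hc1, h1⟩ := exists_inner_sub_eq (t := t) (σ := σ) hu hw huw hr hmk hml
  obtain ⟨c2, hc2, h2⟩ := exists_inner_sub_eq (t := t) (σ := σ) hu hw huw hr hmk' hml'
  obtain ⟨c3, hc3, h3⟩ := exists_inner_sub_eq (t := t) (σ := σ) (k := k) (l := l) (m := k)
    hu hw huw hr (by simpa using (abs_nonneg _).trans_lt hkl) hkl
  obtain ⟨c4, hc4, h4⟩ := exists_inner_sub_eq (t := t) (σ := σ) (k := k) (l := l) (m := l)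
    hu hw huw hr (by rwa [abs_sub_comm]) (by simpa using (abs_nonneg _).trans_lt hkl)
  simp only [sub_self, zero_mul, mul_zero, Int.cast_zero, sub_zero] at h3 h4
  set f := dir u w (t + ((σ : ℤ) : ℝ) * (2 * Real.pi / N) * ((k + l) / 2)) with hf
  set s := r * Real.cos (Real.pi * (k - l) / N) with hs
  have hQP : ∀ i, regVertex u w r t σ N i ∈ P := fun i =>
    P.smul_mem _ (P.add_mem (P.smul_mem _ huP) (P.smul_mem _ hwP))
  set Q := regVertex u w r t σ N with hQ
  rw [crosses_mk_iff]
  constructor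
  · rintro ⟨hne, x, ⟨a, b, ha, hb, hab, rfl⟩, ⟨a', b', ha', hb', hab', hx⟩⟩
    have e1 : inner ℝ f (a • Q k + b • Q l) = s := by
      rw [inner_add_right, inner_smul_right, inner_smul_right, h3, h4, ← add_mul, hab, one_mul]
    have e2 : a' * c1 * ((m - k) * (m - l) : ℤ) + b' * c2 * ((m' - k) * (m' - l) : ℤ) = 0 := by
      rw [← hx, inner_add_right, inner_smul_right, inner_smul_right, h1, h2] at e1
      have : (a' + b') * s = s := by rw [hab', one_mul]
      linarith
    have hzero : (m - k) * (m - l) ≠ 0 ∨ (m' - k) * (m' - l) ≠ 0 := by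
      by_contra hcon
      push Not at hcon
      refine hne ?_
      have e3 := mul_eq_zero.1 hcon.1
      have e4 := mul_eq_zero.1 hcon.2
      rw [Sym2.eq_iff]
      rcases e3 with e3 | e3 <;> rcases e4 with e4 | e4
      · exact absurd (by omega) hm
      · left
        rw [sub_eq_zero.1 e3, sub_eq_zero.1 e4]
        exact ⟨rfl, rfl⟩
      · right
        rw [sub_eq_zero.1 e3, sub_eq_zero.1 e4]
        exact ⟨rfl, rfl⟩
      · exact absurd (by omega) hm
    generalize (m - k) * (m - l) = X at *
    generalize (m' - k) * (m' - l) = Y at *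
    have p1 : 0 < a' * c1 := by positivity
    have p2 : 0 < b' * c2 := by positivity
    by_contra hXY
    rw [not_lt] at hXY
    rcases mul_nonneg_iff.1 hXY with ⟨hX, hY⟩ | ⟨hX, hY⟩
    · have hX' : (0 : ℝ) ≤ X := by exact_mod_cast hX
      have hY' : (0 : ℝ) ≤ Y := by exact_mod_cast hY
      have q1 := mul_nonneg p1.le hX'
      have q2 := mul_nonneg p2.le hY'
      rcases hzero with h0 | h0
      · have := (mul_eq_zero.1 (by linarith : a' * c1 * (X : ℝ) = 0)).resolve_left p1.ne'
        exact h0 (by exact_mod_cast this)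
      · have := (mul_eq_zero.1 (by linarith : b' * c2 * (Y : ℝ) = 0)).resolve_left p2.ne'
        exact h0 (by exact_mod_cast this)
    · have hX' : (X : ℝ) ≤ 0 := by exact_mod_cast hX
      have hY' : (Y : ℝ) ≤ 0 := by exact_mod_cast hY
      have q1 := mul_nonpos_of_nonneg_of_nonpos p1.le hX'
      have q2 := mul_nonpos_of_nonneg_of_nonpos p2.le hY'
      rcases hzero with h0 | h0
      · have := (mul_eq_zero.1 (by linarith : a' * c1 * (X : ℝ) = 0)).resolve_left p1.ne'
        exact h0 (by exact_mod_cast this)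
      · have := (mul_eq_zero.1 (by linarith : b' * c2 * (Y : ℝ) = 0)).resolve_left p2.ne'
        exact h0 (by exact_mod_cast this)
  · intro hXY
    have hmkm : m ≠ k := by
      rintro rfl
      simp at hXY
    have hmlm : m ≠ l := by
      rintro rfl
      simp at hXY
    have hXY' : (((m - k) * (m - l) : ℤ) : ℝ) * ((m' - k) * (m' - l) : ℤ) < 0 := by
      exact_mod_cast hXY
    have hXY2 : (((k - m) * (k - m') : ℤ) : ℝ) * ((l - m) * (l - m') : ℤ) < 0 := by
      convert hXY' using 1
      push_cast
      ring
    have hX0 : (((m - k) * (m - l) : ℤ) : ℝ) ≠ 0 := by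
      intro h0
      rw [h0, zero_mul] at hXY'
      exact lt_irrefl _ hXY'
    obtain ⟨c5, hc5, h5⟩ := exists_inner_sub_eq (t := t) (σ := σ) (k := m) (l := m') (m := k)
      hu hw huw hr (by rwa [abs_sub_comm]) (by rwa [abs_sub_comm])
    obtain ⟨c6, hc6, h6⟩ := exists_inner_sub_eq (t := t) (σ := σ) (k := m) (l := m') (m := l)
      hu hw huw hr (by rwa [abs_sub_comm]) (by rwa [abs_sub_comm])
    obtain ⟨c7, hc7, h7⟩ := exists_inner_sub_eq (t := t) (σ := σ) (k := m) (l := m') (m := m)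
      hu hw huw hr (by simpa using (abs_nonneg _).trans_lt hkl) hmm'
    obtain ⟨c8, hc8, h8⟩ := exists_inner_sub_eq (t := t) (σ := σ) (k := m) (l := m') (m := m')
      hu hw huw hr (by rwa [abs_sub_comm]) (by simpa using (abs_nonneg _).trans_lt hkl)
    simp only [sub_self, zero_mul, mul_zero, Int.cast_zero, sub_zero] at h7 h8
    rw [← hQ] at h5 h6 h7 h8
    set g := dir u w (t + ((σ : ℤ) : ℝ) * (2 * Real.pi / N) * ((m + m') / 2)) with hg
    set s' := r * Real.cos (Real.pi * (m - m') / N) with hs'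
    generalize (((m - k) * (m - l) : ℤ) : ℝ) = X at *
    generalize (((m' - k) * (m' - l) : ℤ) : ℝ) = Y at *
    generalize (((k - m) * (k - m') : ℤ) : ℝ) = Z at *
    generalize (((l - m) * (l - m') : ℤ) : ℝ) = W at *
    refine ⟨?_, openSegment_inter_nonempty (hQP k) (hQP l) (hQP m) (hQP m')
      (v := dir u w (t + ((σ : ℤ) : ℝ) * (2 * Real.pi / N) * ((k + l) / 2) + Real.pi / 2)) ?_
      h3 h4 h7 h8 ?_ ?_⟩
    · intro heq
      have hfm : inner ℝ f (Q m) = s := by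
        rcases Sym2.eq_iff.1 heq with ⟨e1, -⟩ | ⟨-, e1⟩
        · rw [← e1, h3]
        · rw [← e1, h4]
      rw [hfm] at h1
      have : c1 * X = 0 := by linarith
      exact hX0 ((mul_eq_zero.1 this).resolve_left hc1.ne')
    · intro y hy hfy
      refine dir_coords hP huP hwP hu hw huw hy
        (t + ((σ : ℤ) : ℝ) * (2 * Real.pi / N) * ((k + l) / 2) + Real.pi / 2) ?_
      rw [add_assoc _ (Real.pi / 2), add_halves, dir_add_pi, inner_neg_left, ← hf, hfy, neg_zero]
    · rw [h1, h2]
      nlinarith [mul_pos hc1 hc2]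
    · rw [h5, h6]
      nlinarith [mul_pos hc5 hc6]

/-- The reflection in the line with direction halfway between the vertices `0` and `s`. -/
theorem reflection_regVertex (hu : ‖u‖ = 1) (hw : ‖w‖ = 1) (huw : inner ℝ u w = 0) (s k : ℤ) :
    (ℝ ∙ dir u w (t + ((σ : ℤ) : ℝ) * (2 * Real.pi / N) * (s / 2))).reflection
      (regVertex u w r t σ N k) = regVertex u w r t σ N (s - k) := by
  have h1 := dir_recurrence u w (((σ : ℤ) : ℝ) * (2 * Real.pi / N) * (s / 2 - k))
    (t + ((σ : ℤ) : ℝ) * (2 * Real.pi / N) * (s / 2))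
  rw [Submodule.reflection_singleton_apply, norm_dir hu hw huw, regVertex, regVertex,
    inner_smul_right, inner_dir_dir hu hw huw]
  have e1 : t + ((σ : ℤ) : ℝ) * (2 * Real.pi / N) * (s / 2) +
      ((σ : ℤ) : ℝ) * (2 * Real.pi / N) * (s / 2 - k) =
      t + ((σ : ℤ) : ℝ) * (2 * Real.pi / N) * (s - k : ℤ) := by
    push_cast
    ring
  have e2 : t + ((σ : ℤ) : ℝ) * (2 * Real.pi / N) * (s / 2) -
      ((σ : ℤ) : ℝ) * (2 * Real.pi / N) * (s / 2 - k) =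
      t + ((σ : ℤ) : ℝ) * (2 * Real.pi / N) * k := by
    ring
  have e3 : t + ((σ : ℤ) : ℝ) * (2 * Real.pi / N) * (s / 2) -
      (t + ((σ : ℤ) : ℝ) * (2 * Real.pi / N) * k) =
      ((σ : ℤ) : ℝ) * (2 * Real.pi / N) * (s / 2 - k) := by
    ring
  rw [e1, e2] at h1
  rw [e3, eq_sub_of_add_eq h1]
  simp only [RCLike.ofReal_real_eq_id, id, one_pow, div_one, two_smul]
  module

end Plane

/-! ### The zigzag in the expanded polygon -/

theorem zig_even {k : ℕ} (hk : k % 2 = 0) : zig k = ((k / 2 : ℕ) : ℤ) := if_pos hk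

theorem zig_odd {k : ℕ} (hk : k % 2 = 1) : zig k = -(((k + 1) / 2 : ℕ) : ℤ) :=
  if_neg (by omega)

theorem zig_eq_neg_zag (k : ℕ) : zig k = -zag k := by
  rcases Nat.mod_two_eq_zero_or_one k with h0 | h0
  · rw [zig_even h0, zag_even h0, neg_neg]
  · rw [zig_odd h0, zag_odd h0]

theorem exists_dvd_sub_zig {N : ℕ} (hN : 0 < N) (j : ℤ) : ∃ k < N, (N : ℤ) ∣ j - zig k := by
  obtain ⟨k, hk, h1⟩ := exists_dvd_sub_zag hN (-j)
  refine ⟨k, hk, ?_⟩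
  rwa [zig_eq_neg_zag, ← dvd_neg, show -(j - -zag k) = -j - zag k by ring]

theorem zig_inj_of_dvd {N a b : ℕ} (ha : a < N) (hb : b < N) (hab : (N : ℤ) ∣ zig a - zig b) :
    a = b := by
  refine zag_inj_of_dvd ha hb ?_
  rwa [zig_eq_neg_zag, zig_eq_neg_zag, neg_sub_neg, ← dvd_neg, neg_sub] at hab

theorem abs_zig_sub_lt {N a b : ℕ} (ha : a < N) (hb : b < N) : |zig a - zig b| < N := by
  unfold zig
  split_ifs <;> rw [abs_lt] <;> omega

theorem dvd_iff_of_abs_le {N m : ℤ} (hN : 0 < N) (hm : |m| ≤ N) :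
    N ∣ m ↔ m = 0 ∨ m = N ∨ m = -N := by
  rw [abs_le] at hm
  constructor
  · rintro ⟨t, rfl⟩
    have h1 : -1 ≤ t := by nlinarith
    have h2 : t ≤ 1 := by nlinarith
    have : t = 0 ∨ t = 1 ∨ t = -1 := by omega
    rcases this with rfl | rfl | rfl <;> simp
  · rintro (rfl | rfl | rfl) <;> simp

/-- The pairs of positions on the zigzag with `h + 2` vertices whose vertices span a diagonal: those
at distance at least three, and those at distance one which do not contain an end of the zigzag. -/
def DiagPair (h i j : ℕ) : Prop := i + 3 ≤ j ∧ j ≤ h + 1 ∨ 1 ≤ i ∧ j = i + 1 ∧ j ≤ h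

theorem diagPair_iff {h i j : ℕ} (hh : 3 ≤ h) (hij : i < j) (hj : j ≤ h + 1) :
    DiagPair h i j ↔ ¬ ((h + 2 : ℕ) : ℤ) ∣ zig j - zig i - 1 ∧
      ¬ ((h + 2 : ℕ) : ℤ) ∣ zig j - zig i + 1 := by
  have h1 := abs_lt.1 (abs_zig_sub_lt (N := h + 2) (a := j) (b := i) (by omega) (by omega))
  rw [dvd_iff_of_abs_le (by omega) (abs_le.2 ⟨by omega, by omega⟩),
    dvd_iff_of_abs_le (by omega) (abs_le.2 ⟨by omega, by omega⟩), DiagPair]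
  unfold zig at h1 ⊢
  split_ifs at h1 ⊢ <;> omega

/-- The position of a vertex relative to an edge of the zigzag. -/
theorem zig_side (k m : ℕ) :
    (m ≤ k → (zig (k + 1) - zig m) * (zig (k + 2) - zig m) < 0) ∧
    (m = k + 1 ∨ m = k + 2 → (zig (k + 1) - zig m) * (zig (k + 2) - zig m) = 0) ∧
    (k + 3 ≤ m → 0 < (zig (k + 1) - zig m) * (zig (k + 2) - zig m)) := by
  refine ⟨fun hm => ?_, ?_, fun hm => ?_⟩
  · rcases Nat.mod_two_eq_zero_or_one k with h0 | h0
    · rw [mul_neg_iff]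
      unfold zig
      split_ifs <;> omega
    · rw [mul_neg_iff]
      unfold zig
      split_ifs <;> omega
  · rintro (rfl | rfl) <;> simp
  · rw [mul_pos_iff]
    unfold zig
    split_ifs <;> omega

section Path

variable {n : ℕ} {M : CoxeterMatrix (Fin n)} {V : Type*} [NormedAddCommGroup V]
  [InnerProductSpace ℝ V] [FiniteDimensional ℝ V] {S : SimpleSystem M V} {o : Set V} {h : ℕ}

/-- A cyclic labelling of the vertices of the expanded polygon in which the path is the zigzag
without its two ends. -/
structure Labelling (Γ : OrbitPath S o h) (E : Expansion S o) where
  a : ℤ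
  σ : ℤˣ
  q_x : ∀ m < h, E.q (Γ.x m) = E.vertex (a + σ * zig (m + 1))

namespace Labelling

variable {Γ : OrbitPath S o h} {E : Expansion S o} (L : Labelling Γ E)

/-- The vertices of the polygon in the new labelling. -/
def Q (k : ℤ) : V := E.vertex (L.a + L.σ * k)

/-- The vertices of the polygon in the order of the zigzag. -/
def Y (k : ℕ) : V := L.Q (zig k)

theorem q_x_eq {m : ℕ} (hm : m < h) : E.q (Γ.x m) = L.Y (m + 1) := L.q_x m hm

theorem Q_eq (k : ℤ) : L.Q k = regVertex E.polygon.u E.polygon.w E.polygon.radius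
    (2 * Real.pi * L.a / (h + 2 : ℕ) + E.θ) L.σ (h + 2) k := by
  rw [Q, Expansion.vertex, ngon_eq_dir, Γ.coxeterNumber_eq, regVertex]
  congr 2
  push_cast
  ring

theorem Q_eq_iff (i j : ℤ) : L.Q i = L.Q j ↔ ((h + 2 : ℕ) : ℤ) ∣ i - j := by
  rw [Q_eq, Q_eq, regVertex_eq_iff E.polygon.norm_u E.polygon.norm_w E.polygon.inner_u_w
    E.polygon.radius_pos (by omega)]

theorem Y_inj {i j : ℕ} (hi : i ≤ h + 1) (hj : j ≤ h + 1) (hij : L.Y i = L.Y j) : i = j :=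
  zig_inj_of_dvd (N := h + 2) (by omega) (by omega) ((L.Q_eq_iff _ _).1 hij)

theorem exists_Y (k : ℤ) : ∃ i ≤ h + 1, L.Q k = L.Y i := by
  obtain ⟨i, hi, h1⟩ := exists_dvd_sub_zig (N := h + 2) (by omega) k
  exact ⟨i, by omega, (L.Q_eq_iff _ _).2 h1⟩

theorem mk_Y_eq_iff {i j i' j' : ℕ} (hij : i < j) (hj : j ≤ h + 1) (hij' : i' < j')
    (hj' : j' ≤ h + 1) : s(L.Y i, L.Y j) = s(L.Y i', L.Y j') ↔ i = i' ∧ j = j' := by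
  constructor
  · intro heq
    rcases Sym2.eq_iff.1 heq with ⟨h1, h2⟩ | ⟨h1, h2⟩
    · exact ⟨L.Y_inj (by omega) (by omega) h1, L.Y_inj (by omega) (by omega) h2⟩
    · have := L.Y_inj (by omega) (by omega) h1
      have := L.Y_inj (by omega) (by omega) h2
      omega
  · rintro ⟨rfl, rfl⟩
    rfl

theorem exists_vertex_eq (k : ℤ) : ∃ j, E.vertex k = L.Q j ∧ k = L.a + L.σ * j := by
  have hσσ : (L.σ : ℤ) * L.σ = 1 := by rw [← Units.val_mul, Int.units_mul_self, Units.val_one]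
  have h1 : k = L.a + L.σ * (L.σ * (k - L.a)) := by linear_combination -(k - L.a) * hσσ
  exact ⟨L.σ * (k - L.a), by rw [Q, ← h1], h1⟩

theorem mem_diagonals_iff_Q (d : Sym2 V) : d ∈ E.diagonals ↔
    ∃ i j : ℤ, ¬ ((h + 2 : ℕ) : ℤ) ∣ j - i ∧ ¬ ((h + 2 : ℕ) : ℤ) ∣ j - i - 1 ∧
      ¬ ((h + 2 : ℕ) : ℤ) ∣ j - i + 1 ∧ d = s(L.Q i, L.Q j) := by
  have key : ∀ i j : ℤ, (¬ ((h + 2 : ℕ) : ℤ) ∣ j - i ∧ ¬ ((h + 2 : ℕ) : ℤ) ∣ j - i - 1 ∧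
      ¬ ((h + 2 : ℕ) : ℤ) ∣ j - i + 1) ↔
      (¬ ((h + 2 : ℕ) : ℤ) ∣ (L.a + L.σ * j) - (L.a + L.σ * i) ∧
      ¬ ((h + 2 : ℕ) : ℤ) ∣ (L.a + L.σ * j) - (L.a + L.σ * i) - 1 ∧
      ¬ ((h + 2 : ℕ) : ℤ) ∣ (L.a + L.σ * j) - (L.a + L.σ * i) + 1) := by
    intro i j
    rcases Int.units_eq_one_or L.σ with hσ | hσ
    · simp [hσ]
    · rw [hσ, ← dvd_neg (b := j - i), ← dvd_neg (b := j - i - 1), ← dvd_neg (b := j - i + 1)]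
      have e1 : L.a + ((-1 : ℤˣ) : ℤ) * j - (L.a + ((-1 : ℤˣ) : ℤ) * i) = -(j - i) := by
        push_cast
        ring
      rw [e1, show -(j - i) - 1 = -(j - i + 1) by ring, show -(j - i) + 1 = -(j - i - 1) by ring]
      tauto
  rw [Expansion.diagonals, Set.mem_ofPred_eq, Γ.coxeterNumber_eq]
  constructor
  · rintro ⟨i, j, h1, h2, h3, rfl⟩
    obtain ⟨i', hi, hi'⟩ := L.exists_vertex_eq i
    obtain ⟨j', hj, hj'⟩ := L.exists_vertex_eq j
    rw [hi', hj'] at h1 h2 h3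
    obtain ⟨k1, k2, k3⟩ := (key i' j').2 ⟨h1, h2, h3⟩
    exact ⟨i', j', k1, k2, k3, by rw [hi, hj]⟩
  · rintro ⟨i, j, h1, h2, h3, rfl⟩
    obtain ⟨k1, k2, k3⟩ := (key i j).1 ⟨h1, h2, h3⟩
    exact ⟨_, _, k1, k2, k3, rfl⟩

/-- The diagonals in terms of positions on the zigzag. -/
theorem mem_diagonals_iff (d : Sym2 V) : d ∈ E.diagonals ↔
    ∃ i j : ℕ, DiagPair h i j ∧ d = s(L.Y i, L.Y j) := by
  have h3 := Γ.three_le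
  rw [L.mem_diagonals_iff_Q]
  constructor
  · rintro ⟨i, j, h1, h2, h3', rfl⟩
    obtain ⟨i', hi, hi'⟩ := L.exists_Y i
    obtain ⟨j', hj, hj'⟩ := L.exists_Y j
    obtain ⟨s, hs⟩ := (L.Q_eq_iff _ _).1 hi'
    obtain ⟨t, ht⟩ := (L.Q_eq_iff _ _).1 hj'
    rw [hi', hj']
    have e : j - i = zig j' - zig i' + (h + 2 : ℕ) * (t - s) := by
      rw [mul_sub]
      omega
    have k1 : ¬ ((h + 2 : ℕ) : ℤ) ∣ zig j' - zig i' := by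
      rwa [e, dvd_add_left (dvd_mul_right _ _)] at h1
    have k2 : ¬ ((h + 2 : ℕ) : ℤ) ∣ zig j' - zig i' - 1 := by
      rwa [e, add_sub_right_comm, dvd_add_left (dvd_mul_right _ _)] at h2
    have k3 : ¬ ((h + 2 : ℕ) : ℤ) ∣ zig j' - zig i' + 1 := by
      rwa [e, add_right_comm, dvd_add_left (dvd_mul_right _ _)] at h3'
    rcases lt_trichotomy i' j' with hlt | heq | hlt
    · exact ⟨i', j', (diagPair_iff h3 hlt hj).2 ⟨k2, k3⟩, rfl⟩
    · rw [heq, sub_self] at k1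
      exact absurd (dvd_zero _) k1
    · refine ⟨j', i', (diagPair_iff h3 hlt hi).2 ⟨?_, ?_⟩, Sym2.eq_swap⟩
      · rwa [← dvd_neg, show -(zig i' - zig j' - 1) = zig j' - zig i' + 1 by ring]
      · rwa [← dvd_neg, show -(zig i' - zig j' + 1) = zig j' - zig i' - 1 by ring]
  · rintro ⟨i, j, hij, rfl⟩
    have h1 : i < j ∧ j ≤ h + 1 := by
      unfold DiagPair at hij
      omega
    have h2 := (diagPair_iff h3 h1.1 h1.2).1 hij
    refine ⟨zig i, zig j, fun hd => ?_, h2.1, h2.2, rfl⟩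
    have := zig_inj_of_dvd (N := h + 2) (by omega) (by omega) hd
    omega

/-- The simple reflection with label `lab k` gives rise to the `k`-th edge of the path. -/
theorem mem_negDiagram_iff (i : Fin n) (d : Sym2 V) : d ∈ E.negDiagram i ↔
    ∃ k, k + 1 < h ∧ Γ.lab k = i ∧ d = s(L.Y (k + 1), L.Y (k + 2)) := by
  constructor
  · rintro ⟨x, hx, hne, rfl⟩
    obtain ⟨m, hm, rfl⟩ := (Γ.mem_iff x).1 hx
    by_cases h1 : m + 1 < h ∧ Γ.lab m = i
    · obtain ⟨h1, rfl⟩ := h1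
      refine ⟨m, h1, rfl, ?_⟩
      rw [Γ.step m h1, L.q_x_eq hm, L.q_x_eq h1]
    by_cases h2 : ∃ j, j + 1 = m ∧ Γ.lab j = i
    · obtain ⟨j, rfl, rfl⟩ := h2
      refine ⟨j, hm, rfl, ?_⟩
      rw [Γ.step_back hm, L.q_x_eq hm, L.q_x_eq (by omega), Sym2.eq_swap]
    · push Not at h1 h2
      exact absurd (Γ.fix m hm i h1 h2) hne
  · rintro ⟨k, hk, rfl, rfl⟩
    refine ⟨Γ.x k, Γ.x_mem (by omega), ?_, ?_⟩
    · rw [Γ.step k hk]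
      intro h1
      have := Γ.x_inj hk (by omega) h1
      omega
    · rw [Γ.step k hk, L.q_x_eq (by omega), L.q_x_eq hk]

theorem snake_eq (k : ℕ) : snake L.Q k = s(L.Y (k + 1), L.Y (k + 2)) := by
  rw [snake, Y, Y]
  rcases Nat.mod_two_eq_zero_or_one k with h0 | h0
  · rw [zig_odd (by omega), zig_even (by omega), Sym2.eq_swap]
    congr 3 <;> omega
  · rw [zig_even (by omega), zig_odd (by omega)]
    congr 3 <;> omega

theorem crosses_iff {k l m m' : ℕ} (hk : k ≤ h + 1) (hl : l ≤ h + 1) (hm : m ≤ h + 1)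
    (hm' : m' ≤ h + 1) (hmm' : m ≠ m') : Crosses s(L.Y k, L.Y l) s(L.Y m, L.Y m') ↔
    ((zig m - zig k) * (zig m - zig l)) * ((zig m' - zig k) * (zig m' - zig l)) < 0 := by
  have hz : ∀ {a b : ℕ}, a ≤ h + 1 → b ≤ h + 1 → |zig a - zig b| < (h + 2 : ℕ) := fun ha hb =>
    abs_zig_sub_lt (by omega) (by omega)
  simp only [Y, Q_eq]
  refine crosses_regVertex_iff Γ.finrank_coxeterPlane E.polygon.u_mem E.polygon.w_mem
    E.polygon.norm_u E.polygon.norm_w E.polygon.inner_u_w E.polygon.radius_pos (hz hk hl) (hz hm hk)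
    (hz hm hl) (hz hm' hk) (hz hm' hl) (hz hm hm') fun heq => hmm' ?_
  exact zig_inj_of_dvd (N := h + 2) (by omega) (by omega) (by rw [heq, sub_self]; exact dvd_zero _)

/-- The chord from position `i` to position `j` crosses precisely the edges of the path strictly
between these positions. -/
theorem crosses_snake_iff {i j k : ℕ} (hij : i < j) (hj : j ≤ h + 1) (hk : k + 1 < h) :
    Crosses s(L.Y i, L.Y j) s(L.Y (k + 1), L.Y (k + 2)) ↔ i ≤ k ∧ k + 3 ≤ j := by
  rw [L.crosses_iff (by omega) hj (by omega) (by omega) (by omega)]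
  have e : ((zig (k + 1) - zig i) * (zig (k + 1) - zig j)) *
      ((zig (k + 2) - zig i) * (zig (k + 2) - zig j)) =
      ((zig (k + 1) - zig i) * (zig (k + 2) - zig i)) *
      ((zig (k + 1) - zig j) * (zig (k + 2) - zig j)) := by ring
  rw [e]
  obtain ⟨a1, a2, a3⟩ := zig_side k i
  obtain ⟨b1, b2, b3⟩ := zig_side k j
  constructor
  · intro hlt
    by_contra hcon
    rcases (by omega : j ≤ k ∨ (j = k + 1 ∨ j = k + 2) ∨ (i = k + 1 ∨ i = k + 2) ∨ k + 3 ≤ i) with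
      h1 | h1 | h1 | h1
    · nlinarith [a1 (by omega), b1 (by omega)]
    · rw [b2 h1, mul_zero] at hlt
      exact lt_irrefl _ hlt
    · rw [a2 h1, zero_mul] at hlt
      exact lt_irrefl _ hlt
    · nlinarith [a3 (by omega), b3 (by omega)]
  · rintro ⟨h1, h2⟩
    exact mul_neg_of_neg_of_pos (a1 h1) (b3 h2)

/-! ### The mirrors -/

/-- The reflection in the mirror of sign `ε` sends the vertex `k` to the vertex
`mirrorSum ε - k`. -/
def mirrorSum (_ : Labelling Γ E) (ε : Bool) : ℤ := if ε = Γ.firstSide then -1 else 0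

/-- The mirror of sign `ε`. -/
def mirror (ε : Bool) : Submodule ℝ V :=
  ℝ ∙ dir E.polygon.u E.polygon.w (2 * Real.pi * L.a / (h + 2 : ℕ) + E.θ +
    ((L.σ : ℤ) : ℝ) * (2 * Real.pi / (h + 2 : ℕ)) * (L.mirrorSum ε / 2))

theorem mirror_reflection (ε : Bool) (k : ℤ) :
    (L.mirror ε).reflection (L.Q k) = L.Q (L.mirrorSum ε - k) := by
  rw [Q_eq, Q_eq]
  exact reflection_regVertex E.polygon.norm_u E.polygon.norm_w E.polygon.inner_u_w _ _

/-- The mirror of sign `ε` interchanges the ends of the edges of the path with labels in the side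
`!ε`. -/
theorem zig_add_of_side {ε : Bool} {k : ℕ} (hk : k + 1 < h) (hs : S.side (Γ.lab k) = !ε) :
    zig (k + 1) + zig (k + 2) = L.mirrorSum ε := by
  rw [Γ.side_lab hk] at hs
  rw [mirrorSum]
  rcases Nat.mod_two_eq_zero_or_one k with h0 | h0
  · rw [if_pos h0] at hs
    rw [hs, if_neg (by simp), zig_odd (by omega), zig_even (by omega)]
    omega
  · rw [if_neg (by omega)] at hs
    rw [if_pos (by simpa using hs.symm), zig_even (by omega), zig_odd (by omega)]
    omega

theorem isMirror_mirror (ε : Bool) : E.IsMirror ε (L.mirror ε) := by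
  have hne : dir E.polygon.u E.polygon.w (2 * Real.pi * L.a / (h + 2 : ℕ) + E.θ +
      ((L.σ : ℤ) : ℝ) * (2 * Real.pi / (h + 2 : ℕ)) * (L.mirrorSum ε / 2)) ≠ 0 := by
    rw [← norm_ne_zero_iff, norm_dir E.polygon.norm_u E.polygon.norm_w E.polygon.inner_u_w]
    exact one_ne_zero
  have hswap : ∀ k, k + 1 < h → S.side (Γ.lab k) = !ε →
      (L.mirror ε).reflection (L.Y (k + 1)) = L.Y (k + 2) ∧
      (L.mirror ε).reflection (L.Y (k + 2)) = L.Y (k + 1) := by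
    intro k hk hs
    have := L.zig_add_of_side hk hs
    rw [Y, Y, mirror_reflection, mirror_reflection]
    constructor <;> congr 1 <;> omega
  refine ⟨?_, finrank_span_singleton hne, fun i hi => ⟨?_, ?_⟩⟩
  · rw [mirror, Submodule.span_singleton_le_iff_mem]
    exact Submodule.add_mem _ (Submodule.smul_mem _ _ E.polygon.u_mem)
      (Submodule.smul_mem _ _ E.polygon.w_mem)
  · intro a b hab x hx
    obtain ⟨k, hk, rfl, heq⟩ := (L.mem_negDiagram_iff i _).1 hab
    obtain ⟨h1, h2⟩ := hswap k hk hi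
    have hb : b = (L.mirror ε).reflection a := by
      rcases Sym2.eq_iff.1 heq with ⟨rfl, rfl⟩ | ⟨rfl, rfl⟩
      exacts [h1.symm, h2.symm]
    have hx' := Submodule.reflection_mem_subspace_eq_self hx
    have h3 : inner ℝ ((L.mirror ε).reflection a) ((L.mirror ε).reflection x) = inner ℝ a x :=
      LinearIsometryEquiv.inner_map_map _ _ _
    rw [hx'] at h3
    rw [hb, inner_sub_left, h3, sub_self]
  · have h1 : ∀ d ∈ E.negDiagram i, Sym2.map (L.mirror ε).reflection d = d := by
      intro d hd
      obtain ⟨k, hk, rfl, rfl⟩ := (L.mem_negDiagram_iff i _).1 hd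
      rw [Sym2.map_mk, (hswap k hk hi).1, (hswap k hk hi).2, Sym2.eq_swap]
    rw [Set.image_congr h1, Set.image_id']

theorem isMirror_iff (ε : Bool) (ℓ : Submodule ℝ V) : E.IsMirror ε ℓ ↔ ℓ = L.mirror ε := by
  refine ⟨fun hℓ => ?_, fun hℓ => hℓ ▸ L.isMirror_mirror ε⟩
  have h3 := Γ.three_le
  obtain ⟨k, hk, hs⟩ : ∃ k, k + 1 < h ∧ S.side (Γ.lab k) = !ε := by
    by_cases hε : S.side (Γ.lab 0) = !ε
    · exact ⟨0, by omega, hε⟩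
    · refine ⟨1, by omega, ?_⟩
      rw [Γ.alt 0 (by omega), Bool.eq_not_of_ne hε, Bool.not_not]
  refine Submodule.eq_of_le_of_finrank_eq (fun x hx => ?_) ?_
  · have h1 := (hℓ.2.2 _ hs).1 _ _ ((L.mem_negDiagram_iff _ _).2 ⟨k, hk, rfl, rfl⟩) x hx
    have hne : L.Y (k + 2) - L.Y (k + 1) ≠ 0 := by
      rw [sub_ne_zero]
      intro heq
      have := L.Y_inj (by omega) (by omega) heq
      omega
    have hsum := L.zig_add_of_side hk hs
    have hsum' : (zig (k + 2) : ℝ) + zig (k + 1) = L.mirrorSum ε := by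
      exact_mod_cast (by omega)
    rw [Y, Y, Q_eq, Q_eq, regVertex_sub, hsum'] at hne h1
    rw [inner_smul_left, mul_eq_zero] at h1
    have h2 := h1.resolve_left fun h0 => hne (by
      rw [conj_trivial] at h0
      rw [h0, zero_smul])
    rw [dir_coords Γ.finrank_coxeterPlane E.polygon.u_mem E.polygon.w_mem E.polygon.norm_u
      E.polygon.norm_w E.polygon.inner_u_w (hℓ.1 hx) _ h2]
    exact Submodule.smul_mem _ _ (Submodule.mem_span_singleton_self _)
  · rw [hℓ.2.1, (L.isMirror_mirror ε).2.1]

theorem q_injOn (L : Labelling Γ E) : Set.InjOn E.q o := by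
  intro x hx y hy hxy
  obtain ⟨a, ha, rfl⟩ := (Γ.mem_iff x).1 hx
  obtain ⟨b, hb, rfl⟩ := (Γ.mem_iff y).1 hy
  rw [L.q_x_eq ha, L.q_x_eq hb] at hxy
  have := L.Y_inj (by omega) (by omega) hxy
  rw [show a = b by omega]

end Labelling

theorem OrbitPath.nonempty_labelling (Γ : OrbitPath S o h) (E : Expansion S o) :
    Nonempty (Labelling Γ E) := by
  obtain ⟨a, σ, hq⟩ := Γ.exists_zigzag E
  exact ⟨⟨a, σ, hq⟩⟩

end Path

/-! ### Roots as differences of vertices -/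

section Path

variable {n : ℕ} {M : CoxeterMatrix (Fin n)} {V : Type*} [NormedAddCommGroup V]
  [InnerProductSpace ℝ V] [FiniteDimensional ℝ V] {S : SimpleSystem M V} {o : Set V} {h : ℕ}

namespace SimpleSystem

variable (S)

/-- Two roots on the same ray are equal. -/
theorem eq_of_smul_eq_smul {β γ : V} (hβ : β ∈ roots S.α) (hγ : γ ∈ roots S.α) {s t : ℝ}
    (hs : 0 < s) (ht : 0 < t) (heq : s • β = t • γ) : β = γ := by
  have h1 : (s / t) • β = γ := by
    rw [div_eq_inv_mul, mul_smul, heq, smul_smul, inv_mul_cancel₀ ht.ne', one_smul]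
  rcases S.reduced β hβ (s / t) (h1 ▸ hγ) with h2 | h2
  · rw [← h1, h2, one_smul]
  · have := div_pos hs ht
    linarith

theorem roots_of_mem_almostPositiveRoots {β : V} (hβ : β ∈ S.almostPositiveRoots) :
    β ∈ roots S.α := by
  rcases hβ with hβ | ⟨i, rfl⟩
  exacts [hβ.1, neg_mem_roots (basis_mem_roots _ i)]

theorem neg_basis_mem (i : Fin n) : -S.α i ∈ S.almostPositiveRoots := Or.inr ⟨i, rfl⟩

theorem repr_half_of_side_ne {ε : Bool} {i : Fin n} (hi : S.side i ≠ ε) (x : V) :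
    S.α.repr (S.half ε x) i = S.α.repr x i := by
  rw [half_apply, map_sub, Finsupp.sub_apply, map_sum, Finset.sum_apply', Finset.sum_eq_zero,
    sub_zero]
  intro j hj
  have hji : j ≠ i := by
    rintro rfl
    exact hi (Finset.mem_filter.1 hj).2
  simp [hji]

theorem half_neg_basis {ε : Bool} {i : Fin n} (hi : S.side i = ε) :
    S.half ε (-S.α i) = S.α i := by
  rw [S.half_eq_simpleReflection hi, map_neg, simpleReflection_self, neg_neg]
  intro j hj hji
  rw [map_neg, neg_inj, simpleReflection_eq_self_iff]
  exact S.inner_eq_zero hji (hj.trans hi.symm)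

theorem tau_neg_basis_of_ne {ε : Bool} {i : Fin n} (hi : S.side i = !ε) :
    S.tau ε (-S.α i) = -S.α i := if_pos ⟨i, hi, rfl⟩

theorem tau_of_forall {ε : Bool} {β : V} (hβ : ∀ i, S.side i = !ε → β ≠ -S.α i) :
    S.tau ε β = S.half ε β := if_neg (by rintro ⟨i, h1, h2⟩; exact hβ i h1 h2)

/-- A positive root is not the negative of a simple root. -/
theorem ne_neg_basis {β : V} (hβ : ∀ i, 0 ≤ S.α.repr β i) (i : Fin n) : β ≠ -S.α i := by
  rintro rfl
  have := hβ i
  simp at this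
  linarith

theorem tau_of_nonneg {ε : Bool} {β : V} (hβ : ∀ i, 0 ≤ S.α.repr β i) :
    S.tau ε β = S.half ε β := S.tau_of_forall fun i _ => S.ne_neg_basis hβ i

theorem tau_neg_basis_of_eq {ε : Bool} {i : Fin n} (hi : S.side i = ε) :
    S.tau ε (-S.α i) = S.α i := by
  rw [S.tau_of_forall, S.half_neg_basis hi]
  intro j hj heq
  rw [neg_inj] at heq
  rw [← S.α.injective heq, hi] at hj
  simp at hj

theorem eq_neg_basis_of_repr_neg {β : V} (hβ : β ∈ S.almostPositiveRoots) {i : Fin n}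
    (hi : S.α.repr β i < 0) : β = -S.α i := by
  rcases hβ with hβ | ⟨j, rfl⟩
  · exact absurd (hβ.2 i) (not_le.2 hi)
  · by_cases hji : j = i
    · rw [hji]
    · simp [hji] at hi

theorem tau_tau (ε : Bool) {β : V} (hβ : β ∈ S.almostPositiveRoots) :
    S.tau ε (S.tau ε β) = β := by
  by_cases hfix : ∃ i, S.side i = !ε ∧ β = -S.α i
  · obtain ⟨i, hi, rfl⟩ := hfix
    rw [S.tau_neg_basis_of_ne hi, S.tau_neg_basis_of_ne hi]
  · push Not at hfix
    rw [S.tau_of_forall hfix, S.tau_of_forall, S.half_half]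
    intro i hi heq
    have hi' : S.side i ≠ ε := by
      rw [hi]
      simp
    refine hfix i hi (S.eq_neg_basis_of_repr_neg hβ ?_)
    rw [← S.repr_half_of_side_ne hi', heq]
    simp

end SimpleSystem

namespace OrbitPath

variable (Γ : OrbitPath S o h)

/-- The vector attached to the chord from position `i` to position `j` of the zigzag, `i < j`:
each endpoint is moved by one position towards the other, so that also the two new vertices, in the
positions `0` and `h + 1`, get a vertex of the path.  For `j = i + 1` the vector is a negative multiple
of a simple root. -/
def vec (i j : ℕ) : V := Γ.κ • (Γ.x i - Γ.x (j - 2))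

theorem vec_snake {k : ℕ} (hk : k + 1 < h) :
    Γ.vec (k + 1) (k + 2) = -(Γ.coef k • S.α (Γ.lab k)) := by
  rw [vec, Nat.add_sub_cancel, ← Γ.diff k hk, ← smul_neg, neg_sub]

theorem mem_of_apply (Γ : OrbitPath S o h) {g : V ≃ₗᵢ[ℝ] V} (hg : g ∈ reflectionGroup S.α) {y : V}
    (hy : y ∈ o) : g y ∈ o := by
  refine apply_mem_of_stable (fun i x hx => ?_) hg hy
  obtain ⟨k, hk, rfl⟩ := (Γ.mem_iff x).1 hx
  by_cases h1 : k + 1 < h ∧ Γ.lab k = i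
  · rw [← h1.2, Γ.step k h1.1]
    exact Γ.x_mem h1.1
  by_cases h2 : ∃ j, j + 1 = k ∧ Γ.lab j = i
  · obtain ⟨j, rfl, rfl⟩ := h2
    rw [Γ.step_back hk]
    exact Γ.x_mem (by omega)
  · push Not at h1 h2
    rw [Γ.fix k hk i h1 h2]
    exact hx

/-- Every root is a multiple of a difference of vertices. -/
theorem exists_of_mem_roots {β : V} (hβ : β ∈ roots S.α) : ∃ g ∈ reflectionGroup S.α,
    ∃ k a b, k + 1 < h ∧ a < h ∧ b < h ∧ g (Γ.x k) = Γ.x a ∧ g (Γ.x (k + 1)) = Γ.x b ∧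
      β = (Γ.κ / Γ.coef k) • (Γ.x a - Γ.x b) := by
  obtain ⟨i, g, hg, rfl⟩ := hβ
  obtain ⟨k, hk, rfl⟩ := Γ.surj i
  obtain ⟨a, ha, ha'⟩ := (Γ.mem_iff _).1 (Γ.mem_of_apply hg (Γ.x_mem (by omega : k < h)))
  obtain ⟨b, hb, hb'⟩ := (Γ.mem_iff _).1 (Γ.mem_of_apply hg (Γ.x_mem hk))
  refine ⟨g, hg, k, a, b, hk, ha, hb, ha'.symm, hb'.symm, ?_⟩
  rw [ha', hb', ← map_sub, div_eq_inv_mul, mul_smul, ← map_smul g, Γ.diff k hk, ← map_smul,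
    smul_smul, inv_mul_cancel₀ (Γ.coef_pos k hk).ne', one_smul]

/-- Positive roots are positive multiples of the differences `κ • (x a - x b)` with `a < b`. -/
theorem exists_of_mem_positiveRoots {β : V} (hβ : β ∈ S.positiveRoots) :
    ∃ g ∈ reflectionGroup S.α, ∃ k a b, k + 1 < h ∧ a < b ∧ b < h ∧ g (Γ.x k) = Γ.x a ∧
      g (Γ.x (k + 1)) = Γ.x b ∧ Γ.κ • (Γ.x a - Γ.x b) = Γ.coef k • β := by
  obtain ⟨g, hg, k, a, b, hk, ha, hb, hga, hgb, hβ'⟩ := Γ.exists_of_mem_roots hβ.1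
  have hc := Γ.coef_pos k hk
  have heq : Γ.κ • (Γ.x a - Γ.x b) = Γ.coef k • β := by
    rw [hβ', smul_smul, mul_div_cancel₀ _ hc.ne']
  have hne : a ≠ b := by
    rintro rfl
    rw [← hga] at hgb
    have := Γ.x_inj hk (by omega) (g.injective hgb)
    omega
  refine ⟨g, hg, k, a, b, hk, ?_, hb, hga, hgb, heq⟩
  by_contra hlt
  have h1 := (Γ.repr_smul_sub_pos_iff (by omega : b ≤ a) ha (Γ.lab b)).2 ⟨b, le_rfl, by omega, rfl⟩
  rw [← neg_sub, smul_neg, heq, map_neg, map_smul, Finsupp.neg_apply, Finsupp.smul_apply,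
    smul_eq_mul] at h1
  have := mul_nonneg hc.le (hβ.2 (Γ.lab b))
  linarith

/-- The half of sign `ε` moves the vertex in position `k` of a zigzag up, rather than down. -/
def Up (ε : Bool) (k : ℕ) : Prop := if k % 2 = 0 then ε = Γ.firstSide else ε ≠ Γ.firstSide

theorem up_succ (ε : Bool) (k : ℕ) : Γ.Up ε (k + 1) ↔ ¬ Γ.Up ε k := by
  unfold Up
  rcases Nat.mod_two_eq_zero_or_one k with h0 | h0
  · rw [if_neg (by omega), if_pos h0]
  · rw [if_pos (by omega), if_neg (by omega), not_not]

theorem up_iff {ε : Bool} {k : ℕ} (hk : k + 1 < h) : Γ.Up ε k ↔ S.side (Γ.lab k) = ε := by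
  rw [Γ.side_lab hk, Up]
  rcases Nat.mod_two_eq_zero_or_one k with h0 | h0
  · rw [if_pos h0, if_pos h0, eq_comm]
  · rw [if_neg (by omega), if_neg (by omega), ← Bool.eq_not, eq_comm]

theorem half_of_up {ε : Bool} {k : ℕ} (hk : k + 1 < h) (hu : Γ.Up ε k) :
    S.half ε (Γ.x k) = Γ.x (k + 1) := Γ.half_of_lab hk ((Γ.up_iff hk).1 hu)

theorem half_of_up_last {ε : Bool} {k : ℕ} (hk : k + 1 = h) (hu : Γ.Up ε k) :
    S.half ε (Γ.x k) = Γ.x k := by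
  refine Γ.half_last hk ?_
  unfold Up at hu
  split_ifs at hu ⊢
  exacts [hu, Bool.eq_not_of_ne hu]

theorem half_of_not_up {ε : Bool} {k : ℕ} (hk : k < h) (hu : ¬ Γ.Up ε k) :
    S.half ε (Γ.x k) = Γ.x (k - 1) := by
  rcases k with _ | k
  · have hε : ε = !Γ.firstSide := Bool.eq_not_of_ne (by simpa [Up] using hu)
    rw [hε]
    exact Γ.half_second_zero
  · rw [up_succ, not_not] at hu
    exact Γ.half_of_lab_back hk ((Γ.up_iff hk).1 hu)

end OrbitPath

namespace Labelling

variable {Γ : OrbitPath S o h} {E : Expansion S o} (L : Labelling Γ E)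

theorem reflection_of_up {ε : Bool} {k : ℕ} (hu : Γ.Up ε k) :
    (L.mirror ε).reflection (L.Y k) = L.Y (k + 1) := by
  rw [Y, mirror_reflection, Y, mirrorSum]
  unfold OrbitPath.Up at hu
  congr 1
  rcases Nat.mod_two_eq_zero_or_one k with h0 | h0
  · rw [if_pos h0] at hu
    rw [if_pos hu, zig_even h0, zig_odd (by omega)]
    omega
  · rw [if_neg (by omega)] at hu
    rw [if_neg hu, zig_odd h0, zig_even (by omega)]
    omega

/-- Continued by one step, the zigzag stays at the last vertex. -/
theorem Y_top : L.Y (h + 2) = L.Y (h + 1) := by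
  rw [Y, Y, Q_eq_iff]
  rcases Nat.mod_two_eq_zero_or_one h with h0 | h0
  · rw [zig_even (by omega), zig_odd (by omega)]
    exact ⟨1, by omega⟩
  · rw [zig_odd (by omega), zig_even (by omega)]
    exact ⟨-1, by omega⟩

theorem reflection_of_up_top {ε : Bool} (hu : Γ.Up ε (h + 1)) :
    (L.mirror ε).reflection (L.Y (h + 1)) = L.Y (h + 1) := by
  rw [L.reflection_of_up hu, Y_top]

theorem reflection_of_not_up {ε : Bool} {k : ℕ} (hu : ¬ Γ.Up ε k) :
    (L.mirror ε).reflection (L.Y k) = L.Y (k - 1) := by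
  rcases k with _ | k
  · rw [Y, mirror_reflection, mirrorSum, if_neg (by simpa [OrbitPath.Up] using hu)]
    simp [zig]
  · rw [OrbitPath.up_succ, not_not] at hu
    rw [← L.reflection_of_up hu, Submodule.reflection_reflection, Nat.add_sub_cancel]

/-! ### The diagram of a root -/

/-- The diagram of a root consists of the diagonals whose vector is a positive multiple of the
root. -/
def diagram (β : V) : Set (Sym2 V) :=
  {d | ∃ i j, DiagPair h i j ∧ d = s(L.Y i, L.Y j) ∧ ∃ t : ℝ, 0 < t ∧ Γ.vec i j = t • β}

theorem eq_neg_basis_of_vec {k : ℕ} (hk : k + 1 < h) {β : V} (hβ : β ∈ roots S.α) {t : ℝ}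
    (ht : 0 < t) (hvec : Γ.vec (k + 1) (k + 2) = t • β) : β = -S.α (Γ.lab k) := by
  rw [Γ.vec_snake hk, ← smul_neg] at hvec
  exact (S.eq_of_smul_eq_smul (neg_mem_roots (basis_mem_roots _ _)) hβ (Γ.coef_pos k hk) ht
    hvec).symm

theorem repr_nonneg_of_vec {i j : ℕ} (hij : i + 3 ≤ j) (hj : j ≤ h + 1) {β : V} {t : ℝ}
    (ht : 0 < t) (hvec : Γ.vec i j = t • β) (l : Fin n) : 0 ≤ S.α.repr β l := by
  have h1 := Γ.repr_smul_sub_nonneg (a := i) (b := j - 2) (by omega) (by omega) l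
  rw [← OrbitPath.vec, hvec, map_smul, Finsupp.smul_apply, smul_eq_mul] at h1
  exact nonneg_of_mul_nonneg_right h1 ht

theorem repr_pos_iff_of_vec {i j : ℕ} (hij : i + 3 ≤ j) (hj : j ≤ h + 1) {β : V} {t : ℝ}
    (ht : 0 < t) (hvec : Γ.vec i j = t • β) (l : Fin n) :
    0 < S.α.repr β l ↔ ∃ k, i ≤ k ∧ k + 3 ≤ j ∧ Γ.lab k = l := by
  have h1 := Γ.repr_smul_sub_pos_iff (a := i) (b := j - 2) (by omega) (by omega) l
  rw [← OrbitPath.vec, hvec, map_smul, Finsupp.smul_apply, smul_eq_mul, mul_pos_iff_of_pos_left ht]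
    at h1
  rw [h1]
  refine exists_congr fun k => and_congr_right fun _ => and_congr_left fun _ => ?_
  omega

/-- The reflection in the mirror of sign `ε` corresponds to the involution `τ` of sign `ε`: on the
zigzag it moves each vertex by at most one position, in the same direction as the half of the Coxeter
element on the path. -/
theorem reflection_mem_diagram (ε : Bool) {β : V} (hβ : β ∈ roots S.α) {d : Sym2 V}
    (hd : d ∈ L.diagram β) : Sym2.map (L.mirror ε).reflection d ∈ L.diagram (S.tau ε β) := by
  obtain ⟨i, j, hij, rfl, t, ht, hvec⟩ := hd
  rw [Sym2.map_mk]
  rcases hij with ⟨hij, hj⟩ | ⟨hi, rfl, hj⟩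
  · have hnn := repr_nonneg_of_vec hij hj ht hvec
    rw [S.tau_of_nonneg hnn]
    have hvec' : t • S.half ε β = Γ.κ • (S.half ε (Γ.x i) - S.half ε (Γ.x (j - 2))) := by
      rw [← map_smul, ← hvec, OrbitPath.vec, map_smul, map_sub]
    -- the position of the image of the first endpoint
    obtain ⟨i', hi1, hi2, hi3⟩ : ∃ i', (Γ.Up ε i ∧ i' = i + 1 ∨ ¬ Γ.Up ε i ∧ i' = i - 1) ∧
        (L.mirror ε).reflection (L.Y i) = L.Y i' ∧ S.half ε (Γ.x i) = Γ.x i' := by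
      by_cases hu : Γ.Up ε i
      · exact ⟨i + 1, Or.inl ⟨hu, rfl⟩, L.reflection_of_up hu, Γ.half_of_up (by omega) hu⟩
      · exact ⟨i - 1, Or.inr ⟨hu, rfl⟩, L.reflection_of_not_up hu,
          Γ.half_of_not_up (by omega) hu⟩
    have hj' : Γ.Up ε (j - 2) ↔ Γ.Up ε j := by
      have h2 : Γ.Up ε (j - 2 + 1 + 1) ↔ Γ.Up ε (j - 2) := by
        rw [Γ.up_succ, Γ.up_succ, not_not]
      rw [show j - 2 + 1 + 1 = j by omega] at h2
      exact h2.symm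
    -- the position of the image of the second endpoint
    obtain ⟨j', hj1, hj2, hj3⟩ : ∃ j', (Γ.Up ε j ∧ (j ≤ h ∧ j' = j + 1 ∨ j = h + 1 ∧ j' = j) ∨
        ¬ Γ.Up ε j ∧ j' = j - 1) ∧ (L.mirror ε).reflection (L.Y j) = L.Y j' ∧
        S.half ε (Γ.x (j - 2)) = Γ.x (j' - 2) := by
      by_cases hu : Γ.Up ε j
      · rcases (by omega : j ≤ h ∨ j = h + 1) with hjh | rfl
        · refine ⟨j + 1, Or.inl ⟨hu, Or.inl ⟨hjh, rfl⟩⟩, L.reflection_of_up hu, ?_⟩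
          rw [Γ.half_of_up (by omega) (hj'.2 hu)]
          congr 1
          omega
        · exact ⟨h + 1, Or.inl ⟨hu, Or.inr ⟨rfl, rfl⟩⟩, L.reflection_of_up_top hu,
            Γ.half_of_up_last (by omega) (hj'.2 hu)⟩
      · refine ⟨j - 1, Or.inr ⟨hu, rfl⟩, L.reflection_of_not_up hu, ?_⟩
        rw [Γ.half_of_not_up (by omega) (fun h0 => hu (hj'.1 h0))]
        congr 1
    refine ⟨i', j', ?_, by rw [hi2, hj2], t, ht, ?_⟩
    · -- the parities of `i` and `j` agree if and only if both endpoints move in the same direction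
      have hpar : (Γ.Up ε i ↔ Γ.Up ε j) ↔ i % 2 = j % 2 := by
        unfold OrbitPath.Up
        rcases Nat.mod_two_eq_zero_or_one i with h0 | h0 <;>
          rcases Nat.mod_two_eq_zero_or_one j with h1 | h1 <;> simp [h0, h1]
      unfold DiagPair
      rcases hi1 with ⟨hu, hi1⟩ | ⟨hu, hi1⟩ <;>
        rcases hj1 with ⟨hu', hj1⟩ | ⟨hu', hj1⟩ <;>
        simp only [hu, hu', iff_true, iff_false, true_iff, false_iff, not_true_eq_false] at hpar <;>
        omega
    · rw [hvec', hi3, hj3, OrbitPath.vec]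
  · obtain ⟨k, rfl⟩ : ∃ k, i = k + 1 := ⟨i - 1, by omega⟩
    have hk : k + 1 < h := by omega
    have hβ' := eq_neg_basis_of_vec hk hβ ht hvec
    by_cases hs : S.side (Γ.lab k) = ε
    · have hu := (Γ.up_iff hk).2 hs
      have hu1 : ¬ Γ.Up ε (k + 1) := by rwa [Γ.up_succ, not_not]
      rw [hβ', S.tau_neg_basis_of_eq hs, L.reflection_of_not_up hu1, L.reflection_of_up
        ((Γ.up_succ ε (k + 1)).2 hu1)]
      exact ⟨k, k + 3, Or.inl ⟨le_rfl, by omega⟩, rfl, Γ.coef k, Γ.coef_pos k hk, Γ.diff k hk⟩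
    · have hu1 : Γ.Up ε (k + 1) := by
        rw [Γ.up_succ, Γ.up_iff hk]
        exact hs
      have hu2 : ¬ Γ.Up ε (k + 1 + 1) := by rwa [Γ.up_succ, not_not]
      have htau : S.tau ε β = β := by
        rw [hβ', S.tau_neg_basis_of_ne (Bool.eq_not_of_ne hs)]
      rw [htau, L.reflection_of_up hu1, L.reflection_of_not_up hu2, Sym2.eq_swap]
      exact ⟨k + 1, k + 2, Or.inr ⟨by omega, rfl, by omega⟩, rfl, t, ht, hvec⟩

theorem diagram_neg (i : Fin n) : L.diagram (-S.α i) = E.negDiagram i := by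
  ext d
  rw [L.mem_negDiagram_iff]
  constructor
  · rintro ⟨a, b, hab, rfl, t, ht, hvec⟩
    rcases hab with ⟨hab, hb⟩ | ⟨ha, rfl, hb⟩
    · exact absurd rfl (S.ne_neg_basis (repr_nonneg_of_vec hab hb ht hvec) i)
    · obtain ⟨k, rfl⟩ : ∃ k, a = k + 1 := ⟨a - 1, by omega⟩
      have hk : k + 1 < h := by omega
      have := eq_neg_basis_of_vec hk (neg_mem_roots (basis_mem_roots _ _)) ht hvec
      rw [neg_inj] at this
      exact ⟨k, hk, (S.α.injective this).symm, rfl⟩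
  · rintro ⟨k, hk, rfl, rfl⟩
    refine ⟨k + 1, k + 2, Or.inr ⟨by omega, rfl, by omega⟩, rfl, Γ.coef k, Γ.coef_pos k hk, ?_⟩
    rw [Γ.vec_snake hk, smul_neg]

theorem diagram_nonempty {β : V} (hβ : β ∈ S.almostPositiveRoots) : (L.diagram β).Nonempty := by
  rcases hβ with hβ | ⟨i, rfl⟩
  · obtain ⟨g, hg, k, a, b, hk, hab, hb, -, -, heq⟩ := Γ.exists_of_mem_positiveRoots hβ
    exact ⟨_, a, b + 2, Or.inl ⟨by omega, by omega⟩, rfl, Γ.coef k, Γ.coef_pos k hk, heq⟩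
  · obtain ⟨k, hk, rfl⟩ := Γ.surj i
    simp only [diagram_neg]
    exact ⟨_, (L.mem_negDiagram_iff _ _).2 ⟨k, hk, rfl, rfl⟩⟩

/-- A root with a nonempty diagram is almost positive. -/
theorem mem_of_mem_diagram {β : V} (hβ : β ∈ roots S.α) {d : Sym2 V} (hd : d ∈ L.diagram β) :
    β ∈ S.almostPositiveRoots := by
  obtain ⟨a, b, hab, rfl, t, ht, hvec⟩ := hd
  rcases hab with ⟨hab, hb⟩ | ⟨ha, rfl, hb⟩
  · exact Or.inl ⟨hβ, repr_nonneg_of_vec hab hb ht hvec⟩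
  · obtain ⟨k, rfl⟩ : ∃ k, a = k + 1 := ⟨a - 1, by omega⟩
    exact Or.inr ⟨Γ.lab k, (eq_neg_basis_of_vec (by omega) hβ ht hvec).symm⟩

theorem tau_mem (L : Labelling Γ E) (ε : Bool) {β : V} (hβ : β ∈ S.almostPositiveRoots) :
    S.tau ε β ∈ S.almostPositiveRoots := by
  have hroot := S.roots_of_mem_almostPositiveRoots hβ
  obtain ⟨d, hd⟩ := L.diagram_nonempty hβ
  refine L.mem_of_mem_diagram ?_ (L.reflection_mem_diagram ε hroot hd)
  rw [SimpleSystem.tau]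
  split_ifs
  exacts [hroot, apply_mem_roots hroot (S.half_mem ε)]

theorem sym2_map_reflection (K : Submodule ℝ V) (d : Sym2 V) :
    Sym2.map K.reflection (Sym2.map K.reflection d) = d := by
  induction d with | _ a b
  simp

theorem diagram_tau (ε : Bool) {β : V} (hβ : β ∈ S.almostPositiveRoots) :
    L.diagram (S.tau ε β) = Sym2.map (L.mirror ε).reflection '' L.diagram β := by
  refine Set.Subset.antisymm (fun d hd => ?_) ?_
  · have h1 := L.reflection_mem_diagram ε
      (S.roots_of_mem_almostPositiveRoots (L.tau_mem ε hβ)) hd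
    rw [S.tau_tau ε hβ] at h1
    exact ⟨_, h1, sym2_map_reflection _ _⟩
  · rintro _ ⟨d, hd, rfl⟩
    exact L.reflection_mem_diagram ε (S.roots_of_mem_almostPositiveRoots hβ) hd

theorem isDiagramMap_diagram : E.IsDiagramMap L.diagram := by
  refine ⟨L.diagram_neg, fun ε ℓ hℓ β hβ => ?_⟩
  rw [(L.isMirror_iff ε ℓ).1 hℓ]
  exact L.diagram_tau ε hβ

/-- Two almost positive roots with a common diagonal are equal. -/
theorem eq_of_mem_diagram {β γ : V} (hβ : β ∈ S.almostPositiveRoots)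
    (hγ : γ ∈ S.almostPositiveRoots) {d : Sym2 V} (h1 : d ∈ L.diagram β) (h2 : d ∈ L.diagram γ) :
    β = γ := by
  obtain ⟨i, j, hij, rfl, s, hs, hvec⟩ := h1
  obtain ⟨i', j', hij', heq, t, ht, hvec'⟩ := h2
  have e : i < j ∧ j ≤ h + 1 ∧ i' < j' ∧ j' ≤ h + 1 := by
    unfold DiagPair at hij hij'
    omega
  obtain ⟨rfl, rfl⟩ := (L.mk_Y_eq_iff e.1 e.2.1 e.2.2.1 e.2.2.2).1 heq
  exact S.eq_of_smul_eq_smul (S.roots_of_mem_almostPositiveRoots hβ)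
    (S.roots_of_mem_almostPositiveRoots hγ) hs ht (hvec.symm.trans hvec')

theorem diagram_injOn : Set.InjOn L.diagram S.almostPositiveRoots := by
  intro β hβ γ hγ heq
  obtain ⟨d, hd⟩ := L.diagram_nonempty hβ
  exact L.eq_of_mem_diagram hβ hγ hd (heq ▸ hd)

end Labelling

/-! ### Reaching all almost positive roots from the negative simple roots -/

/-- The smallest set of vectors that contains the negative simple roots and is closed under the
involutions `τ`. -/
inductive Reachable (S : SimpleSystem M V) : V → Prop
  | neg (i : Fin n) : Reachable S (-S.α i)
  | tau (ε : Bool) {β : V} : Reachable S β → Reachable S (S.tau ε β)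

namespace Labelling

variable {Γ : OrbitPath S o h} {E : Expansion S o} (L : Labelling Γ E)

theorem mem_of_reachable (L : Labelling Γ E) {β : V} (hβ : Reachable S β) :
    β ∈ S.almostPositiveRoots := by
  induction hβ with
  | neg i => exact S.neg_basis_mem i
  | tau ε _ ih => exact L.tau_mem ε ih

/-- The diagonals whose endpoints have labels with sum `0` or `-1` are edges of the path. -/
theorem eq_snake_of_sum {i j : ℕ} (hij : DiagPair h i j) {s : ℤ} (hs : s = 0 ∨ s = -1)
    (hd : ((h + 2 : ℕ) : ℤ) ∣ zig i + zig j - s) : 1 ≤ i ∧ j = i + 1 ∧ j ≤ h := by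
  have e : i < j ∧ j ≤ h + 1 := by
    unfold DiagPair at hij
    omega
  have h1 : |zig i + zig j - s| < (h + 2 : ℕ) := by
    unfold zig
    split_ifs <;> rw [abs_lt] <;> omega
  have h2 := Int.eq_zero_of_abs_lt_dvd hd h1
  unfold DiagPair at hij
  unfold zig at h2
  split_ifs at h2 <;> omega

theorem reflection_mem_diagonals (ε : Bool) {d : Sym2 V} (hd : d ∈ E.diagonals) :
    Sym2.map (L.mirror ε).reflection d ∈ E.diagonals := by
  obtain ⟨i, j, h1, h2, h3, rfl⟩ := (L.mem_diagonals_iff_Q _).1 hd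
  rw [Sym2.map_mk, mirror_reflection, mirror_reflection]
  refine (L.mem_diagonals_iff_Q _).2 ⟨_, _, ?_, ?_, ?_, rfl⟩
  · rwa [← dvd_neg, show -(L.mirrorSum ε - j - (L.mirrorSum ε - i)) = j - i by ring]
  · rwa [← dvd_neg, show -(L.mirrorSum ε - j - (L.mirrorSum ε - i) - 1) = j - i + 1 by ring]
  · rwa [← dvd_neg, show -(L.mirrorSum ε - j - (L.mirrorSum ε - i) + 1) = j - i - 1 by ring]

/-- Every diagonal belongs to the diagram of a root that can be reached from a negative simple root:
successive reflections in the mirrors decrease the absolute value of the sum of the labels of its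
endpoints, until the diagonal becomes an edge of the path. -/
theorem exists_reachable {d : Sym2 V} (hd : d ∈ E.diagonals) :
    ∃ β, Reachable S β ∧ d ∈ L.diagram β := by
  have key : ∀ N : ℕ, ∀ i j : ℤ, s(L.Q i, L.Q j) ∈ E.diagonals → |2 * (i + j) + 1| ≤ 2 * N + 1 →
      ∃ β, Reachable S β ∧ s(L.Q i, L.Q j) ∈ L.diagram β := by
    intro N
    induction N with
    | zero =>
      intro i j hd hN
      obtain ⟨i', j', hij, heq⟩ := (L.mem_diagonals_iff _).1 hd
      have hsum : ((h + 2 : ℕ) : ℤ) ∣ zig i' + zig j' - (i + j) := by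
        rcases Sym2.eq_iff.1 heq with ⟨h1, h2⟩ | ⟨h1, h2⟩
        · have := dvd_add ((L.Q_eq_iff _ _).1 h1.symm) ((L.Q_eq_iff _ _).1 h2.symm)
          rwa [show zig i' - i + (zig j' - j) = zig i' + zig j' - (i + j) by ring] at this
        · have := dvd_add ((L.Q_eq_iff _ _).1 h1.symm) ((L.Q_eq_iff _ _).1 h2.symm)
          rwa [show zig j' - i + (zig i' - j) = zig i' + zig j' - (i + j) by ring] at this
      rw [abs_le] at hN
      obtain ⟨h1, rfl, h3⟩ := eq_snake_of_sum hij (by omega) hsum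
      obtain ⟨k, rfl⟩ : ∃ k, i' = k + 1 := ⟨i' - 1, by omega⟩
      refine ⟨-S.α (Γ.lab k), Reachable.neg _, ?_⟩
      rw [L.diagram_neg, L.mem_negDiagram_iff]
      exact ⟨k, by omega, rfl, heq⟩
    | succ N ih =>
      intro i j hd hN
      have hstep : ∀ ε, |2 * (L.mirrorSum ε - i + (L.mirrorSum ε - j)) + 1| ≤ 2 * (N : ℤ) + 1 →
          ∃ β, Reachable S β ∧ s(L.Q i, L.Q j) ∈ L.diagram β := by
        intro ε hε
        have hd' : s(L.Q (L.mirrorSum ε - i), L.Q (L.mirrorSum ε - j)) ∈ E.diagonals := by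
          have h1 := L.reflection_mem_diagonals ε hd
          rwa [Sym2.map_mk, mirror_reflection, mirror_reflection] at h1
        obtain ⟨β, hβ, hmem⟩ := ih _ _ hd' hε
        refine ⟨S.tau ε β, Reachable.tau ε hβ, ?_⟩
        have := L.reflection_mem_diagram ε
          (S.roots_of_mem_almostPositiveRoots (L.mem_of_reachable hβ)) hmem
        rwa [Sym2.map_mk, mirror_reflection, mirror_reflection, sub_sub_cancel, sub_sub_cancel]
          at this
      rw [abs_le] at hN
      push_cast at hN
      rcases (by omega : 1 ≤ i + j ∨ i + j ≤ -2 ∨ (i + j = 0 ∨ i + j = -1)) with h1 | h1 | h1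
      · refine hstep (!Γ.firstSide) ?_
        rw [mirrorSum, if_neg (by simp), abs_le]
        constructor <;> omega
      · refine hstep Γ.firstSide ?_
        rw [mirrorSum, if_pos rfl, abs_le]
        constructor <;> omega
      · exact ih i j hd (abs_le.2 ⟨by omega, by omega⟩)
  obtain ⟨i, j, -, -, -, rfl⟩ := (L.mem_diagonals_iff_Q d).1 hd
  exact key (2 * (i + j) + 1).natAbs i j hd (by
    rw [Int.abs_eq_natAbs]
    omega)

theorem mem_diagonals_of_mem_diagram {β : V} {d : Sym2 V} (hd : d ∈ L.diagram β) :
    d ∈ E.diagonals := by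
  obtain ⟨i, j, hij, rfl, -⟩ := hd
  exact (L.mem_diagonals_iff _).2 ⟨i, j, hij, rfl⟩

theorem reachable_of_mem (L : Labelling Γ E) {β : V} (hβ : β ∈ S.almostPositiveRoots) :
    Reachable S β := by
  obtain ⟨d, hd⟩ := L.diagram_nonempty hβ
  obtain ⟨γ, hγ, hd'⟩ := L.exists_reachable (L.mem_diagonals_of_mem_diagram hd)
  rwa [L.eq_of_mem_diagram hβ (L.mem_of_reachable hγ) hd hd']

/-- The requirements on a diagram map determine it on everything that the involutions `τ` reach. -/
theorem eqOn_diagram {Δ : V → Set (Sym2 V)} (hΔ : E.IsDiagramMap Δ) :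
    Set.EqOn Δ L.diagram S.almostPositiveRoots := by
  intro β hβ
  have hr := L.reachable_of_mem hβ
  clear hβ
  induction hr with
  | neg i => rw [hΔ.1, diagram_neg]
  | tau ε hr ih =>
    have hmem := L.mem_of_reachable hr
    rw [hΔ.2 ε _ (L.isMirror_mirror ε) _ hmem, ih, L.diagram_tau ε hmem]

/-! ### Compatibility -/

/-- A diagonal in the diagram of an almost positive root `β` crosses the diagram of `-αᵢ` if and
only if the coefficient of `αᵢ` in `β` is positive. -/
theorem exists_crosses_iff {β : V} (hβ : β ∈ S.almostPositiveRoots) {d : Sym2 V}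
    (hd : d ∈ L.diagram β) (l : Fin n) :
    (∃ e ∈ L.diagram (-S.α l), Crosses d e) ↔ 0 < S.α.repr β l := by
  obtain ⟨i, j, hij, rfl, t, ht, hvec⟩ := hd
  have e : i < j ∧ j ≤ h + 1 := by
    unfold DiagPair at hij
    omega
  have h1 : (∃ e ∈ L.diagram (-S.α l), Crosses s(L.Y i, L.Y j) e) ↔
      ∃ k, i ≤ k ∧ k + 3 ≤ j ∧ Γ.lab k = l := by
    constructor
    · rintro ⟨e', he, hc⟩
      rw [L.diagram_neg, L.mem_negDiagram_iff] at he
      obtain ⟨k, hk, hl, rfl⟩ := he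
      rw [L.crosses_snake_iff e.1 e.2 hk] at hc
      exact ⟨k, hc.1, hc.2, hl⟩
    · rintro ⟨k, h1, h2, hl⟩
      refine ⟨s(L.Y (k + 1), L.Y (k + 2)), ?_, (L.crosses_snake_iff e.1 e.2 (by omega)).2 ⟨h1, h2⟩⟩
      rw [L.diagram_neg, L.mem_negDiagram_iff]
      exact ⟨k, by omega, hl, rfl⟩
  rw [h1]
  rcases hij with ⟨hij, hj⟩ | ⟨hi, rfl, hj⟩
  · rw [repr_pos_iff_of_vec hij hj ht hvec]
  · obtain ⟨k, rfl⟩ : ∃ k, i = k + 1 := ⟨i - 1, by omega⟩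
    rw [eq_neg_basis_of_vec (by omega) (S.roots_of_mem_almostPositiveRoots hβ) ht hvec]
    constructor
    · rintro ⟨k, h2, h3, -⟩
      omega
    · intro h0
      simp only [map_neg, Finsupp.neg_apply, Module.Basis.repr_self, Finsupp.single_apply] at h0
      split_ifs at h0 <;> linarith

/-- The relation that the diagrams do not cross is the compatibility relation. -/
theorem isCompatibility : S.IsCompatibility fun β γ =>
    β ≠ γ ∧ ∀ d ∈ L.diagram β, ∀ e ∈ L.diagram γ, ¬ Crosses d e := by
  constructor
  · intro ε β hβ γ hγ
    simp only [L.diagram_tau ε hβ, L.diagram_tau ε hγ, Set.forall_mem_image, crosses_map_iff]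
    refine and_congr_left fun _ => not_congr ⟨fun heq => ?_, fun heq => by rw [heq]⟩
    rw [← S.tau_tau ε hβ, heq, S.tau_tau ε hγ]
  · intro i β hβ
    obtain ⟨d, hd⟩ := L.diagram_nonempty hβ
    constructor
    · rintro ⟨hne, hc⟩
      have h1 : ¬ 0 < S.α.repr β i := by
        rw [← L.exists_crosses_iff hβ hd]
        rintro ⟨e, he, hce⟩
        exact hc d hd e he hce
      refine le_antisymm (not_lt.1 h1) (not_lt.1 fun h2 => hne ?_)
      exact S.eq_neg_basis_of_repr_neg hβ h2
    · intro h0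
      refine ⟨?_, fun d hd e he hce => ?_⟩
      · rintro rfl
        simp at h0
      · have := (L.exists_crosses_iff hβ hd i).1 ⟨e, he, hce⟩
        rw [h0] at this
        exact lt_irrefl _ this

theorem compatibility_unique (L : Labelling Γ E) {R R' : V → V → Prop} (hR : S.IsCompatibility R)
    (hR' : S.IsCompatibility R') {β γ : V} (hβ : β ∈ S.almostPositiveRoots)
    (hγ : γ ∈ S.almostPositiveRoots) : R β γ ↔ R' β γ := by
  have hr := L.reachable_of_mem hγ
  clear hγ
  induction hr generalizing β with
  | neg i => rw [hR.2 i β hβ, hR'.2 i β hβ]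
  | tau ε hr ih =>
    have hmem := L.mem_of_reachable hr
    have hβ' := L.tau_mem ε hβ
    rw [← S.tau_tau ε hβ, hR.1 ε _ hβ' _ hmem, hR'.1 ε _ hβ' _ hmem]
    exact ih hβ'

end Labelling

/-- The assertions that hold uniformly for all orbits that form a path. -/
theorem OrbitPath.main (Γ : OrbitPath S o h) :
    S.coxeterNumber = h ∧ Module.finrank ℝ S.coxeterPlane = 2 ∧
    Nonempty (OrbitPolygon S o) ∧
    (∀ (G : OrbitPolygon S o) (θ : ℝ), G.index h = h + 2 ∧
      ∃ E : Expansion S o, E.polygon = G ∧ E.θ = θ) ∧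
    ∀ E : Expansion S o,
      Set.InjOn E.q o ∧ (∀ ε, ∃! ℓ, E.IsMirror ε ℓ) ∧
      (∃ Δ, E.IsDiagramMap Δ ∧
        ∀ Δ', E.IsDiagramMap Δ' → Set.EqOn Δ' Δ S.almostPositiveRoots) ∧
      (∃ R, S.IsCompatibility R) ∧
      ∀ Δ, E.IsDiagramMap Δ → ∀ R, S.IsCompatibility R →
        ∀ β ∈ S.almostPositiveRoots, ∀ γ ∈ S.almostPositiveRoots, β ≠ γ →
          (R β γ ↔ ∀ d ∈ Δ β, ∀ e ∈ Δ γ, ¬ Crosses d e) := by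
  refine ⟨Γ.coxeterNumber_eq, Γ.finrank_coxeterPlane, Γ.nonempty_orbitPolygon,
    fun G θ => ⟨?_, Γ.exists_expansion G θ⟩, fun E => ?_⟩
  · have := Γ.index_add_h G 0
    rwa [zero_add, OrbitPolygon.index, zero_add] at this
  · obtain ⟨L⟩ := Γ.nonempty_labelling E
    refine ⟨L.q_injOn, fun ε => ⟨L.mirror ε, L.isMirror_mirror ε, fun ℓ => (L.isMirror_iff ε ℓ).1⟩,
      ⟨L.diagram, L.isDiagramMap_diagram, fun Δ' => L.eqOn_diagram⟩, ⟨_, L.isCompatibility⟩,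
      fun Δ hΔ R hR β hβ γ hγ hne => ?_⟩
    rw [L.compatibility_unique hR L.isCompatibility hβ hγ, L.eqOn_diagram hΔ hβ,
      L.eqOn_diagram hΔ hγ, and_iff_right hne]

end Path

/-! ### Diagrams in type `A` -/

section Path

variable {n : ℕ} {M : CoxeterMatrix (Fin n)} {V : Type*} [NormedAddCommGroup V]
  [InnerProductSpace ℝ V] [FiniteDimensional ℝ V] {S : SimpleSystem M V} {o : Set V} {h : ℕ}

/-- The coefficients of a sum of consecutive simple roots. -/
theorem repr_sum_Icc (α : Module.Basis (Fin n) ℝ V) (i j l : Fin n) :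
    α.repr (∑ k ∈ Finset.Icc i j, α k) l = if i ≤ l ∧ l ≤ j then 1 else 0 := by
  rw [map_sum, Finset.sum_apply']
  simp [Finsupp.single_apply]

namespace SimpleSystem

variable (S)

theorem mem_positiveRoots_of_repr_pos {β : V} (hβ : β ∈ S.almostPositiveRoots) {l : Fin n}
    (hl : 0 < S.α.repr β l) : β ∈ S.positiveRoots := by
  rcases hβ with hβ | ⟨i, rfl⟩
  · exact hβ
  · simp only [map_neg, Finsupp.neg_apply, Module.Basis.repr_self, Finsupp.single_apply] at hl
    split_ifs at hl <;> linarith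

end SimpleSystem

/-- The path `x 0, …, x n` of type `A`, whose `k`-th edge carries the label `k`. -/
structure OrbitPath.IsTypeA (Γ : OrbitPath S o h) (c : ℝ) : Prop where
  h_eq : h = n + 1
  lab_eq : ∀ k, k + 1 < h → (Γ.lab k : ℕ) = k
  coef_eq : ∀ k, k + 1 < h → Γ.coef k = c

namespace Labelling

variable {Γ : OrbitPath S o h} {E : Expansion S o} (L : Labelling Γ E)

variable {c : ℝ}

theorem smul_sub_eq_smul_sum (hA : Γ.IsTypeA c) {i j : Fin n} (hij : i ≤ j) :
    Γ.κ • (Γ.x i - Γ.x (j + 1)) = c • ∑ k ∈ Finset.Icc i j, S.α k := by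
  have hh := hA.h_eq
  have hj : (j : ℕ) + 1 < h := by omega
  have hij' : (i : ℕ) ≤ j := hij
  apply S.α.repr.injective
  ext l
  rw [Γ.repr_smul_sub (by omega) hj, map_smul, Finsupp.smul_apply, repr_sum_Icc, smul_eq_mul]
  have h1 : ∀ k ∈ Finset.Ico (i : ℕ) (j + 1), (if Γ.lab k = l then Γ.coef k else 0) =
      if k = l then c else 0 := by
    intro k hk
    rw [Finset.mem_Ico] at hk
    have hiff : Γ.lab k = l ↔ k = l := by rw [Fin.ext_iff, hA.lab_eq k (by omega)]
    simp only [hA.coef_eq k (by omega), hiff]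
  rw [Finset.sum_congr rfl h1, Finset.sum_ite_eq']
  by_cases hl : i ≤ l ∧ l ≤ j
  · have hl' : (i : ℕ) ≤ l ∧ (l : ℕ) ≤ j := hl
    rw [if_pos hl, if_pos (Finset.mem_Ico.2 ⟨hl'.1, by omega⟩), mul_one]
  · have hl' : ¬ ((i : ℕ) ≤ l ∧ (l : ℕ) ≤ j) := hl
    rw [if_neg hl, if_neg (by rw [Finset.mem_Ico]; omega), mul_zero]

theorem exists_sum_of_mem_positiveRoots (hA : Γ.IsTypeA c) {β : V} (hβ : β ∈ S.positiveRoots) :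
    ∃ i j : Fin n, i ≤ j ∧ β = ∑ k ∈ Finset.Icc i j, S.α k := by
  have hh := hA.h_eq
  obtain ⟨g, hg, k, a, b, hk, hab, hb, -, -, heq⟩ := Γ.exists_of_mem_positiveRoots hβ
  obtain ⟨b, rfl⟩ : ∃ b', b = b' + 1 := ⟨b - 1, by omega⟩
  have hc : c ≠ 0 := by
    rw [← hA.coef_eq k hk]
    exact (Γ.coef_pos k hk).ne'
  have hab' : (⟨a, by omega⟩ : Fin n) ≤ ⟨b, by omega⟩ := Fin.mk_le_mk.2 (by omega)
  refine ⟨⟨a, by omega⟩, ⟨b, by omega⟩, hab', smul_right_injective V hc ?_⟩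
  simp only
  rw [← smul_sub_eq_smul_sum hA hab', heq, hA.coef_eq k hk]

/-- The chord from position `i` to position `j + 3` belongs to `αᵢ + ⋯ + αⱼ`. -/
theorem sum_mem_positiveRoots (hA : Γ.IsTypeA c) {i j : Fin n} (hij : i ≤ j) :
    (∑ k ∈ Finset.Icc i j, S.α k) ∈ S.positiveRoots ∧
      s(L.Y i, L.Y (j + 3)) ∈ L.diagram (∑ k ∈ Finset.Icc i j, S.α k) := by
  have hij' : (i : ℕ) ≤ j := hij
  have hh := hA.h_eq
  have hd : s(L.Y i, L.Y (j + 3)) ∈ E.diagonals :=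
    (L.mem_diagonals_iff _).2 ⟨i, j + 3, Or.inl ⟨by omega, by omega⟩, rfl⟩
  obtain ⟨β, hr, hdβ⟩ := L.exists_reachable hd
  have hβ := L.mem_of_reachable hr
  have hpos : 0 < S.α.repr β i := by
    rw [← L.exists_crosses_iff hβ hdβ, L.diagram_neg]
    exact ⟨_, (L.mem_negDiagram_iff _ _).2 ⟨i, by omega, Fin.ext (hA.lab_eq i (by omega)), rfl⟩,
      (L.crosses_snake_iff (by omega) (by omega) (by omega)).2 ⟨le_rfl, by omega⟩⟩
  have hβ' := S.mem_positiveRoots_of_repr_pos hβ hpos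
  obtain ⟨i', j', hij2, hsum⟩ := exists_sum_of_mem_positiveRoots hA hβ'
  have hval : S.α.repr β i = 1 := by
    rw [hsum, repr_sum_Icc] at hpos ⊢
    split_ifs at hpos ⊢
    · rfl
    · exact absurd hpos (lt_irrefl _)
  obtain ⟨a, b, hab, heq, t, ht, hvec⟩ := hdβ
  have e : a < b ∧ b ≤ h + 1 := by
    unfold DiagPair at hab
    omega
  obtain ⟨rfl, rfl⟩ := (L.mk_Y_eq_iff (by omega) (by omega) e.1 e.2).1 heq
  have hsum' := smul_sub_eq_smul_sum hA hij
  rw [OrbitPath.vec, show (j : ℕ) + 3 - 2 = j + 1 by omega, hsum'] at hvec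
  have hct : c = t := by
    have h1 := congrArg (fun v => S.α.repr v i) hvec
    simp only [map_smul, Finsupp.smul_apply, smul_eq_mul, hval] at h1
    rw [repr_sum_Icc, if_pos ⟨le_rfl, hij⟩] at h1
    linarith
  have hβeq : ∑ k ∈ Finset.Icc i j, S.α k = β := by
    rw [hct] at hvec
    exact smul_right_injective V ht.ne' hvec
  rw [hβeq]
  refine ⟨hβ', ⟨i, j + 3, hab, rfl, t, ht, ?_⟩⟩
  rw [OrbitPath.vec, show (j : ℕ) + 3 - 2 = j + 1 by omega, hsum', hβeq, hct]

theorem diagram_neg_of_typeA (hA : Γ.IsTypeA c) (i : Fin n) :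
    L.diagram (-S.α i) = {snake L.Q i} := by
  have hh := hA.h_eq
  rw [L.diagram_neg]
  ext d
  rw [L.mem_negDiagram_iff, Set.mem_singleton_iff, L.snake_eq]
  constructor
  · rintro ⟨k, hk, rfl, rfl⟩
    rw [hA.lab_eq k hk]
  · rintro rfl
    exact ⟨i, by omega, Fin.ext (hA.lab_eq i (by omega)), rfl⟩

/-- Every diagram is an image of an edge of the path under reflections. -/
theorem exists_diagram_eq_singleton (hA : Γ.IsTypeA c) {β : V} (hβ : Reachable S β) :
    ∃ d, L.diagram β = {d} := by
  induction hβ with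
  | neg i => exact ⟨_, L.diagram_neg_of_typeA hA i⟩
  | tau ε hr ih =>
    obtain ⟨d, hd⟩ := ih
    exact ⟨_, by rw [L.diagram_tau ε (L.mem_of_reachable hr), hd, Set.image_singleton]⟩

theorem diagram_eq_singleton (hA : Γ.IsTypeA c) {β : V} (hβ : β ∈ S.almostPositiveRoots)
    {d : Sym2 V} (hd : d ∈ L.diagram β) : L.diagram β = {d} := by
  obtain ⟨d', hd'⟩ := L.exists_diagram_eq_singleton hA (L.reachable_of_mem hβ)
  rw [hd', Set.mem_singleton_iff] at hd
  rw [hd', hd]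

/-- A diagonal is determined by the edges of the snake that it crosses: they give the support of the
root, and the root has only one diagonal. -/
theorem isSnakeModelA (L : Labelling Γ E) (hA : Γ.IsTypeA c) {Δ : V → Set (Sym2 V)}
    (hΔ : E.IsDiagramMap Δ) : E.IsSnakeModelA Δ := by
  have hh := hA.h_eq
  have hEq := L.eqOn_diagram hΔ
  have hneg : ∀ i, Δ (-S.α i) = L.diagram (-S.α i) := fun i => hEq (S.neg_basis_mem i)
  refine ⟨⟨L.a, L.σ, fun i => ?_⟩, fun β => ⟨?_, ?_⟩, fun i j hij => ?_, ?_⟩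
  · rw [hneg, L.diagram_neg_of_typeA hA]
    rfl
  · exact exists_sum_of_mem_positiveRoots hA
  · rintro ⟨i, j, hij, rfl⟩
    exact (L.sum_mem_positiveRoots hA hij).1
  · obtain ⟨hpos, hd⟩ := L.sum_mem_positiveRoots hA hij
    have hmem : (∑ k ∈ Finset.Icc i j, S.α k) ∈ S.almostPositiveRoots := Or.inl hpos
    refine ⟨_, L.mem_diagonals_of_mem_diagram hd, ?_, fun k => ?_, fun d' hd' hc => ?_⟩
    · rw [hEq hmem, L.diagram_eq_singleton hA hmem hd]
    · rw [hneg, L.exists_crosses_iff hmem hd, repr_sum_Icc]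
      split_ifs with h1 <;> simp [h1]
    · obtain ⟨β, hr, hdβ⟩ := L.exists_reachable hd'
      have hβ := L.mem_of_reachable hr
      have hc' : ∀ k, 0 < S.α.repr β k ↔ i ≤ k ∧ k ≤ j := fun k => by
        rw [← L.exists_crosses_iff hβ hdβ, ← hneg, hc]
      obtain ⟨i', j', hij', rfl⟩ := exists_sum_of_mem_positiveRoots hA
        (S.mem_positiveRoots_of_repr_pos hβ ((hc' i).2 ⟨le_rfl, hij⟩))
      have h2 : ∀ k, (i' ≤ k ∧ k ≤ j') ↔ i ≤ k ∧ k ≤ j := fun k => by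
        rw [← hc', repr_sum_Icc]
        split_ifs with h1 <;> simp [h1]
      have h3 := (h2 i).2 ⟨le_rfl, hij⟩
      have h4 := (h2 j).2 ⟨hij, le_rfl⟩
      have h5 := (h2 i').1 ⟨le_rfl, hij'⟩
      have h6 := (h2 j').1 ⟨hij', le_rfl⟩
      obtain rfl := le_antisymm h3.1 h5.1
      obtain rfl := le_antisymm h4.2 h6.2
      rw [L.diagram_eq_singleton hA hβ hd, Set.mem_singleton_iff] at hdβ
      exact hdβ
  · refine Set.BijOn.congr ⟨fun β hβ => ?_, L.diagram_injOn, ?_⟩ hEq.symm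
    · obtain ⟨d, hd⟩ := L.diagram_nonempty hβ
      exact ⟨d, L.mem_diagonals_of_mem_diagram hd, L.diagram_eq_singleton hA hβ hd⟩
    · rintro _ ⟨d, hd, rfl⟩
      obtain ⟨β, hr, hdβ⟩ := L.exists_reachable hd
      have hβ := L.mem_of_reachable hr
      exact ⟨β, hβ, L.diagram_eq_singleton hA hβ hdβ⟩

end Labelling

end Path

/-! ### Diagrams in type `I₂(m)` -/

section Path

variable {V : Type*} [NormedAddCommGroup V] [InnerProductSpace ℝ V] [FiniteDimensional ℝ V]

theorem dir_smul_iff {u w : V} (hu : ‖u‖ = 1) (hw : ‖w‖ = 1) (huw : inner ℝ u w = 0) (s t : ℝ) :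
    (∃ c : ℝ, dir u w s = c • dir u w t) ↔ ∃ k : ℤ, s - t = k * Real.pi := by
  constructor
  · rintro ⟨c, hc⟩
    have h1 := congrArg (fun v => inner ℝ v (dir u w (t + Real.pi / 2))) hc
    simp only [inner_smul_left, inner_dir_dir hu hw huw] at h1
    rw [show t - (t + Real.pi / 2) = -(Real.pi / 2) by ring, Real.cos_neg, Real.cos_pi_div_two,
      mul_zero, show s - (t + Real.pi / 2) = s - t - Real.pi / 2 by ring,
      Real.cos_sub_pi_div_two, Real.sin_eq_zero_iff] at h1
    obtain ⟨k, hk⟩ := h1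
    exact ⟨k, hk.symm⟩
  · rintro ⟨k, hk⟩
    refine ⟨(-1) ^ k, ?_⟩
    rw [show s = t + k * Real.pi by linarith, dir, dir, Real.cos_add_int_mul_pi,
      Real.sin_add_int_mul_pi, smul_add, smul_smul, smul_smul]

section General

variable {n : ℕ} {M : CoxeterMatrix (Fin n)} {S : SimpleSystem M V} {o : Set V} {h : ℕ}

namespace Labelling

variable {Γ : OrbitPath S o h} {E : Expansion S o} (L : Labelling Γ E)

/-- The diagonals whose endpoints have labels with sum `s` modulo the number of vertices. -/
def sumFamily (s : ℤ) : Set (Sym2 V) :=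
  {d ∈ E.diagonals | ∃ i j, d = s(L.Q i, L.Q j) ∧ ((h + 2 : ℕ) : ℤ) ∣ i + j - s}

theorem dvd_sum_sub_of_eq {i j i' j' : ℤ} (heq : s(L.Q i, L.Q j) = s(L.Q i', L.Q j')) :
    ((h + 2 : ℕ) : ℤ) ∣ i + j - (i' + j') := by
  rcases Sym2.eq_iff.1 heq with ⟨h1, h2⟩ | ⟨h1, h2⟩
  · have := dvd_add ((L.Q_eq_iff _ _).1 h1) ((L.Q_eq_iff _ _).1 h2)
    rwa [show i - i' + (j - j') = i + j - (i' + j') by ring] at this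
  · have := dvd_add ((L.Q_eq_iff _ _).1 h1) ((L.Q_eq_iff _ _).1 h2)
    rwa [show i - j' + (j - i') = i + j - (i' + j') by ring] at this

theorem mk_mem_sumFamily_iff {i j s : ℤ} : s(L.Q i, L.Q j) ∈ L.sumFamily s ↔
    s(L.Q i, L.Q j) ∈ E.diagonals ∧ ((h + 2 : ℕ) : ℤ) ∣ i + j - s := by
  constructor
  · rintro ⟨hd, i', j', heq, hdvd⟩
    refine ⟨hd, ?_⟩
    have := dvd_add (L.dvd_sum_sub_of_eq heq) hdvd
    rwa [show i + j - (i' + j') + (i' + j' - s) = i + j - s by ring] at this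
  · rintro ⟨hd, hdvd⟩
    exact ⟨hd, i, j, rfl, hdvd⟩

theorem reflection_mem_sumFamily (ε : Bool) {s : ℤ} {d : Sym2 V} (hd : d ∈ L.sumFamily s) :
    Sym2.map (L.mirror ε).reflection d ∈ L.sumFamily (2 * L.mirrorSum ε - s) := by
  obtain ⟨hd, i, j, rfl, hdvd⟩ := hd
  refine ⟨L.reflection_mem_diagonals ε hd, L.mirrorSum ε - i, L.mirrorSum ε - j, ?_, ?_⟩
  · rw [Sym2.map_mk, mirror_reflection, mirror_reflection]
  · rwa [← dvd_neg, show -(L.mirrorSum ε - i + (L.mirrorSum ε - j) - (2 * L.mirrorSum ε - s)) =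
      i + j - s by ring]

theorem image_sumFamily (ε : Bool) (s : ℤ) :
    Sym2.map (L.mirror ε).reflection '' L.sumFamily s = L.sumFamily (2 * L.mirrorSum ε - s) := by
  refine Set.Subset.antisymm ?_ fun d hd => ?_
  · rintro _ ⟨d, hd, rfl⟩
    exact L.reflection_mem_sumFamily ε hd
  · have h1 := L.reflection_mem_sumFamily ε hd
    rw [sub_sub_cancel] at h1
    exact ⟨_, h1, sym2_map_reflection _ _⟩

theorem Q_sub_ne_zero {i j : ℤ} (hij : ¬ ((h + 2 : ℕ) : ℤ) ∣ j - i) : L.Q j - L.Q i ≠ 0 := by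
  rwa [sub_ne_zero, Ne, L.Q_eq_iff]

/-- Two chords of a regular polygon are parallel if and only if the labels of their endpoints have
the same sum modulo the number of vertices. -/
theorem exists_smul_sub_iff {i j i' j' : ℤ} (hij : ¬ ((h + 2 : ℕ) : ℤ) ∣ j - i)
    (hij' : ¬ ((h + 2 : ℕ) : ℤ) ∣ j' - i') :
    (∃ t : ℝ, L.Q j' - L.Q i' = t • (L.Q j - L.Q i)) ↔
      ((h + 2 : ℕ) : ℤ) ∣ i' + j' - (i + j) := by
  have hne := L.Q_sub_ne_zero hij
  have hne' := L.Q_sub_ne_zero hij'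
  simp only [Q_eq, regVertex_sub] at hne hne' ⊢
  have h1 := left_ne_zero_of_smul hne
  have h2 := left_ne_zero_of_smul hne'
  set A := 2 * E.polygon.radius *
    (((L.σ : ℤ) : ℝ) * Real.sin (Real.pi * (j - i : ℤ) / (h + 2 : ℕ))) with hA
  set B := 2 * E.polygon.radius *
    (((L.σ : ℤ) : ℝ) * Real.sin (Real.pi * (j' - i' : ℤ) / (h + 2 : ℕ))) with hB
  have key : ∀ x y : V, (∃ t : ℝ, B • x = t • A • y) ↔ ∃ c : ℝ, x = c • y := by
    intro x y
    constructor
    · rintro ⟨t, ht⟩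
      refine ⟨B⁻¹ * (t * A), ?_⟩
      rw [mul_smul, mul_smul, ← ht, smul_smul, inv_mul_cancel₀ h2, one_smul]
    · rintro ⟨c, rfl⟩
      refine ⟨B * c / A, ?_⟩
      rw [smul_smul, smul_smul, div_mul_cancel₀ _ h1]
  rw [key, dir_smul_iff E.polygon.norm_u E.polygon.norm_w E.polygon.inner_u_w]
  have hN : ((h + 2 : ℕ) : ℝ) ≠ 0 := by positivity
  have hσ := units_cast_mul_self L.σ
  have hσσ : (L.σ : ℤ) * L.σ = 1 := by exact_mod_cast hσ
  have hpi := Real.pi_ne_zero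
  constructor
  · rintro ⟨k, hk⟩
    refine ⟨L.σ * k, ?_⟩
    have h3 : ((L.σ : ℤ) : ℝ) * (i' + j' - (i + j)) = k * (h + 2 : ℕ) := by
      refine mul_left_cancel₀ hpi ?_
      field_simp at hk
      linear_combination hk / 2
    have h4 : (L.σ : ℤ) * (i' + j' - (i + j)) = k * (h + 2 : ℕ) := by exact_mod_cast h3
    linear_combination L.σ * h4 - (i' + j' - (i + j)) * hσσ
  · rintro ⟨k, hk⟩
    refine ⟨L.σ * k, ?_⟩
    have h3 : (i' : ℝ) + j' - (i + j) = (h + 2 : ℕ) * k := by exact_mod_cast hk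
    push_cast at h3 ⊢
    push_cast at hN
    field_simp
    linear_combination 2 * Real.pi * ((L.σ : ℤ) : ℝ) * h3

theorem parallel_iff {i j i' j' : ℤ} (hij : ¬ ((h + 2 : ℕ) : ℤ) ∣ j - i)
    (hij' : ¬ ((h + 2 : ℕ) : ℤ) ∣ j' - i') :
    Parallel s(L.Q i, L.Q j) s(L.Q i', L.Q j') ↔ ((h + 2 : ℕ) : ℤ) ∣ i' + j' - (i + j) := by
  rw [← L.exists_smul_sub_iff hij hij']
  constructor
  · rintro ⟨a, b, a', b', hd, he, t, ht⟩
    rcases Sym2.eq_iff.1 hd with ⟨rfl, rfl⟩ | ⟨rfl, rfl⟩ <;>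
      rcases Sym2.eq_iff.1 he with ⟨rfl, rfl⟩ | ⟨rfl, rfl⟩
    · exact ⟨t, ht⟩
    · exact ⟨-t, by rw [neg_smul, ← ht, neg_sub]⟩
    · exact ⟨-t, by rw [neg_smul, ← smul_neg, neg_sub, ← ht]⟩
    · exact ⟨t, by rw [← neg_sub, ht, ← smul_neg, neg_sub]⟩
  · rintro ⟨t, ht⟩
    exact ⟨_, _, _, _, rfl, rfl, t, ht⟩

/-- A family of diagonals with constant sum is a maximal family of parallel diagonals. -/
theorem sumFamily_eq {s : ℤ} {d : Sym2 V} (hd : d ∈ L.sumFamily s) :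
    L.sumFamily s = {e ∈ E.diagonals | Parallel d e} := by
  obtain ⟨i, j, h1, -, -, rfl⟩ := (L.mem_diagonals_iff_Q _).1 hd.1
  have hs := (L.mk_mem_sumFamily_iff.1 hd).2
  ext e
  by_cases he : e ∈ E.diagonals
  · obtain ⟨i', j', h1', -, -, rfl⟩ := (L.mem_diagonals_iff_Q _).1 he
    rw [mk_mem_sumFamily_iff, Set.mem_sep_iff, L.parallel_iff h1 h1']
    refine and_congr_right fun _ => ?_
    rw [show i' + j' - s = i' + j' - (i + j) + (i + j - s) by ring, dvd_add_left hs]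
  · exact ⟨fun h0 => absurd h0.1 he, fun h0 => absurd h0.1 he⟩

theorem sumFamily_nonempty (s : ℤ) : (L.sumFamily s).Nonempty := by
  have h3 := Γ.three_le
  obtain ⟨r, e, he, hs⟩ : ∃ r e : ℤ, (e = 0 ∨ e = 1) ∧ s = 2 * r + e :=
    ⟨s / 2, s % 2, by omega, by omega⟩
  have key : ∀ m : ℤ, 0 < m → m < (h + 2 : ℕ) → ¬ ((h + 2 : ℕ) : ℤ) ∣ m := fun m h0 h1 hd =>
    absurd (Int.le_of_dvd h0 hd) (not_le.2 h1)
  refine ⟨s(L.Q (r - 1), L.Q (r + 1 + e)), ?_⟩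
  rw [mk_mem_sumFamily_iff, L.mem_diagonals_iff_Q]
  exact ⟨⟨_, _, key _ (by omega) (by omega), key _ (by omega) (by omega),
    key _ (by omega) (by omega), rfl⟩, ⟨0, by omega⟩⟩

theorem sumFamily_congr_iff {s s' : ℤ} :
    L.sumFamily s = L.sumFamily s' ↔ ((h + 2 : ℕ) : ℤ) ∣ s - s' := by
  constructor
  · intro heq
    obtain ⟨d, hd⟩ := L.sumFamily_nonempty s
    obtain ⟨i, j, -, -, -, rfl⟩ := (L.mem_diagonals_iff_Q _).1 hd.1
    have h1 := (L.mk_mem_sumFamily_iff.1 hd).2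
    rw [heq] at hd
    have h2 := (L.mk_mem_sumFamily_iff.1 hd).2
    have := dvd_sub h2 h1
    rwa [show i + j - s' - (i + j - s) = s - s' by ring] at this
  · intro hdvd
    ext d
    refine and_congr_right fun _ => exists_congr fun i => exists_congr fun j =>
      and_congr_right fun _ => ?_
    rw [show i + j - s' = i + j - s + (s - s') by ring, dvd_add_left hdvd]

end Labelling

end General

section Rank2

variable {M : CoxeterMatrix (Fin 2)} {S : SimpleSystem M V} {o : Set V} {h : ℕ}

/-- In rank two the two sides of the bipartition contain one simple reflection each. -/
theorem OrbitPath.side_injective (Γ : OrbitPath S o h) : Function.Injective S.side := by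
  have h3 := Γ.three_le
  have h1 := Γ.alt 0 (by omega)
  have hne : Γ.lab 1 ≠ Γ.lab 0 := by
    intro heq
    rw [zero_add, heq] at h1
    simp at h1
  intro i j hij
  have hi : i = Γ.lab 0 ∨ i = Γ.lab 1 := by omega
  have hj : j = Γ.lab 0 ∨ j = Γ.lab 1 := by omega
  rw [zero_add] at h1
  rcases hi with rfl | rfl <;> rcases hj with rfl | rfl
  · rfl
  · rw [h1] at hij
    simp at hij
  · rw [h1] at hij
    simp at hij
  · rfl

namespace Labelling

variable {Γ : OrbitPath S o h} {E : Expansion S o} (L : Labelling Γ E)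

theorem diagram_neg_eq_sumFamily (i : Fin 2) :
    L.diagram (-S.α i) = L.sumFamily (L.mirrorSum (!S.side i)) := by
  rw [L.diagram_neg]
  ext d
  rw [L.mem_negDiagram_iff]
  constructor
  · rintro ⟨k, hk, rfl, rfl⟩
    rw [Y, Y, mk_mem_sumFamily_iff]
    refine ⟨(L.mem_diagonals_iff _).2 ⟨k + 1, k + 2, Or.inr ⟨by omega, rfl, by omega⟩, rfl⟩, ?_⟩
    rw [L.zig_add_of_side (ε := !S.side (Γ.lab k)) hk (by simp), sub_self]
    exact dvd_zero _
  · intro hd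
    obtain ⟨a, b, hab, rfl⟩ := (L.mem_diagonals_iff _).1 hd.1
    have hdvd := (L.mk_mem_sumFamily_iff.1 hd).2
    have hs : L.mirrorSum (!S.side i) = 0 ∨ L.mirrorSum (!S.side i) = -1 := by
      rw [mirrorSum]
      split_ifs <;> simp
    obtain ⟨h1, rfl, h3⟩ := eq_snake_of_sum hab hs hdvd
    obtain ⟨k, rfl⟩ : ∃ k, a = k + 1 := ⟨a - 1, by omega⟩
    have hk : k + 1 < h := by omega
    refine ⟨k, hk, Γ.side_injective ?_, rfl⟩
    have h4 := L.zig_add_of_side (ε := !S.side (Γ.lab k)) hk (by simp)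
    rw [h4] at hdvd
    have h5 := Γ.three_le
    have h6 : L.mirrorSum (!S.side (Γ.lab k)) = L.mirrorSum (!S.side i) := by
      by_contra hne
      have h7 := Int.eq_zero_of_abs_lt_dvd hdvd (by
        rw [abs_lt]
        unfold mirrorSum
        split_ifs <;> omega)
      exact hne (by omega)
    unfold mirrorSum at h6
    by_cases e1 : S.side (Γ.lab k) = Γ.firstSide <;> by_cases e2 : S.side i = Γ.firstSide
    · rw [e1, e2]
    · rw [e1, Bool.eq_not_of_ne e2] at h6
      simp at h6
    · rw [e2, Bool.eq_not_of_ne e1] at h6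
      simp at h6
    · rw [Bool.eq_not_of_ne e1, Bool.eq_not_of_ne e2]

/-- Every diagram is a family with constant sum, as the reflections permute these families. -/
theorem exists_diagram_eq_sumFamily {β : V} (hβ : Reachable S β) :
    ∃ s, L.diagram β = L.sumFamily s := by
  induction hβ with
  | neg i => exact ⟨_, L.diagram_neg_eq_sumFamily i⟩
  | tau ε hr ih =>
    obtain ⟨s, hs⟩ := ih
    exact ⟨_, by rw [L.diagram_tau ε (L.mem_of_reachable hr), hs, L.image_sumFamily]⟩

theorem bijOn_maximalParallelFamilies (L : Labelling Γ E) {Δ : V → Set (Sym2 V)}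
    (hΔ : E.IsDiagramMap Δ) :
    Set.BijOn Δ S.almostPositiveRoots E.maximalParallelFamilies := by
  refine Set.BijOn.congr ⟨fun β hβ => ?_, L.diagram_injOn, ?_⟩ (L.eqOn_diagram hΔ).symm
  · obtain ⟨d, hd⟩ := L.diagram_nonempty hβ
    obtain ⟨s, hs⟩ := L.exists_diagram_eq_sumFamily (L.reachable_of_mem hβ)
    refine ⟨d, L.mem_diagonals_of_mem_diagram hd, ?_⟩
    rw [hs] at hd ⊢
    exact L.sumFamily_eq hd
  · rintro _ ⟨d, hd, rfl⟩
    obtain ⟨β, hr, hdβ⟩ := L.exists_reachable hd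
    obtain ⟨s, hs⟩ := L.exists_diagram_eq_sumFamily hr
    refine ⟨β, L.mem_of_reachable hr, ?_⟩
    rw [hs] at hdβ ⊢
    exact L.sumFamily_eq hdβ

/-- The almost positive roots correspond to the residues of sums of labels. -/
theorem ncard_almostPositiveRoots (L : Labelling Γ E) : S.almostPositiveRoots.ncard = h + 2 := by
  have hex : ∀ s : ℤ, ∃ β ∈ S.almostPositiveRoots, L.diagram β = L.sumFamily s := by
    intro s
    obtain ⟨d, hd⟩ := L.sumFamily_nonempty s
    obtain ⟨β, hr, hdβ⟩ := L.exists_reachable hd.1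
    obtain ⟨s', hs'⟩ := L.exists_diagram_eq_sumFamily hr
    refine ⟨β, L.mem_of_reachable hr, ?_⟩
    rw [hs'] at hdβ ⊢
    rw [L.sumFamily_eq hd, L.sumFamily_eq hdβ]
  choose f hf hf' using hex
  refine Set.ncard_eq_of_bijective (fun i _ => f i) (fun β hβ => ?_) (fun i _ => hf i)
    fun i j hi hj hij => ?_
  · obtain ⟨s, hs⟩ := L.exists_diagram_eq_sumFamily (L.reachable_of_mem hβ)
    have hN : (0 : ℤ) < (h + 2 : ℕ) := by omega
    have h1 := Int.emod_nonneg s hN.ne'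
    have h2 := Int.emod_lt_of_pos s hN
    refine ⟨(s % (h + 2 : ℕ)).toNat, by omega, L.diagram_injOn (hf _) hβ ?_⟩
    rw [hf', hs, sumFamily_congr_iff, Int.toNat_of_nonneg h1]
    exact ((Int.mod_modEq s _).symm).dvd
  · have h1 := hf' i
    rw [hij, hf' j, sumFamily_congr_iff] at h1
    have h2 := Int.eq_zero_of_abs_lt_dvd h1 (by rw [abs_lt]; omega)
    omega

end Labelling

end Rank2

end Path

/-! ### Diagrams in type `B` -/

theorem ncard_sep_pair {α : Type*} (a b : α) (P : α → Prop) [Decidable (P a)] [Decidable (P b)]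
    [Decidable (a = b)] : {x ∈ ({a, b} : Set α) | P x}.ncard =
      if a = b then (if P a then 1 else 0) else (if P a then 1 else 0) + if P b then 1 else 0 := by
  have e : {x ∈ ({a, b} : Set α) | P x} = {x | (x = a ∧ P a) ∨ (x = b ∧ P b)} := by
    ext x
    simp only [Set.mem_insert_iff, Set.mem_singleton_iff, Set.mem_ofPred_eq]
    constructor
    · rintro ⟨rfl | rfl, hx⟩
      exacts [Or.inl ⟨rfl, hx⟩, Or.inr ⟨rfl, hx⟩]
    · rintro (⟨rfl, hx⟩ | ⟨rfl, hx⟩)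
      exacts [⟨Or.inl rfl, hx⟩, ⟨Or.inr rfl, hx⟩]
  rw [e]
  by_cases hab : a = b
  · subst hab
    by_cases ha : P a
    · simp [ha]
    · simp [ha]
  · by_cases ha : P a <;> by_cases hb : P b
    · have h2 : {x | (x = a ∧ P a) ∨ (x = b ∧ P b)} = {a, b} := by
        ext x
        simp [ha, hb]
      rw [h2, Set.ncard_pair hab]
      simp [hab, ha, hb]
    · simp [hab, ha, hb]
    · simp [hab, ha, hb]
    · simp [hab, ha, hb]

section Path

variable {n : ℕ} {M : CoxeterMatrix (Fin n)} {V : Type*} [NormedAddCommGroup V]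
  [InnerProductSpace ℝ V] [FiniteDimensional ℝ V] {S : SimpleSystem M V} {o : Set V} {h : ℕ}

namespace OrbitPath

/-- The path of type `B`: its first half runs through multiples of the vectors `e₁, …, eₙ` of the
standard realization, its second half through their negatives in the opposite order. -/
structure IsTypeB (Γ : OrbitPath S o h) (c : ℝ) : Prop where
  h_eq : h = 2 * n
  lab_eq : ∀ k, k + 1 < h → (Γ.lab k : ℕ) = if k < n then k else 2 * n - 2 - k
  neg_x : ∀ k < h, Γ.x (2 * n - 1 - k) = -Γ.x k
  coef_eq : ∀ k, k + 1 < n → Γ.coef k = c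
  norm_eq : ∀ i j : Fin n, (i : ℕ) + 1 < n → (j : ℕ) + 1 = n →
    (Γ.coef j * ‖S.α j‖) ^ 2 = 2 * (c * ‖S.α i‖) ^ 2

variable {Γ : OrbitPath S o h} {c : ℝ}

theorem IsTypeB.two_le (hB : Γ.IsTypeB c) : 2 ≤ n := by
  have := hB.h_eq
  have := Γ.three_le
  omega

theorem IsTypeB.coef_pos (hB : Γ.IsTypeB c) : 0 < c := by
  have := hB.h_eq
  have := hB.two_le
  rw [← hB.coef_eq 0 (by omega)]
  exact Γ.coef_pos 0 (by omega)

theorem IsTypeB.coef_of_ne (hB : Γ.IsTypeB c) {k : ℕ} (hk : k + 1 < h) (hkn : k + 1 ≠ n) :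
    Γ.coef k = c := by
  have hh := hB.h_eq
  rcases (by omega : k + 1 < n ∨ n ≤ k) with h1 | h1
  · exact hB.coef_eq k h1
  · have h2 := Γ.diff k hk
    have h3 := Γ.diff (2 * n - 2 - k) (by omega)
    have e1 : Γ.x k = -Γ.x (2 * n - 2 - k + 1) := by
      rw [← hB.neg_x _ (by omega)]
      congr 1
      omega
    have e2 : Γ.x (k + 1) = -Γ.x (2 * n - 2 - k) := by
      rw [← hB.neg_x _ (by omega)]
      congr 1
      omega
    have e3 : Γ.lab (2 * n - 2 - k) = Γ.lab k := by
      rw [Fin.ext_iff, hB.lab_eq k hk, hB.lab_eq _ (by omega), if_pos (by omega),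
        if_neg (by omega)]
    rw [e1, e2, neg_sub_neg, h3, e3, hB.coef_eq _ (by omega)] at h2
    exact (smul_left_injective ℝ (S.α.ne_zero _) h2).symm

theorem IsTypeB.lab_eq_iff (hB : Γ.IsTypeB c) {k : ℕ} (hk : k + 1 < h) (l : Fin n) :
    Γ.lab k = l ↔ k = l ∨ k = 2 * n - 2 - l := by
  have hh := hB.h_eq
  rw [Fin.ext_iff, hB.lab_eq k hk]
  split_ifs <;> omega

/-- The coefficients of the difference of two vertices of the path. -/
theorem IsTypeB.repr_smul_sub (hB : Γ.IsTypeB c) {a b : ℕ} (hab : a ≤ b) (hb : b < h)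
    (l : Fin n) : S.α.repr (Γ.κ • (Γ.x a - Γ.x b)) l =
      if (l : ℕ) + 1 = n then Γ.coef l * (if a ≤ l ∧ (l : ℕ) < b then 1 else 0) else
        c * ((if a ≤ l ∧ (l : ℕ) < b then 1 else 0) +
          if a ≤ 2 * n - 2 - l ∧ 2 * n - 2 - l < b then 1 else 0) := by
  have hh := hB.h_eq
  rw [Γ.repr_smul_sub hab hb]
  by_cases hl : (l : ℕ) + 1 = n
  · have h1 : ∀ k ∈ Finset.Ico a b, (if Γ.lab k = l then Γ.coef k else 0) =
        if k = l then Γ.coef l else 0 := by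
      intro k hk
      rw [Finset.mem_Ico] at hk
      simp only [hB.lab_eq_iff (by omega : k + 1 < h)]
      by_cases hkl : k = l
      · rw [if_pos (Or.inl hkl), if_pos hkl, hkl]
      · rw [if_neg (by omega), if_neg hkl]
    rw [Finset.sum_congr rfl h1, Finset.sum_ite_eq', if_pos hl]
    simp only [Finset.mem_Ico, mul_ite, mul_one, mul_zero]
  · have h1 : ∀ k ∈ Finset.Ico a b, (if Γ.lab k = l then Γ.coef k else 0) =
        (if k = l then c else 0) + if k = 2 * n - 2 - l then c else 0 := by
      intro k hk
      rw [Finset.mem_Ico] at hk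
      simp only [hB.lab_eq_iff (by omega : k + 1 < h)]
      by_cases hkl : k = l
      · rw [if_pos (Or.inl hkl), if_pos hkl, if_neg (by omega),
          hB.coef_of_ne (by omega) (by omega), add_zero]
      · by_cases hkl' : k = 2 * n - 2 - l
        · rw [if_pos (Or.inr hkl'), if_neg hkl, if_pos hkl',
            hB.coef_of_ne (by omega) (by omega), zero_add]
        · rw [if_neg (by omega), if_neg hkl, if_neg hkl', add_zero]
    rw [Finset.sum_congr rfl h1, Finset.sum_add_distrib, Finset.sum_ite_eq', Finset.sum_ite_eq',
      if_neg hl]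
    simp only [Finset.mem_Ico, mul_add, mul_ite, mul_one, mul_zero]

end OrbitPath

namespace Labelling

variable {Γ : OrbitPath S o h} {E : Expansion S o} (L : Labelling Γ E) {c : ℝ}

theorem neg_Q (hh : h = 2 * n) (k : ℤ) : -L.Q k = L.Q (k + (n + 1)) := by
  have hN : ((h + 2 : ℕ) : ℝ) = 2 * (n + 1) := by
    rw [hh]
    push_cast
    ring
  have hn : (n : ℝ) + 1 ≠ 0 := by positivity
  rw [Q_eq, Q_eq, regVertex, regVertex, ← smul_neg, hN]
  congr 1
  rcases Int.units_eq_one_or L.σ with hσ | hσ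
  · rw [hσ, ← dir_add_pi]
    congr 1
    push_cast
    field_simp
    ring
  · rw [hσ, neg_eq_iff_eq_neg, ← dir_add_pi]
    congr 1
    push_cast
    field_simp
    ring

theorem neg_Y (hh : h = 2 * n) {k : ℕ} (hk : k ≤ h + 1) : -L.Y k = L.Y (2 * n + 1 - k) := by
  rw [Y, L.neg_Q hh, Y, Q_eq_iff]
  rcases Nat.mod_two_eq_zero_or_one k with h0 | h0
  · rw [zig_even h0, zig_odd (by omega)]
    exact ⟨1, by omega⟩
  · rw [zig_odd h0, zig_even (by omega)]
    exact ⟨0, by omega⟩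

theorem map_neg_mk (hh : h = 2 * n) {a b : ℕ} (ha : a ≤ h + 1) (hb : b ≤ h + 1) :
    Sym2.map (fun x => -x) s(L.Y a, L.Y b) = s(L.Y (2 * n + 1 - b), L.Y (2 * n + 1 - a)) := by
  rw [Sym2.map_mk, L.neg_Y hh ha, L.neg_Y hh hb, Sym2.eq_swap]

theorem map_neg_map_neg (d : Sym2 V) :
    Sym2.map (fun x => -x) (Sym2.map (fun x => -x) d) = d := by
  induction d with | _ a b
  simp

theorem diagram_neg_of_typeB (hB : Γ.IsTypeB c) (i : Fin n) :
    L.diagram (-S.α i) = {snake L.Q i, snake L.Q (2 * n - 2 - i)} := by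
  have hh := hB.h_eq
  rw [L.diagram_neg]
  ext d
  rw [L.mem_negDiagram_iff, Set.mem_insert_iff, Set.mem_singleton_iff, L.snake_eq, L.snake_eq]
  constructor
  · rintro ⟨k, hk, hl, rfl⟩
    rcases (hB.lab_eq_iff hk i).1 hl with rfl | rfl
    exacts [Or.inl rfl, Or.inr rfl]
  · rintro (rfl | rfl)
    · exact ⟨i, by omega, (hB.lab_eq_iff (by omega) i).2 (Or.inl rfl), rfl⟩
    · exact ⟨2 * n - 2 - i, by omega, (hB.lab_eq_iff (by omega) i).2 (Or.inr rfl), rfl⟩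

/-- Every diagram is an image, under reflections in lines through the centre, of the diagram of a
negative simple root, hence centrally symmetric. -/
theorem exists_diagram_eq_pair (hB : Γ.IsTypeB c) {β : V} (hβ : Reachable S β) :
    ∃ d, L.diagram β = {d, Sym2.map (fun x => -x) d} := by
  have hh := hB.h_eq
  induction hβ with
  | neg i =>
    refine ⟨snake L.Q i, ?_⟩
    rw [L.diagram_neg_of_typeB hB i, L.snake_eq, L.snake_eq, L.map_neg_mk hh (by omega) (by omega),
      show 2 * n + 1 - (i + 2) = 2 * n - 2 - i + 1 by omega,
      show 2 * n + 1 - (i + 1) = 2 * n - 2 - i + 2 by omega]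
  | tau ε hr ih =>
    obtain ⟨d, hd⟩ := ih
    refine ⟨Sym2.map (L.mirror ε).reflection d, ?_⟩
    rw [L.diagram_tau ε (L.mem_of_reachable hr), hd, Set.image_pair, Sym2.map_map, Sym2.map_map]
    congr 3
    funext x
    simp

/-- The diagram of an almost positive root consists of a diagonal and its image under the central
symmetry. -/
theorem diagram_eq_pair (hB : Γ.IsTypeB c) {β : V} (hβ : β ∈ S.almostPositiveRoots) {d : Sym2 V}
    (hd : d ∈ L.diagram β) : L.diagram β = {d, Sym2.map (fun x => -x) d} := by
  obtain ⟨d', hd'⟩ := L.exists_diagram_eq_pair hB (L.reachable_of_mem hβ)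
  rw [hd'] at hd ⊢
  rcases hd with rfl | hd
  · rfl
  · rw [Set.mem_singleton_iff] at hd
    rw [hd, map_neg_map_neg, Set.pair_comm]

theorem diagram_mem_centralFamilies (hB : Γ.IsTypeB c) {β : V}
    (hβ : β ∈ S.almostPositiveRoots) : L.diagram β ∈ E.centralFamilies := by
  obtain ⟨d, hd⟩ := L.diagram_nonempty hβ
  exact ⟨d, L.mem_diagonals_of_mem_diagram hd, L.diagram_eq_pair hB hβ hd⟩

theorem exists_diagram_eq_of_mem_centralFamilies (hB : Γ.IsTypeB c) {F : Set (Sym2 V)}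
    (hF : F ∈ E.centralFamilies) : ∃ β ∈ S.almostPositiveRoots, L.diagram β = F := by
  obtain ⟨d, hd, rfl⟩ := hF
  obtain ⟨β, hr, hdβ⟩ := L.exists_reachable hd
  exact ⟨β, L.mem_of_reachable hr, L.diagram_eq_pair hB (L.mem_of_reachable hr) hdβ⟩

/-- The number of diagonals of the centrally symmetric family with the chord from position `a` to
position `b + 2` that cross an edge of the zigzag. -/
theorem crossCount_eq (hB : Γ.IsTypeB c) {a b : ℕ} (hab : a < b) (hb : b < h) {l : Fin n}
    {e : Sym2 V} (he : e ∈ L.diagram (-S.α l)) :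
    crossCount {s(L.Y a, L.Y (b + 2)), Sym2.map (fun x => -x) s(L.Y a, L.Y (b + 2))} e =
      if a + b + 1 = 2 * n then (if a ≤ l ∧ (l : ℕ) < b then 1 else 0) else
        (if a ≤ l ∧ (l : ℕ) < b then 1 else 0) +
          if a ≤ 2 * n - 2 - l ∧ 2 * n - 2 - l < b then 1 else 0 := by
  classical
  have hh := hB.h_eq
  have hiff : s(L.Y a, L.Y (b + 2)) = s(L.Y (2 * n + 1 - (b + 2)), L.Y (2 * n + 1 - a)) ↔
      a + b + 1 = 2 * n := by
    rw [L.mk_Y_eq_iff (by omega) (by omega) (by omega) (by omega)]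
    omega
  have key : ∀ p, p + 1 < h → (Crosses s(L.Y a, L.Y (b + 2)) s(L.Y (p + 1), L.Y (p + 2)) ↔
      a ≤ p ∧ p < b) ∧ (Crosses s(L.Y (2 * n + 1 - (b + 2)), L.Y (2 * n + 1 - a))
      s(L.Y (p + 1), L.Y (p + 2)) ↔ a ≤ 2 * n - 2 - p ∧ 2 * n - 2 - p < b) := by
    intro p hp
    rw [L.crosses_snake_iff (by omega) (by omega) hp, L.crosses_snake_iff (by omega) (by omega) hp]
    constructor <;> omega
  rw [L.map_neg_mk hh (by omega) (by omega), crossCount, ncard_sep_pair]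
  rw [L.diagram_neg_of_typeB hB, L.snake_eq, L.snake_eq] at he
  simp only [hiff]
  rcases he with rfl | he
  · simp only [key l (by omega)]
  · rw [Set.mem_singleton_iff] at he
    rw [he]
    simp only [key (2 * n - 2 - l) (by omega)]
    rw [show 2 * n - 2 - (2 * n - 2 - (l : ℕ)) = l by omega]
    split_ifs <;> omega

/-- The number of crossings and the coefficient of a positive root in terms of two numbers `p`, `q`.
The first case is that of a diameter. -/
theorem crossCount_cases (hB : Γ.IsTypeB c) {β : V} (hβ : β ∈ S.positiveRoots) {l : Fin n}
    {e : Sym2 V} (he : e ∈ L.diagram (-S.α l)) : ∃ (j : Fin n) (p q : ℝ),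
      ‖β‖ = ‖S.α j‖ ∧ ((l : ℕ) + 1 = n → p = q) ∧
      Γ.coef j * S.α.repr β l = (if (l : ℕ) + 1 = n then Γ.coef l * p else c * (p + q)) ∧
      ((j : ℕ) + 1 = n ∧ p = q ∧ (crossCount (L.diagram β) e : ℝ) = p ∨
        (j : ℕ) + 1 ≠ n ∧ (crossCount (L.diagram β) e : ℝ) = p + q) := by
  have hh := hB.h_eq
  obtain ⟨g, hg, k, a, b, hk, hab, hb, hga, hgb, heq⟩ := Γ.exists_of_mem_positiveRoots hβ
  have hc := Γ.coef_pos k hk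
  have hd : s(L.Y a, L.Y (b + 2)) ∈ L.diagram β :=
    ⟨a, b + 2, Or.inl ⟨by omega, by omega⟩, rfl, Γ.coef k, hc, heq⟩
  have hanti : a + b + 1 = 2 * n ↔ k + 1 = n := by
    constructor
    · intro h1
      have h2 : Γ.x b = -Γ.x a := by
        rw [← hB.neg_x a (by omega)]
        congr 1
        omega
      rw [← hga, ← hgb, ← map_neg, g.injective.eq_iff, ← hB.neg_x k (by omega)] at h2
      have := Γ.x_inj (by omega) (by omega) h2
      omega
    · intro h1
      have h2 : Γ.x (k + 1) = -Γ.x k := by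
        rw [← hB.neg_x k (by omega)]
        congr 1
        omega
      have h3 : Γ.x b = Γ.x (2 * n - 1 - a) := by
        rw [hB.neg_x a (by omega), ← hga, ← hgb, h2, map_neg]
      have := Γ.x_inj (by omega) (by omega) h3
      omega
  have hnorm : ‖β‖ = ‖S.α (Γ.lab k)‖ := by
    have h1 : ‖Γ.coef k • β‖ = ‖Γ.coef k • S.α (Γ.lab k)‖ := by
      rw [← heq, ← hga, ← hgb, ← map_sub, ← map_smul, LinearIsometryEquiv.norm_map, Γ.diff k hk]
    rw [norm_smul, norm_smul] at h1
    exact mul_left_cancel₀ (norm_ne_zero_iff.2 hc.ne') h1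
  have hlab : ((Γ.lab k : ℕ) + 1 = n ↔ k + 1 = n) ∧ Γ.coef (Γ.lab k) = Γ.coef k := by
    have h1 := hB.lab_eq k hk
    split_ifs at h1 with h2
    · rw [h1]
      exact ⟨Iff.rfl, rfl⟩
    · refine ⟨by omega, ?_⟩
      rw [hB.coef_of_ne hk (by omega), hB.coef_of_ne (by omega) (by omega)]
  refine ⟨Γ.lab k, if a ≤ l ∧ (l : ℕ) < b then 1 else 0,
    if a ≤ 2 * n - 2 - l ∧ 2 * n - 2 - l < b then 1 else 0, hnorm, fun hl => ?_, ?_, ?_⟩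
  · rw [show 2 * n - 2 - (l : ℕ) = l by omega]
  · rw [hlab.2, ← hB.repr_smul_sub hab.le hb, heq, map_smul, Finsupp.smul_apply, smul_eq_mul]
  · rw [L.diagram_eq_pair hB (Or.inl hβ) hd, L.crossCount_eq hB hab hb he, Ne, hlab.1, ← hanti]
    by_cases h1 : a + b + 1 = 2 * n
    · left
      rw [if_pos h1]
      refine ⟨h1, ?_, ?_⟩
      · split_ifs <;> first | rfl | omega
      · push_cast
        rfl
    · right
      rw [if_neg h1]
      refine ⟨h1, ?_⟩
      push_cast
      rfl

/-- If the numbers of crossings are the coefficients of positive roots, up to positive factors, then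
they determine the family: a family with the same numbers belongs to a proportional root. -/
theorem isFamilyWithCrossings (hB : Γ.IsTypeB c) {Δ : V → Set (Sym2 V)} (hΔ : E.IsDiagramMap Δ)
    {s : V → ℝ} {w : Fin n → ℝ} (hs : ∀ β ∈ S.positiveRoots, 0 < s β) (hw : ∀ l, 0 < w l)
    (hcount : ∀ β ∈ S.positiveRoots, ∀ l, ∀ e ∈ L.diagram (-S.α l),
      (crossCount (L.diagram β) e : ℝ) = S.α.repr β l * w l / s β) {β : V}
    (hβ : β ∈ S.positiveRoots) :
    E.IsFamilyWithCrossings Δ (fun k => S.α.repr β k * w k / s β) (Δ β) := by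
  intro g hg
  have hg' : ∀ k, g k ∈ L.diagram (-S.α k) := fun k => by
    rw [← L.eqOn_diagram hΔ (S.neg_basis_mem k)]
    exact hg k
  rw [L.eqOn_diagram hΔ (Or.inl hβ)]
  refine ⟨⟨L.diagram_mem_centralFamilies hB (Or.inl hβ), fun k => hcount β hβ k _ (hg' k)⟩,
    fun F' hF' hm => ?_⟩
  obtain ⟨γ, hγ, rfl⟩ := L.exists_diagram_eq_of_mem_centralFamilies hB hF'
  congr 1
  rcases hγ with hγ | ⟨i, rfl⟩
  · refine S.eq_of_smul_eq_smul hγ.1 hβ.1 (inv_pos.2 (hs γ hγ)) (inv_pos.2 (hs β hβ)) ?_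
    apply S.α.repr.injective
    ext k
    have h1 : _ = S.α.repr β k * w k / s β := hm k
    rw [hcount γ hγ k _ (hg' k)] at h1
    have h2 := (hs γ hγ).ne'
    have h3 := (hs β hβ).ne'
    rw [map_smul, map_smul, Finsupp.smul_apply, Finsupp.smul_apply, smul_eq_mul, smul_eq_mul]
    refine mul_right_cancel₀ (hw k).ne' ?_
    rw [div_eq_inv_mul, div_eq_inv_mul] at h1
    linear_combination h1
  · exfalso
    have hzero : β = 0 := by
      apply S.α.repr.injective
      ext k
      have h1 : {d ∈ L.diagram (-S.α i) | Crosses d (g k)} = ∅ := by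
        rw [Set.eq_empty_iff_forall_notMem]
        rintro d ⟨hd, hc⟩
        have h2 := (L.exists_crosses_iff (S.neg_basis_mem i) hd k).1 ⟨_, hg' k, hc⟩
        simp only [map_neg, Finsupp.neg_apply, Module.Basis.repr_self, Finsupp.single_apply] at h2
        split_ifs at h2 <;> linarith
      have h2 := hm k
      rw [crossCount, h1, Set.ncard_empty, Nat.cast_zero, eq_comm, div_eq_zero_iff,
        mul_eq_zero] at h2
      rw [map_zero, Finsupp.zero_apply]
      exact (h2.resolve_right (hs β hβ).ne').resolve_right (hw k).ne'
    obtain ⟨j, k, hk, hkβ⟩ := hβ.1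
    rw [hzero, eq_comm, map_eq_zero_iff _ k.injective] at hkβ
    exact S.α.ne_zero j hkβ

/-- Numbers of crossings and coefficients are given by the same numbers `p` and `q` of
`crossCount_cases`, up to the ratio of the coefficient in the middle of the path to the others, which
is `2` if the last simple root is short and `1` if it is long. -/
theorem isSnakeModelB (L : Labelling Γ E) (hB : Γ.IsTypeB c) {Δ : V → Set (Sym2 V)}
    (hΔ : E.IsDiagramMap Δ) : E.IsSnakeModelB Δ := by
  have hEq := L.eqOn_diagram hΔ
  have hn := hB.two_le
  have hh := hB.h_eq
  have hc := hB.coef_pos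
  have hpos : ∀ i, 0 < ‖S.α i‖ := fun i => norm_pos_iff.2 (S.α.ne_zero i)
  have hcoef : ∀ j : Fin n, (j : ℕ) + 1 ≠ n → Γ.coef j = c := fun j hj =>
    hB.coef_of_ne (by omega) hj
  let i₀ : Fin n := ⟨0, by omega⟩
  have hi₀ : (i₀ : ℕ) + 1 < n := by
    simp only [i₀]
    omega
  refine ⟨⟨L.a, L.σ, fun i => ?_⟩, ?_, fun hshort => ?_, fun hlong => ?_⟩
  · rw [hEq (S.neg_basis_mem i), L.diagram_neg_of_typeB hB]
    rfl
  · refine Set.BijOn.congr ⟨fun β hβ => L.diagram_mem_centralFamilies hB hβ, L.diagram_injOn,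
      fun F hF => ?_⟩ hEq.symm
    obtain ⟨β, hβ, h1⟩ := L.exists_diagram_eq_of_mem_centralFamilies hB hF
    exact ⟨β, hβ, h1⟩
  · intro β hβ
    -- the ratio of the root lengths determines the coefficient in the middle of the path
    have hmid : ∀ j : Fin n, (j : ℕ) + 1 = n → Γ.coef j = 2 * c := by
      intro j hj
      have h1 := hB.norm_eq i₀ j hi₀ hj
      rw [mul_pow c, hshort i₀ j hi₀ hj] at h1
      have h2 : (Γ.coef j * ‖S.α j‖) ^ 2 = (2 * c * ‖S.α j‖) ^ 2 := by linear_combination h1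
      have h3 := (sq_eq_sq₀ (mul_pos (Γ.coef_pos j (by omega)) (hpos j)).le
        (mul_pos (by linarith) (hpos j)).le).1 h2
      exact mul_right_cancel₀ (hpos j).ne' h3
    have := L.isFamilyWithCrossings hB hΔ (s := fun _ => 1) (w := fun _ => 1) (by simp) (by simp)
      (fun γ hγ l e he => ?_) hβ
    · simpa using this
    · obtain ⟨j, p, q, -, hpq, hrepr, hcases⟩ := L.crossCount_cases hB hγ he
      rw [mul_one, div_one]
      rcases hcases with ⟨hj, rfl, hcc⟩ | ⟨hj, hcc⟩
      · rw [hcc]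
        rw [hmid j hj] at hrepr
        refine mul_left_cancel₀ (by positivity : 2 * c ≠ 0) ?_
        rw [hrepr]
        split_ifs with hl
        · rw [hmid l hl]
        · ring
      · rw [hcc]
        rw [hcoef j hj] at hrepr
        refine mul_left_cancel₀ hc.ne' ?_
        rw [hrepr]
        split_ifs with hl
        · rw [hmid l hl, hpq hl]
          ring
        · ring
  · intro β hβ
    -- the ratio of the root lengths determines the coefficient in the middle of the path
    have hmid : ∀ j : Fin n, (j : ℕ) + 1 = n → Γ.coef j = c := by
      intro j hj
      have h1 := hB.norm_eq i₀ j hi₀ hj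
      rw [mul_pow, mul_pow, hlong i₀ j hi₀ hj] at h1
      have h2 : (2 * ‖S.α i₀‖ ^ 2) * Γ.coef j ^ 2 = (2 * ‖S.α i₀‖ ^ 2) * c ^ 2 := by
        linear_combination h1
      have h3 := mul_left_cancel₀ (by have := hpos i₀; positivity) h2
      exact (sq_eq_sq₀ (Γ.coef_pos j (by omega)).le hc.le).1 h3
    have hcoef' : ∀ j : Fin n, Γ.coef j = c := fun j => by
      by_cases hj : (j : ℕ) + 1 = n
      exacts [hmid j hj, hcoef j hj]
    refine L.isFamilyWithCrossings hB hΔ (s := fun γ => ‖γ‖ ^ 2) (w := fun l => ‖S.α l‖ ^ 2)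
      (fun γ hγ => ?_) (fun l => by have := hpos l; positivity) (fun γ hγ l e he => ?_) hβ
    · obtain ⟨i, k, hk, rfl⟩ := hγ.1
      rw [LinearIsometryEquiv.norm_map]
      have := hpos i
      positivity
    · obtain ⟨j, p, q, hnorm, hpq, hrepr, hcases⟩ := L.crossCount_cases hB hγ he
      have hj0 := hpos j
      rw [hcoef', hcoef'] at hrepr
      rw [hnorm, eq_div_iff (by positivity)]
      have hval : S.α.repr γ l = if (l : ℕ) + 1 = n then p else p + q := by
        refine mul_left_cancel₀ hc.ne' ?_
        rw [hrepr]
        split_ifs <;> rfl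
      let m : Fin n := ⟨n - 1, by omega⟩
      have hm : (m : ℕ) + 1 = n := by
        simp only [m]
        omega
      rw [hval]
      rcases hcases with ⟨hj, rfl, hcc⟩ | ⟨hj, hcc⟩
      · rw [hcc]
        split_ifs with hl
        · rw [show l = j from Fin.ext (by omega)]
        · rw [hlong l j (by omega) hj]
          ring
      · rw [hcc]
        split_ifs with hl
        · rw [hlong j l (by omega) hl, hpq hl]
          ring
        · have h1 := hlong l m (by omega) hm
          have h2 := hlong j m (by omega) hm
          have h3 : ‖S.α l‖ ^ 2 = ‖S.α j‖ ^ 2 := by linarith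
          rw [h3]

end Labelling

end Path

/-! ### Coordinates with respect to unit normals -/

section Coordinates

variable {n : ℕ} {M : CoxeterMatrix (Fin n)} {V : Type*} [NormedAddCommGroup V]
  [InnerProductSpace ℝ V] [FiniteDimensional ℝ V]

namespace SimpleSystem

variable (S : SimpleSystem M V)

/-- The signed distance of `x` to the mirror of the `i`-th simple reflection. -/
def height (i : Fin n) (x : V) : ℝ := inner ℝ (S.α i) x / ‖S.α i‖

theorem norm_pos (i : Fin n) : 0 < ‖S.α i‖ := norm_pos_iff.2 (S.α.ne_zero i)

theorem height_eq_zero_iff (i : Fin n) (x : V) : S.height i x = 0 ↔ inner ℝ (S.α i) x = 0 := by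
  rw [height, div_eq_zero_iff, or_iff_left (S.norm_pos i).ne']

theorem reflection_eq_self_iff (i : Fin n) (x : V) :
    simpleReflection S.α i x = x ↔ S.height i x = 0 := by
  rw [simpleReflection_eq_self_iff, height_eq_zero_iff]

theorem height_neg (i : Fin n) (x : V) : S.height i (-x) = -S.height i x := by
  rw [height, inner_neg_right, neg_div, height]

theorem height_smul (i : Fin n) (t : ℝ) (x : V) : S.height i (t • x) = t * S.height i x := by
  rw [height, inner_smul_right, mul_div_assoc, height]

theorem height_sub (i : Fin n) (x y : V) : S.height i (x - y) = S.height i x - S.height i y := by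
  rw [height, inner_sub_right, sub_div, height, height]

theorem sub_reflection (i : Fin n) (x : V) :
    x - simpleReflection S.α i x = (2 * S.height i x / ‖S.α i‖) • S.α i := by
  rw [simpleReflection_apply, sub_sub_cancel, height]
  congr 1
  have := (S.norm_pos i).ne'
  field_simp

theorem height_basis (i k : Fin n) :
    S.height i (S.α k) = -(‖S.α k‖ * Real.cos (Real.pi / (M i k : ℝ))) := by
  have := (S.norm_pos i).ne'
  rw [height, S.inner_eq]
  field_simp

theorem height_reflection (i k : Fin n) (x : V) : S.height i (simpleReflection S.α k x) =
    S.height i x + 2 * Real.cos (Real.pi / (M i k : ℝ)) * S.height k x := by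
  have h1 : simpleReflection S.α k x = x - (2 * S.height k x / ‖S.α k‖) • S.α k := by
    rw [← sub_reflection, sub_sub_cancel]
  have := (S.norm_pos k).ne'
  rw [h1, height_sub, height_smul, height_basis]
  field_simp
  ring

theorem height_reflection_self (k : Fin n) (x : V) :
    S.height k (simpleReflection S.α k x) = -S.height k x := by
  rw [height_reflection, M.diagonal]
  simp
  ring

theorem ext_height {x y : V} (hxy : ∀ i, S.height i x = S.height i y) : x = y := by
  rw [← sub_eq_zero]
  refine eq_zero_of_inner_eq_zero S.α fun i => ?_
  rw [← height_eq_zero_iff, height_sub, hxy, sub_self]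

/-- The heights can be prescribed arbitrarily, as the simple roots form a basis. -/
theorem exists_height (f : Fin n → ℝ) : ∃ y, ∀ i, S.height i y = f i := by
  let T : V →ₗ[ℝ] (Fin n → ℝ) :=
    { toFun := fun x i => S.height i x
      map_add' := fun x y => by
        funext i
        simp [height, inner_add_right, add_div]
      map_smul' := fun t x => by
        funext i
        simp [height_smul] }
  have hinj : Function.Injective T := fun x y hxy => S.ext_height fun i => congrFun hxy i
  have hsurj := (LinearMap.injective_iff_surjective_of_finrank_eq_finrank
    (by rw [Module.finrank_eq_card_basis S.α, Module.finrank_fin_fun, Fintype.card_fin])).1 hinj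
  obtain ⟨y, hy⟩ := hsurj f
  exact ⟨y, fun i => congrFun hy i⟩

/-- Simple roots joined by an edge with label three have the same length. -/
theorem norm_eq_of_eq_three {i j : Fin n} (hij : M i j = 3) : ‖S.α i‖ = ‖S.α j‖ := by
  have hi := (S.norm_pos i).ne'
  have hj := (S.norm_pos j).ne'
  have hcos : inner ℝ (S.α i) (S.α j) = -(‖S.α i‖ * ‖S.α j‖ / 2) := by
    rw [S.inner_eq, hij]
    push_cast
    rw [Real.cos_pi_div_three]
    ring
  have hcos' : inner ℝ (S.α j) (S.α i) = -(‖S.α i‖ * ‖S.α j‖ / 2) := by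
    rw [real_inner_comm, hcos]
  have h1 : simpleReflection S.α j (S.α i) = S.α i + (‖S.α i‖ / ‖S.α j‖) • S.α j := by
    rw [simpleReflection_apply, hcos', sub_eq_add_neg, ← neg_smul]
    congr 2
    field_simp
  have h2 : simpleReflection S.α i (S.α j) = S.α j + (‖S.α j‖ / ‖S.α i‖) • S.α i := by
    rw [simpleReflection_apply, hcos, sub_eq_add_neg, ← neg_smul]
    congr 2
    field_simp
  have h3 : simpleReflection S.α i (simpleReflection S.α j (S.α i)) =
      (‖S.α i‖ / ‖S.α j‖) • S.α j := by
    rw [h1, map_add, map_smul, simpleReflection_self, h2, smul_add, smul_smul,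
      show ‖S.α i‖ / ‖S.α j‖ * (‖S.α j‖ / ‖S.α i‖) = 1 by field_simp, one_smul]
    abel
  have h4 : (‖S.α i‖ / ‖S.α j‖) • S.α j ∈ roots S.α := by
    rw [← h3]
    exact apply_mem_roots (apply_mem_roots (basis_mem_roots _ _) (simpleReflection_mem _ _))
      (simpleReflection_mem _ _)
  have hpos := div_pos (S.norm_pos i) (S.norm_pos j)
  rcases S.reduced _ (basis_mem_roots _ j) _ h4 with h5 | h5
  · rwa [div_eq_one_iff_eq hj] at h5
  · linarith

theorem side_ne_of_ne_two {i j : Fin n} (hij : i ≠ j) (hM : M i j ≠ 2) :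
    S.side i = !S.side j :=
  Bool.eq_not_of_ne fun h0 => hM (S.bipartite i j hij h0)

end SimpleSystem

/-- A sequence of vectors, each obtained from the preceding one by a simple reflection, is a path if
no other simple reflections move its members. -/
def OrbitPath.ofHeights (S : SimpleSystem M V) {h : ℕ} (x : ℕ → V) (lab : ℕ → Fin n) (κ : ℝ)
    (h3 : 3 ≤ h) (hpos : ∀ k, k + 1 < h → 0 < κ * S.height (lab k) (x k))
    (hstep : ∀ k, k + 1 < h → simpleReflection S.α (lab k) (x k) = x (k + 1))
    (hfix : ∀ k < h, ∀ i, (k + 1 < h → lab k ≠ i) → (∀ j, j + 1 = k → lab j ≠ i) →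
      S.height i (x k) = 0)
    (halt : ∀ k, k + 2 < h → S.side (lab (k + 1)) = !S.side (lab k))
    (hsurj : ∀ i, ∃ k, k + 1 < h ∧ lab k = i) : OrbitPath S (orbit S.α (x 0)) h where
  x := x
  lab := lab
  κ := κ
  coef := fun k => 2 * (κ * S.height (lab k) (x k)) / ‖S.α (lab k)‖
  three_le := h3
  coef_pos := fun k hk => div_pos (mul_pos two_pos (hpos k hk)) (S.norm_pos _)
  diff := fun k hk => by
    rw [← hstep k hk, S.sub_reflection, smul_smul]
    congr 1
    ring
  step := hstep
  fix := fun k hk i h1 h2 => (S.reflection_eq_self_iff i _).2 (hfix k hk i h1 h2)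
  alt := halt
  surj := hsurj
  mem_iff := by
    intro y
    constructor
    · rintro ⟨g, hg, rfl⟩
      refine apply_mem_of_stable (s := {y | ∃ k < h, x k = y}) ?_ hg ⟨0, by omega, rfl⟩
      rintro i _ ⟨k, hk, rfl⟩
      by_cases h1 : k + 1 < h ∧ lab k = i
      · obtain ⟨h1, rfl⟩ := h1
        exact ⟨k + 1, h1, (hstep k h1).symm⟩
      by_cases h2 : ∃ j, j + 1 = k ∧ lab j = i
      · obtain ⟨j, rfl, rfl⟩ := h2
        exact ⟨j, by omega, by rw [← hstep j hk, simpleReflection_simpleReflection]⟩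
      · push Not at h1 h2
        exact ⟨k, hk, ((S.reflection_eq_self_iff i _).2 (hfix k hk i h1 h2)).symm⟩
    · rintro ⟨k, hk, rfl⟩
      induction k with
      | zero => exact mem_orbit_self _ _
      | succ k ih =>
        rw [← hstep k hk]
        exact apply_mem_orbit (ih (by omega)) (simpleReflection_mem _ _)

theorem OrbitPath.encard_le {S : SimpleSystem M V} {o : Set V} {h : ℕ} (Γ : OrbitPath S o h) :
    o.encard ≤ h := by
  have e : o = Γ.x '' (Finset.range h : Set ℕ) := by
    ext y
    rw [Γ.mem_iff]
    simp
  rw [e]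
  refine (Set.encard_image_le _ _).trans ?_
  rw [Set.encard_coe_eq_coe_finsetCard, Finset.card_range]

end Coordinates

/-! ### Orbits of the first fundamental direction in types `A` and `B` -/

section Walk

variable {n : ℕ} {M : CoxeterMatrix (Fin n)} {V : Type*} [NormedAddCommGroup V]
  [InnerProductSpace ℝ V] [FiniteDimensional ℝ V]

/-- The Coxeter diagram is a string whose edges have label three, with the possible exception of the
last one, for whose label `m` the number `2 cos (π / m)` is `e`. -/
structure IsString (M : CoxeterMatrix (Fin n)) (e : ℝ) : Prop where
  two_le : 2 ≤ n
  e_pos : 0 < e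
  far : ∀ i j : Fin n, (i : ℕ) + 1 < j → M i j = 2
  mid : ∀ i j : Fin n, (i : ℕ) + 1 = j → (j : ℕ) + 1 < n → M i j = 3
  last : ∀ i j : Fin n, (i : ℕ) + 1 = j → (j : ℕ) + 1 = n →
    2 * Real.cos (Real.pi / (M i j : ℝ)) = e

namespace IsString

variable {e : ℝ} (hM : IsString M e)

include hM

theorem two_cos_far {i j : Fin n} (hij : (i : ℕ) + 1 < j ∨ (j : ℕ) + 1 < i) :
    2 * Real.cos (Real.pi / (M i j : ℝ)) = 0 := by
  have h1 : M i j = 2 := by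
    rcases hij with hij | hij
    · exact hM.far i j hij
    · rw [← M.isSymm.apply i j]
      exact hM.far j i hij
  rw [h1]
  simp

theorem two_cos_succ {i j : Fin n} (hij : (i : ℕ) + 1 = j) :
    2 * Real.cos (Real.pi / (M i j : ℝ)) = if (j : ℕ) + 1 = n then e else 1 := by
  split_ifs with hj
  · exact hM.last i j hij hj
  · rw [hM.mid i j hij (by omega)]
    push_cast
    rw [Real.cos_pi_div_three]
    norm_num

theorem two_cos_pred {i j : Fin n} (hij : (j : ℕ) + 1 = i) :
    2 * Real.cos (Real.pi / (M i j : ℝ)) = if (i : ℕ) + 1 = n then e else 1 := by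
  rw [← hM.two_cos_succ hij]
  congr 4
  exact M.isSymm.apply j i

theorem side_succ (S : SimpleSystem M V) {i j : Fin n} (hij : (i : ℕ) + 1 = j) :
    S.side j = !S.side i := by
  have hne : i ≠ j := fun h0 => by
    rw [h0] at hij
    omega
  rw [S.side_ne_of_ne_two hne, Bool.not_not]
  intro h2
  have h1 := hM.two_cos_succ hij
  have he := hM.e_pos
  rw [h2] at h1
  push_cast at h1
  rw [Real.cos_pi_div_two, mul_zero] at h1
  split_ifs at h1 <;> linarith

theorem inner_succ_ne_zero (S : SimpleSystem M V) {i j : Fin n} (hij : (i : ℕ) + 1 = j) :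
    inner ℝ (S.α i) (S.α j) ≠ 0 := by
  have h1 := hM.two_cos_succ hij
  have he := hM.e_pos
  have h2 : 2 * Real.cos (Real.pi / (M i j : ℝ)) ≠ 0 := by
    rw [h1]
    split_ifs
    exacts [he.ne', one_ne_zero]
  rw [S.inner_eq, neg_ne_zero]
  exact mul_ne_zero (mul_pos (S.norm_pos i) (S.norm_pos j)).ne' (right_ne_zero_of_mul h2)

/-- All simple roots but possibly the last one have the same length. -/
theorem norm_eq (S : SimpleSystem M V) {i j : Fin n} (hi : (i : ℕ) + 1 < n)
    (hj : (j : ℕ) + 1 < n) : ‖S.α i‖ = ‖S.α j‖ := by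
  have key : ∀ k (hk : k + 1 < n), ‖S.α ⟨k, by omega⟩‖ = ‖S.α ⟨0, by omega⟩‖ := by
    intro k
    induction k with
    | zero => exact fun _ => rfl
    | succ k ih =>
      intro hk
      rw [← ih (by omega)]
      exact (S.norm_eq_of_eq_three (hM.mid _ _ rfl hk)).symm
  rw [show i = ⟨i, by omega⟩ from rfl, show j = ⟨j, by omega⟩ from rfl, key i hi, key j hj]

end IsString

/-- The sequence obtained from `y` by applying the simple reflections one after the other. -/
def walk (S : SimpleSystem M V) (y : V) : ℕ → V
  | 0 => y
  | k + 1 => if hk : k < n then simpleReflection S.α ⟨k, hk⟩ (walk S y k) else walk S y k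

theorem walk_succ (S : SimpleSystem M V) (y : V) (k : Fin n) :
    simpleReflection S.α k (walk S y k) = walk S y (k + 1) := by
  rw [walk, dif_pos k.2]

namespace IsString

variable {e : ℝ} (hM : IsString M e) {S : SimpleSystem M V} {y : V}
  (hy : ∀ j : Fin n, (j : ℕ) ≠ 0 → S.height j y = 0) {g : ℝ}
  (hg : ∀ j : Fin n, (j : ℕ) = 0 → S.height j y = g)

include hM hy hg

/-- After `k` steps, the only nonzero heights are those over the mirrors with labels `k` and
`k - 1`. -/
theorem height_walk {k : ℕ} (hk : k < n) (i : Fin n) : S.height i (walk S y k) =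
    if (i : ℕ) = k then (if k + 1 = n then e * g else g) else
      if (i : ℕ) + 1 = k then -g else 0 := by
  have hn := hM.two_le
  induction k generalizing i with
  | zero =>
    rw [walk, if_neg (by omega : ¬ 0 + 1 = n), if_neg (by omega : ¬ (i : ℕ) + 1 = 0)]
    split_ifs with h0
    exacts [hg i h0, hy i h0]
  | succ k ih =>
    have hk' : k < n := by omega
    have h1 := ih hk' ⟨k, hk'⟩
    rw [if_pos rfl, if_neg (by omega)] at h1
    rw [walk, dif_pos hk']
    rcases (by omega : (i : ℕ) = k ∨ (i : ℕ) = k + 1 ∨ (i : ℕ) + 1 = k ∨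
      ((i : ℕ) + 1 < k ∨ k + 1 < i)) with h2 | h2 | h2 | h2
    · rw [show (⟨k, hk'⟩ : Fin n) = i from Fin.ext h2.symm] at h1 ⊢
      rw [S.height_reflection_self, h1, if_neg (by omega), if_pos (by omega)]
    · rw [S.height_reflection, h1, ih hk', hM.two_cos_pred (j := ⟨k, hk'⟩) (by simp [h2]),
        if_neg (by omega), if_neg (by omega), if_pos h2, h2]
      split_ifs <;> ring
    · rw [S.height_reflection, h1, ih hk', hM.two_cos_succ (j := ⟨k, hk'⟩) (by simp [h2]),
        if_neg (by omega), if_pos h2, if_neg (by simp only; omega), if_neg (by omega),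
        if_neg (by omega)]
      ring
    · rw [S.height_reflection, ih hk', hM.two_cos_far (j := ⟨k, hk'⟩) (by simpa using h2),
        if_neg (by omega), if_neg (by omega), if_neg (by omega), if_neg (by omega)]
      ring

/-- The vector reached by applying all simple reflections. -/
theorem height_walk_last (i : Fin n) : S.height i (walk S y n) =
    if (i : ℕ) + 1 = n then -(e * g) else if (i : ℕ) + 2 = n then (e ^ 2 - 1) * g else 0 := by
  have hn := hM.two_le
  obtain ⟨m, rfl⟩ : ∃ m, n = m + 1 := ⟨n - 1, by omega⟩
  have hm : m < m + 1 := by omega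
  have h0 := hM.height_walk hy hg hm
  have h1 := h0 ⟨m, hm⟩
  rw [if_pos rfl, if_pos rfl] at h1
  rw [walk, dif_pos hm]
  rcases (by omega : (i : ℕ) = m ∨ (i : ℕ) + 1 = m ∨ (i : ℕ) + 1 < m) with h2 | h2 | h2
  · rw [show (⟨m, hm⟩ : Fin (m + 1)) = i from Fin.ext h2.symm] at h1 ⊢
    rw [S.height_reflection_self, h1, if_pos (by omega)]
  · rw [S.height_reflection, h1, h0, hM.two_cos_succ (j := ⟨m, hm⟩) (by simp [h2]),
      if_neg (by omega), if_pos h2, if_pos rfl, if_neg (by omega), if_pos (by omega)]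
    ring
  · rw [S.height_reflection, h0, hM.two_cos_far (j := ⟨m, hm⟩) (Or.inl h2),
      if_neg (by omega), if_neg (by omega), if_neg (by omega), if_neg (by omega)]
    ring

end IsString

/-- The path of type `A`. -/
theorem IsString.exists_pathA (hM : IsString M 1) {S : SimpleSystem M V} {y : V}
    (hM3 : ∀ i j : Fin n, (i : ℕ) + 1 = j → M i j = 3) (hy0 : y ≠ 0)
    (hy : ∀ j : Fin n, (j : ℕ) ≠ 0 → S.height j y = 0) :
    ∃ (Γ : OrbitPath S (orbit S.α y) (n + 1)) (c : ℝ), Γ.IsTypeA c := by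
  have hn := hM.two_le
  obtain ⟨g, hg⟩ : ∃ g, ∀ j : Fin n, (j : ℕ) = 0 → S.height j y = g :=
    ⟨S.height ⟨0, by omega⟩ y, fun j hj => by rw [show j = ⟨0, by omega⟩ from Fin.ext hj]⟩
  have hg0 : g ≠ 0 := by
    rintro rfl
    refine hy0 (S.ext_height fun i => ?_)
    rw [show S.height i 0 = 0 by simp [SimpleSystem.height]]
    by_cases hi : (i : ℕ) = 0
    exacts [hg i hi, hy i hi]
  have hnorm : ∀ i j : Fin n, ‖S.α i‖ = ‖S.α j‖ := by
    have key : ∀ k (hk : k < n), ‖S.α ⟨k, hk⟩‖ = ‖S.α ⟨0, by omega⟩‖ := by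
      intro k
      induction k with
      | zero => exact fun _ => rfl
      | succ k ih =>
        intro hk
        rw [← ih (by omega)]
        exact (S.norm_eq_of_eq_three (hM3 _ _ rfl)).symm
    intro i j
    rw [show i = ⟨i, i.2⟩ from rfl, show j = ⟨j, j.2⟩ from rfl, key i i.2, key j j.2]
  have hheight : ∀ k < n, S.height ⟨min k (n - 1), by omega⟩ (walk S y k) = g := by
    intro k hk
    rw [hM.height_walk hy hg hk, if_pos (by simp only; omega)]
    simp
  refine ⟨OrbitPath.ofHeights S (walk S y) (fun k => ⟨min k (n - 1), by omega⟩) g (by omega)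
    (fun k hk => ?_) (fun k hk => ?_) (fun k hk i h1 h2 => ?_) (fun k hk => ?_) (fun i => ?_),
    2 * (g * g) / ‖S.α ⟨0, by omega⟩‖, ⟨rfl, fun k hk => ?_, fun k hk => ?_⟩⟩
  · rw [hheight k (by omega)]
    exact mul_self_pos.2 hg0
  · rw [← walk_succ S y ⟨k, by omega⟩]
    congr 2
    exact Fin.ext (by simp only; omega)
  · rcases (by omega : k < n ∨ k = n) with h3 | rfl
    · have h4 := h1 (by omega)
      rw [Ne, Fin.ext_iff] at h4
      simp only at h4
      rw [hM.height_walk hy hg h3, if_neg (by omega)]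
      split_ifs with h5
      · have h6 := h2 i h5
        rw [Ne, Fin.ext_iff] at h6
        simp only at h6
        omega
      · rfl
    · have h6 := h2 (k - 1) (by omega)
      rw [Ne, Fin.ext_iff] at h6
      simp only at h6
      rw [hM.height_walk_last hy hg, if_neg (by omega)]
      split_ifs <;> ring
  · exact hM.side_succ S (by simp only; omega)
  · exact ⟨i, by omega, Fin.ext (by simp only; omega)⟩
  · simp only [OrbitPath.ofHeights]
    omega
  · simp only [OrbitPath.ofHeights]
    rw [hheight k (by omega), hnorm]

/-- The path of type `B`. -/
theorem IsString.exists_pathB (hM : IsString M √2) {S : SimpleSystem M V} {y : V} (hy0 : y ≠ 0)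
    (hy : ∀ j : Fin n, (j : ℕ) ≠ 0 → S.height j y = 0) :
    ∃ (Γ : OrbitPath S (orbit S.α y) (2 * n)) (c : ℝ), Γ.IsTypeB c ∧
      Γ.x (n - 1) = walk S y (n - 1) := by
  have hn := hM.two_le
  have hsq : √2 ^ 2 = (2 : ℝ) := Real.sq_sqrt (by norm_num)
  obtain ⟨g, hg⟩ : ∃ g, ∀ j : Fin n, (j : ℕ) = 0 → S.height j y = g :=
    ⟨S.height ⟨0, by omega⟩ y, fun j hj => by rw [show j = ⟨0, by omega⟩ from Fin.ext hj]⟩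
  have hg0 : g ≠ 0 := by
    rintro rfl
    refine hy0 (S.ext_height fun i => ?_)
    rw [show S.height i 0 = 0 by simp [SimpleSystem.height]]
    by_cases hi : (i : ℕ) = 0
    exacts [hg i hi, hy i hi]
  have hlast : walk S y n = -walk S y (n - 1) := by
    refine S.ext_height fun i => ?_
    rw [S.height_neg, hM.height_walk_last hy hg, hM.height_walk hy hg (by omega), hsq]
    rcases (by omega : (i : ℕ) + 1 = n ∨ (i : ℕ) + 2 = n ∨ (i : ℕ) + 2 < n) with h1 | h1 | h1
    · rw [if_pos h1, if_pos (by omega), if_pos (by omega)]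
    · rw [if_neg (by omega), if_pos h1, if_neg (by omega), if_pos (by omega)]
      ring
    · rw [if_neg (by omega), if_neg (by omega), if_neg (by omega), if_neg (by omega), neg_zero]
  obtain ⟨x, hx⟩ : ∃ x : ℕ → V, ∀ k, x k = if k < n then walk S y k else
    -walk S y (2 * n - 1 - k) := ⟨_, fun _ => rfl⟩
  obtain ⟨lab, hlab⟩ : ∃ lab : ℕ → Fin n, ∀ k, k + 1 < 2 * n →
      (lab k : ℕ) = if k < n then k else 2 * n - 2 - k :=
    ⟨fun k => ⟨if k < n then k else 2 * n - 2 - k, by split_ifs <;> omega⟩, fun _ _ => rfl⟩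
  have hx0 : x 0 = y := by
    rw [hx, if_pos (by omega), walk]
  have hheight : ∀ k, k + 1 < 2 * n → S.height (lab k) (x k) = if k + 1 = n then √2 * g else g := by
    intro k hk
    have h1 := hlab k hk
    rw [hx]
    split_ifs at h1 ⊢ with h2 h3 h3
    · rw [hM.height_walk hy hg h2, if_pos h1, if_pos h3]
    · rw [hM.height_walk hy hg h2, if_pos h1, if_neg h3]
    · omega
    · rw [S.height_neg, hM.height_walk hy hg (by omega), if_neg (by omega), if_pos (by omega),
        neg_neg]
  have hstep : ∀ k, k + 1 < 2 * n → simpleReflection S.α (lab k) (x k) = x (k + 1) := by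
    intro k hk
    have h1 := hlab k hk
    rcases (by omega : k + 1 < n ∨ k + 1 = n ∨ n ≤ k) with h2 | h2 | h2
    · rw [if_pos (by omega)] at h1
      have h4 := walk_succ S y (lab k)
      rw [h1] at h4
      rw [hx, hx, if_pos (by omega), if_pos h2, h4]
    · rw [if_pos (by omega)] at h1
      have h4 := walk_succ S y (lab k)
      rw [h1] at h4
      rw [hx, hx, if_pos (by omega), if_neg (by omega), show 2 * n - 1 - (k + 1) = n - 1 by omega,
        ← hlast, h4, h2]
    · rw [if_neg (by omega)] at h1
      rw [hx, hx, if_neg (by omega), if_neg (by omega), map_neg,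
        show 2 * n - 1 - k = lab k + 1 by omega, ← walk_succ, simpleReflection_simpleReflection, h1]
      congr 2
      omega
  have hfix : ∀ k < 2 * n, ∀ i, (k + 1 < 2 * n → lab k ≠ i) → (∀ j, j + 1 = k → lab j ≠ i) →
      S.height i (x k) = 0 := by
    intro k hk i h1 h2
    have h1' : k + 1 < 2 * n → (if k < n then k else 2 * n - 2 - k) ≠ i := fun h3 => by
      rw [← hlab k h3]
      exact fun h4 => h1 h3 (Fin.ext h4)
    have h2' : ∀ j, j + 1 = k → (if j < n then j else 2 * n - 2 - j) ≠ i := fun j h3 => by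
      rw [← hlab j (by omega)]
      exact fun h4 => h2 j h3 (Fin.ext h4)
    rw [hx]
    by_cases h3 : k < n
    · rw [if_pos h3] at h1'
      rw [if_pos h3, hM.height_walk hy hg h3, if_neg (fun h4 => h1' (by omega) h4.symm), if_neg]
      intro h4
      have := h2' i h4
      rw [if_pos i.2] at this
      exact this rfl
    · rw [if_neg h3] at h1'
      rw [if_neg h3, S.height_neg, hM.height_walk hy hg (by omega), if_neg, if_neg, neg_zero]
      · intro h4
        exact h1' (by omega) (by omega)
      · intro h4
        have := h2' (k - 1) (by omega)
        split_ifs at this <;> omega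
  have halt : ∀ k, k + 2 < 2 * n → S.side (lab (k + 1)) = !S.side (lab k) := by
    intro k hk
    have h1 := hlab k (by omega)
    have h2 := hlab (k + 1) (by omega)
    rcases (by omega : k + 1 < n ∨ n ≤ k + 1) with h3 | h3
    · rw [if_pos (by omega)] at h1 h2
      exact hM.side_succ S (by omega)
    · rw [hM.side_succ S (i := lab (k + 1)) (j := lab k) (by split_ifs at h1 h2 <;> omega),
        Bool.not_not]
  have hsurj : ∀ i, ∃ k, k + 1 < 2 * n ∧ lab k = i := fun i =>
    ⟨i, by omega, Fin.ext (by rw [hlab _ (by omega), if_pos i.2])⟩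
  have hpos : ∀ k, k + 1 < 2 * n → 0 < g * S.height (lab k) (x k) := by
    intro k hk
    have hgg := mul_self_pos.2 hg0
    rw [hheight k hk]
    split_ifs
    · rw [show g * (√2 * g) = √2 * (g * g) by ring]
      positivity
    · exact hgg
  have hcoef : ∀ k, k + 1 < 2 * n → k + 1 ≠ n → S.height (lab k) (x k) = g := fun k hk hkn => by
    rw [hheight k hk, if_neg hkn]
  rw [← hx0]
  refine ⟨OrbitPath.ofHeights S x lab g (by omega) hpos hstep hfix halt hsurj,
    2 * (g * g) / ‖S.α ⟨0, by omega⟩‖, ⟨rfl, hlab, fun k hk => ?_, fun k hk => ?_,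
    fun i j hi hj => ?_⟩, ?_⟩
  · simp only [OrbitPath.ofHeights]
    rw [hx, hx]
    rcases (by omega : k < n ∨ n ≤ k) with h1 | h1
    · rw [if_neg (by omega), if_pos h1]
      congr 2
      omega
    · rw [if_pos (by omega), if_neg (by omega), neg_neg]
  · simp only [OrbitPath.ofHeights]
    rw [hcoef k (by omega) (by omega),
      hM.norm_eq S (i := lab k) (j := ⟨0, by omega⟩) _ (by simp; omega)]
    rw [hlab k (by omega), if_pos (by omega)]
    exact hk
  · simp only [OrbitPath.ofHeights]
    have h1 : lab j = j := Fin.ext (by rw [hlab _ (by omega), if_pos j.2])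
    rw [hheight j (by omega), if_pos hj, h1, div_mul_cancel₀ _ (S.norm_pos j).ne',
      hM.norm_eq S (i := i) (j := ⟨0, by omega⟩) hi (by simp; omega),
      div_mul_cancel₀ _ (S.norm_pos _).ne']
    linear_combination 4 * g ^ 4 * hsq
  · simp only [OrbitPath.ofHeights]
    rw [hx, if_pos (by omega), hx0]

end Walk

/-! ### Orbits of vectors on a mirror in rank two -/

section Rank2

variable {M : CoxeterMatrix (Fin 2)} {V : Type*} [NormedAddCommGroup V] [InnerProductSpace ℝ V]
  [FiniteDimensional ℝ V]

/-- The sequence obtained from `y` by applying the two simple reflections alternately, beginning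
with the one with label `i`. -/
def alternate (S : SimpleSystem M V) (i : Fin 2) (y : V) : ℕ → V
  | 0 => y
  | k + 1 => simpleReflection S.α (if k % 2 = 0 then i else 1 - i) (alternate S i y k)

variable {S : SimpleSystem M V} {i : Fin 2} {y : V} {m : ℕ}

theorem entry_eq (hM : M 0 1 = m) {a b : Fin 2} (hab : a ≠ b) : M a b = m := by
  rcases (by omega : (a = 0 ∧ b = 1) ∨ (a = 1 ∧ b = 0)) with ⟨rfl, rfl⟩ | ⟨rfl, rfl⟩
  · exact hM
  · rw [← hM]
    exact M.isSymm.apply 0 1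

/-- The heights of the vectors are given by Chebyshev polynomials of the second kind. -/
theorem height_alternate (hM : M 0 1 = m) (hy : S.height (1 - i) y = 0) (k : ℕ) :
    Real.sin (Real.pi / m) * S.height (if k % 2 = 0 then i else 1 - i) (alternate S i y k) =
        S.height i y * Real.sin ((k + 1) * (Real.pi / m)) ∧
      Real.sin (Real.pi / m) * S.height (if k % 2 = 0 then 1 - i else i) (alternate S i y k) =
        -(S.height i y * Real.sin (k * (Real.pi / m))) := by
  have hne : i ≠ 1 - i := by omega
  have h1 := entry_eq hM hne
  have h2 := entry_eq hM hne.symm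
  induction k with
  | zero =>
    simp only [Nat.zero_mod, if_true, alternate, hy]
    constructor
    · simp [mul_comm]
    · simp
  | succ k ih =>
    obtain ⟨ih1, ih2⟩ := ih
    have hsin : Real.sin ((k + 1 + 1) * (Real.pi / m)) =
        2 * Real.cos (Real.pi / m) * Real.sin ((k + 1) * (Real.pi / m)) -
          Real.sin (k * (Real.pi / m)) := by
      have e1 : ((k : ℝ) + 1 + 1) * (Real.pi / m) = (k + 1) * (Real.pi / m) + Real.pi / m := by ring
      have e2 : (k : ℝ) * (Real.pi / m) = (k + 1) * (Real.pi / m) - Real.pi / m := by ring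
      rw [e1, e2, Real.sin_add, Real.sin_sub]
      ring
    rw [alternate]
    push_cast
    rcases Nat.mod_two_eq_zero_or_one k with h0 | h0
    · rw [if_pos h0] at ih1 ih2
      rw [if_neg (by omega : ¬ (k + 1) % 2 = 0), if_pos h0, if_neg (by omega : ¬ (k + 1) % 2 = 0),
        S.height_reflection, h2, S.height_reflection_self]
      constructor
      · rw [hsin]
        linear_combination ih2 + 2 * Real.cos (Real.pi / m) * ih1
      · linear_combination -ih1
    · rw [if_neg (by omega)] at ih1 ih2
      rw [if_pos (by omega : (k + 1) % 2 = 0), if_neg (by omega : ¬ k % 2 = 0),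
        if_pos (by omega : (k + 1) % 2 = 0), S.height_reflection, h1, S.height_reflection_self]
      constructor
      · rw [hsin]
        linear_combination ih2 + 2 * Real.cos (Real.pi / m) * ih1
      · linear_combination -ih1

/-- In rank two the orbit of a vector on a simple mirror is a path. -/
theorem exists_path_rank_two (S : SimpleSystem M V) (hm : 3 ≤ m) (hM : M 0 1 = m)
    (hy : S.height (1 - i) y = 0) (hy0 : y ≠ 0) : Nonempty (OrbitPath S (orbit S.α y) m) := by
  have hne : i ≠ 1 - i := by omega
  have hm0 : (0 : ℝ) < m := by
    have : 0 < m := by omega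
    exact_mod_cast this
  have hθ : 0 < Real.pi / m := div_pos Real.pi_pos hm0
  have hs : 0 < Real.sin (Real.pi / m) := by
    refine Real.sin_pos_of_pos_of_lt_pi hθ ?_
    rw [div_lt_iff₀ hm0]
    have : (1 : ℝ) < m := by exact_mod_cast (by omega : 1 < m)
    nlinarith [Real.pi_pos]
  have hg0 : S.height i y ≠ 0 := by
    intro h0
    refine hy0 (S.ext_height fun j => ?_)
    rw [show S.height j 0 = 0 by simp [SimpleSystem.height]]
    rcases (by omega : j = i ∨ j = 1 - i) with rfl | rfl
    exacts [h0, hy]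
  refine ⟨OrbitPath.ofHeights S (alternate S i y) (fun k => if k % 2 = 0 then i else 1 - i)
    (S.height i y) hm (fun k hk => ?_) (fun k _ => rfl) (fun k hk j h1 h2 => ?_) (fun k hk => ?_)
    (fun j => ?_)⟩
  · have h1 := (height_alternate hM hy k).1
    have h2 : 0 < Real.sin ((k + 1) * (Real.pi / m)) := by
      refine Real.sin_pos_of_pos_of_lt_pi (by positivity) ?_
      rw [← mul_div_assoc, div_lt_iff₀ hm0]
      have : (k : ℝ) + 1 < m := by exact_mod_cast hk
      nlinarith [Real.pi_pos]
    have h3 := mul_pos (mul_self_pos.2 hg0) h2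
    have h4 : Real.sin (Real.pi / m) * (S.height i y *
        S.height (if k % 2 = 0 then i else 1 - i) (alternate S i y k)) =
        S.height i y * S.height i y * Real.sin ((k + 1) * (Real.pi / m)) := by
      linear_combination S.height i y * h1
    rw [← h4] at h3
    exact (mul_pos_iff_of_pos_left hs).1 h3
  · rcases (by omega : k = 0 ∨ (0 < k ∧ k + 1 < m) ∨ k + 1 = m) with rfl | h3 | h3
    · have h4 := h1 (by omega)
      simp only [Nat.zero_mod, if_true] at h4
      rw [show j = 1 - i by omega, alternate, hy]
    · exfalso
      have h4 := h1 h3.2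
      have h5 := h2 (k - 1) (by omega)
      split_ifs at h4 h5 <;> omega
    · have h5 := h2 (k - 1) (by omega)
      have h6 : j = if k % 2 = 0 then i else 1 - i := by
        split_ifs at h5 ⊢ <;> omega
      have h7 := (height_alternate hM hy k).1
      have h8 : (k : ℝ) + 1 = m := by exact_mod_cast h3
      rw [h8, mul_div_cancel₀ _ hm0.ne', Real.sin_pi, mul_zero, ← h6] at h7
      exact (mul_eq_zero.1 h7).resolve_left hs.ne'
  · have key : ∀ a b : Fin 2, a ≠ b → S.side a = !S.side b := fun a b hab =>
      S.side_ne_of_ne_two hab (by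
        rw [entry_eq hM hab]
        omega)
    refine key _ _ ?_
    split_ifs <;> first | exact hne | exact hne.symm | omega
  · by_cases hj : j = i
    · exact ⟨0, by omega, by simp [hj]⟩
    · exact ⟨1, by omega, by simp; omega⟩

namespace OrbitPath

variable {o : Set V} {h : ℕ} (Γ : OrbitPath S o h)

/-- In rank two the Coxeter plane is the whole space. -/
theorem mem_plane_of_rank_two (Γ : OrbitPath S o h) (v : V) : v ∈ S.coxeterPlane := by
  have h1 : S.coxeterPlane = ⊤ := Submodule.eq_top_of_finrank_eq (by
    rw [Γ.finrank_coxeterPlane, Module.finrank_eq_card_basis S.α, Fintype.card_fin])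
  rw [h1]
  trivial

/-- Powers of the Coxeter element that fix a nonzero vector are trivial. -/
theorem dvd_of_turn_zpow_eq {v : V} (hv : v ≠ 0) {j : ℤ} (hj : (Γ.turn ^ j) v = v) :
    (h : ℤ) ∣ j := by
  have key := congrFun (eq_of_recurrence (C := 2 * Real.cos Γ.angle)
    (f := fun j : ℤ => inner ℝ ((Γ.turn ^ j) v) v)
    (g := fun j : ℤ => Real.cos (Γ.angle * j) * ‖v‖ ^ 2) (fun j => ?_) (fun j => ?_) (by simp) ?_) j
  · simp only [hj, real_inner_self_eq_norm_sq] at key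
    have hp : 0 < ‖v‖ := norm_pos_iff.2 hv
    rw [eq_comm, mul_eq_right₀ (by positivity), Real.cos_eq_one_iff] at key
    obtain ⟨t, ht⟩ := key
    refine ⟨t, ?_⟩
    rw [← Γ.angle_mul_h, mul_comm, mul_assoc] at ht
    have := mul_left_cancel₀ Γ.angle_pos.ne' ht
    exact_mod_cast this.symm
  · have h1 := (Γ.mem_plane_iff _).1 (Γ.mem_plane_of_rank_two ((Γ.turn ^ j) v))
    have h2 : (Γ.turn ^ (j + 1)) v = Γ.turn ((Γ.turn ^ j) v) := by
      rw [add_comm, zpow_add, zpow_one, LinearIsometryEquiv.coe_mul, Function.comp]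
    have h3 : (Γ.turn ^ (j - 1)) v = Γ.turn⁻¹ ((Γ.turn ^ j) v) := by
      rw [sub_eq_neg_add, zpow_add, zpow_neg_one, LinearIsometryEquiv.coe_mul, Function.comp]
    rw [h2, h3, ← inner_add_left, h1, inner_smul_left]
    rfl
  · have := Real.two_mul_cos_mul_cos (Γ.angle * j) Γ.angle
    push_cast
    rw [mul_add, mul_sub, mul_one, smul_eq_mul]
    linear_combination -‖v‖ ^ 2 * this
  · simp only [zpow_one]
    rw [Γ.inner_turn_self (Γ.mem_plane_of_rank_two v), Int.cast_one, mul_one]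

theorem turn_mem (Γ : OrbitPath S o h) : Γ.turn ∈ reflectionGroup S.α :=
  mul_mem (S.half_mem _) (S.half_mem _)

/-- In rank two an orbit with at most `h` elements meets a simple mirror: it consists of the images
of one vector under the powers of the Coxeter element, and a reflection maps this vector to its image
under a power, half of which moves the vector to a mirror. -/
theorem exists_mem_mirror (Γ : OrbitPath S o h) {v : V} (hv : v ≠ 0)
    (hcard : (orbit S.α v).encard ≤ h) : ∃ w ∈ orbit S.α v, ∃ i, S.height i w = 0 := by
  have h3 := Γ.three_le
  have hmem : ∀ j : ℤ, (Γ.turn ^ j) v ∈ orbit S.α v := fun j => ⟨_, zpow_mem Γ.turn_mem j, rfl⟩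
  have hinj : Set.InjOn (fun k : ℕ => (Γ.turn ^ (k : ℤ)) v) (Finset.range h : Set ℕ) := by
    intro a ha b hb hab
    simp only [Finset.coe_range, Set.mem_Iio] at ha hb hab
    have h1 : (Γ.turn ^ ((a : ℤ) - b)) v = v := by
      rw [sub_eq_neg_add, zpow_add, LinearIsometryEquiv.coe_mul, Function.comp, hab, zpow_neg]
      exact (Γ.turn ^ (b : ℤ)).symm_apply_apply v
    have h2 := Int.eq_zero_of_abs_lt_dvd (Γ.dvd_of_turn_zpow_eq hv h1) (by rw [abs_lt]; omega)
    omega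
  have himg : (fun k : ℕ => (Γ.turn ^ (k : ℤ)) v) '' (Finset.range h : Set ℕ) = orbit S.α v := by
    refine Set.Finite.eq_of_subset_of_encard_le ?_ ?_ ?_
    · exact (Finset.finite_toSet _).image _
    · rintro _ ⟨k, -, rfl⟩
      exact hmem k
    · rw [hinj.encard_image, Set.encard_coe_eq_coe_finsetCard, Finset.card_range]
      exact hcard
  have hsv : S.half (!Γ.firstSide) v ∈ orbit S.α v := ⟨_, S.half_mem _, rfl⟩
  rw [← himg] at hsv
  obtain ⟨k, -, hk⟩ := hsv
  simp only at hk
  have hside : ∀ ε, ∃ i, S.side i = ε := by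
    intro ε
    by_cases hε : ε = Γ.firstSide
    · exact ⟨Γ.lab 0, hε.symm⟩
    · exact ⟨Γ.lab 1, by rw [Γ.alt 0 (by omega), Bool.eq_not_of_ne hε, firstSide]⟩
  have hfin : ∀ ε (j : ℤ), S.half ε ((Γ.turn ^ j) v) = (Γ.turn ^ j) v →
      ∃ w ∈ orbit S.α v, ∃ i, S.height i w = 0 := by
    intro ε j hj
    obtain ⟨i, hi⟩ := hside ε
    exact ⟨_, hmem j, i, (S.height_eq_zero_iff i _).2 ((S.half_eq_self_iff ε _).1 hj i hi)⟩
  have hsecond : ∀ j : ℤ, S.half (!Γ.firstSide) ((Γ.turn ^ j) v) = (Γ.turn ^ (k - j)) v := by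
    intro j
    rw [half_second_turn_zpow, ← hk, sub_eq_neg_add, zpow_add, LinearIsometryEquiv.coe_mul,
      Function.comp]
  rcases Nat.even_or_odd' k with ⟨l, hl | hl⟩
  · refine hfin (!Γ.firstSide) l ?_
    rw [hsecond, show (k : ℤ) - l = l by omega]
  · refine hfin Γ.firstSide (l + 1) ?_
    have h1 : ∀ w, S.half Γ.firstSide w = Γ.turn (S.half (!Γ.firstSide) w) := fun w => by
      rw [turn, LinearIsometryEquiv.coe_mul, Function.comp, S.half_half]
    rw [h1, hsecond, show (k : ℤ) - (l + 1) = l by omega, add_comm (l : ℤ) 1, zpow_add, zpow_one,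
      LinearIsometryEquiv.coe_mul, Function.comp]

end OrbitPath

end Rank2

/-! ### Small orbits in types `A` and `B` -/

section Frame

variable {n : ℕ} {M : CoxeterMatrix (Fin n)} {V : Type*} [NormedAddCommGroup V]
  [InnerProductSpace ℝ V] [FiniteDimensional ℝ V]

/-- The frame operator of a finite set of vectors. -/
def frame (O : Finset V) (w : V) : V := ∑ y ∈ O, (inner ℝ y w : ℝ) • y

theorem inner_frame (O : Finset V) (v w : V) :
    inner ℝ v (frame O w) = ∑ y ∈ O, inner ℝ y v * inner ℝ y w := by
  rw [frame, inner_sum]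
  refine Finset.sum_congr rfl fun y _ => ?_
  rw [inner_smul_right, mul_comm, real_inner_comm v y]

theorem inner_frame_comm (O : Finset V) (v w : V) :
    inner ℝ v (frame O w) = inner ℝ w (frame O v) := by
  rw [inner_frame, inner_frame]
  exact Finset.sum_congr rfl fun y _ => mul_comm _ _

variable {S : SimpleSystem M V} {O : Finset V}
  (hO : ∀ i, ∀ y ∈ O, simpleReflection S.α i y ∈ O)

include hO

theorem sum_reflection {E : Type*} [AddCommMonoid E] (i : Fin n) (F : V → E) :
    ∑ y ∈ O, F (simpleReflection S.α i y) = ∑ y ∈ O, F y :=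
  Finset.sum_nbij' (simpleReflection S.α i) (simpleReflection S.α i) (hO i) (hO i)
    (fun _ _ => simpleReflection_simpleReflection _ _ _)
    (fun _ _ => simpleReflection_simpleReflection _ _ _) fun _ _ => rfl

theorem sum_eq_zero_of_stable : ∑ y ∈ O, y = 0 := by
  refine eq_zero_of_inner_eq_zero S.α fun i => ?_
  rw [← simpleReflection_eq_self_iff, map_sum]
  exact sum_reflection hO i id

theorem frame_reflection (i : Fin n) (w : V) :
    frame O (simpleReflection S.α i w) = simpleReflection S.α i (frame O w) := by
  rw [frame, frame, map_sum, ← sum_reflection hO i]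
  refine Finset.sum_congr rfl fun y _ => ?_
  rw [LinearIsometryEquiv.inner_map_map, map_smul]

/-- The frame operator of a stable set is a scalar, since it commutes with the reflections and the
Coxeter diagram is connected; its trace is the sum of the squared norms. -/
theorem exists_frame_eq_smul (hconn : ∀ i j : Fin n, (i : ℕ) + 1 = j →
    inner ℝ (S.α i) (S.α j) ≠ 0) (hn : 0 < n) {r : ℝ} (hr : ∀ y ∈ O, ‖y‖ = r) :
    ∃ μ : ℝ, μ * n = O.card * r ^ 2 ∧ ∀ w, frame O w = μ • w := by
  have hone : ∀ i, ∃ μ : ℝ, frame O (S.α i) = μ • S.α i := by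
    intro i
    have h1 := frame_reflection hO i (S.α i)
    rw [simpleReflection_self, simpleReflection_apply,
      show frame O (-S.α i) = -frame O (S.α i) by simp [frame]] at h1
    refine ⟨inner ℝ (S.α i) (frame O (S.α i)) / ‖S.α i‖ ^ 2, ?_⟩
    have h2 : (2 : ℝ) • frame O (S.α i) =
        (2 : ℝ) • (inner ℝ (S.α i) (frame O (S.α i)) / ‖S.α i‖ ^ 2) • S.α i := by
      rw [smul_smul, ← mul_div_assoc, two_smul]
      nth_rewrite 1 [← neg_neg (frame O (S.α i)), h1]
      abel
    exact smul_right_injective V two_ne_zero h2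
  choose μ hμ using hone
  have hstep : ∀ i j : Fin n, (i : ℕ) + 1 = j → μ j = μ i := by
    intro i j hij
    have h1 := inner_frame_comm O (S.α i) (S.α j)
    rw [hμ, hμ, inner_smul_right, inner_smul_right, real_inner_comm (S.α i) (S.α j)] at h1
    exact mul_right_cancel₀ (hconn i j hij) h1
  have hall : ∀ k (hk : k < n), μ ⟨k, hk⟩ = μ ⟨0, hn⟩ := by
    intro k
    induction k with
    | zero => exact fun _ => rfl
    | succ k ih =>
      intro hk
      rw [← ih (by omega)]
      exact hstep _ _ rfl
  have hscal : ∀ w, frame O w = μ ⟨0, hn⟩ • w := by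
    intro w
    rw [← sub_eq_zero]
    refine eq_zero_of_inner_eq_zero S.α fun i => ?_
    rw [inner_sub_right, inner_frame_comm, hμ, inner_smul_right, inner_smul_right,
      show i = ⟨i, i.2⟩ from rfl, hall, real_inner_comm, sub_self]
  refine ⟨μ ⟨0, hn⟩, ?_, hscal⟩
  let b := stdOrthonormalBasis ℝ V
  have h1 : ∑ j, inner ℝ (b j) (frame O (b j)) = μ ⟨0, hn⟩ * n := by
    simp only [hscal, inner_smul_right, real_inner_self_eq_norm_sq, b.norm_eq_one]
    rw [one_pow, mul_one, Finset.sum_const, Finset.card_univ, Fintype.card_fin, nsmul_eq_mul,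
      Module.finrank_eq_card_basis S.α, Fintype.card_fin, mul_comm]
  rw [← h1]
  simp only [inner_frame]
  rw [Finset.sum_comm, ← nsmul_eq_mul, ← Finset.sum_const]
  refine Finset.sum_congr rfl fun y hy => ?_
  rw [← hr y hy, ← b.sum_sq_norm_inner_left y]
  refine Finset.sum_congr rfl fun j _ => ?_
  rw [Real.norm_eq_abs, sq_abs, sq]

theorem sum_height_mul_height {μ : ℝ} (hμ : ∀ w, frame O w = μ • w) (i j : Fin n) :
    ∑ y ∈ O, S.height i y * S.height j y = -(μ * Real.cos (Real.pi / (M i j : ℝ))) := by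
  have hi := (S.norm_pos i).ne'
  have hj := (S.norm_pos j).ne'
  have h1 := inner_frame O (S.α i) (S.α j)
  rw [hμ, inner_smul_right, S.inner_eq] at h1
  have h2 : ∑ y ∈ O, S.height i y * S.height j y =
      (∑ y ∈ O, inner ℝ y (S.α i) * inner ℝ y (S.α j)) / (‖S.α i‖ * ‖S.α j‖) := by
    rw [Finset.sum_div]
    refine Finset.sum_congr rfl fun y _ => ?_
    rw [SimpleSystem.height, SimpleSystem.height, div_mul_div_comm, real_inner_comm,
      real_inner_comm y (S.α j)]
  rw [h2, ← h1]
  field_simp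

theorem sum_height_sq {μ : ℝ} (hμ : ∀ w, frame O w = μ • w) (i : Fin n) :
    ∑ y ∈ O, S.height i y ^ 2 = μ := by
  have h1 := sum_height_mul_height hO hμ i i
  rw [M.diagonal] at h1
  simp only [← sq] at h1
  rw [h1]
  simp

omit hO in
theorem inner_reflection (i : Fin n) (y : V) :
    inner ℝ y (simpleReflection S.α i y) = ‖y‖ ^ 2 - 2 * S.height i y ^ 2 := by
  have := (S.norm_pos i).ne'
  rw [simpleReflection_apply, inner_sub_right, inner_smul_right, real_inner_self_eq_norm_sq,
    SimpleSystem.height, real_inner_comm]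
  field_simp

/-- A small stable set in type `A` contains a vector on all simple mirrors but the first. Its
elements are the vertices of a regular simplex, since the sum of the squared deviations from the inner
products in such a simplex is nonpositive. Hence all nonzero heights have the same absolute value, and
each simple reflection moves two elements only. -/
theorem exists_mem_of_card_le_A (hM : IsString M 1) {r : ℝ} (hr : ∀ y ∈ O, ‖y‖ = r)
    (hr0 : 0 < r) (hne : O.Nonempty) (hcard : O.card ≤ n + 1) :
    ∃ y ∈ O, ∀ j : Fin n, (j : ℕ) ≠ 0 → S.height j y = 0 := by
  classical
  have hn := hM.two_le
  have hn0 : (0 : ℝ) < n := by exact_mod_cast (by omega : 0 < n)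
  obtain ⟨μ, hμn, hμ⟩ := exists_frame_eq_smul hO (fun i j => hM.inner_succ_ne_zero S) (by omega) hr
  have hcard' : (O.card : ℝ) ≤ n + 1 := by exact_mod_cast hcard
  -- the squares of the deviations from the inner products in a regular simplex
  have hdev : ∀ y ∈ O, ∑ z ∈ O.erase y, (n * inner ℝ z y + r ^ 2) ^ 2 =
      r ^ 4 * (n + 1) * (O.card - (n + 1)) := by
    intro y hy
    have h1 : ∑ z ∈ O, inner ℝ z y = (0 : ℝ) := by
      rw [← sum_inner, sum_eq_zero_of_stable hO, inner_zero_left]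
    have h2 : ∑ z ∈ O, inner ℝ z y * inner ℝ z y = μ * r ^ 2 := by
      rw [← inner_frame, hμ, inner_smul_right, real_inner_self_eq_norm_sq, hr y hy]
    rw [← Finset.add_sum_erase _ _ hy, real_inner_self_eq_norm_sq, hr y hy] at h1 h2
    have h3 : ((O.erase y).card : ℝ) = O.card - 1 := by
      rw [Finset.card_erase_of_mem hy, Nat.cast_pred (Finset.card_pos.2 hne)]
    have h4 : ∑ z ∈ O.erase y, ((n : ℝ) * inner ℝ z y + r ^ 2) ^ 2 =
        n ^ 2 * (∑ z ∈ O.erase y, inner ℝ z y * inner ℝ z y) +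
          2 * n * r ^ 2 * (∑ z ∈ O.erase y, inner ℝ z y) + (O.card - 1) * r ^ 4 := by
      rw [Finset.mul_sum, Finset.mul_sum, ← h3, ← nsmul_eq_mul, ← Finset.sum_const,
        ← Finset.sum_add_distrib, ← Finset.sum_add_distrib]
      exact Finset.sum_congr rfl fun z _ => by ring
    rw [h4]
    linear_combination (n ^ 2 : ℝ) * h2 + 2 * n * r ^ 2 * h1 + n * r ^ 2 * hμn
  have hinner : ∀ y ∈ O, ∀ z ∈ O, z ≠ y → n * inner ℝ z y = -r ^ 2 := by
    intro y hy z hz hzy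
    have h1 : ∑ z ∈ O.erase y, ((n : ℝ) * inner ℝ z y + r ^ 2) ^ 2 ≤ 0 := by
      rw [hdev y hy]
      exact mul_nonpos_of_nonneg_of_nonpos (by positivity) (by linarith)
    have h2 := (Finset.sum_eq_zero_iff_of_nonneg fun z _ => sq_nonneg _).1
      (le_antisymm h1 (Finset.sum_nonneg fun z _ => sq_nonneg _)) z (Finset.mem_erase.2 ⟨hzy, hz⟩)
    linarith [pow_eq_zero_iff two_ne_zero |>.1 h2]
  obtain ⟨y₀, hy₀⟩ := hne
  have hcard2 : (O.card : ℝ) = n + 1 := by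
    have h1 := hdev y₀ hy₀
    rw [Finset.sum_eq_zero fun z hz => by
      rw [hinner y₀ hy₀ z (Finset.mem_of_mem_erase hz) (Finset.ne_of_mem_erase hz)]
      ring] at h1
    have h2 : r ^ 4 * ((n : ℝ) + 1) ≠ 0 := by positivity
    linarith [(mul_eq_zero.1 h1.symm).resolve_left h2]
  obtain ⟨D, hD⟩ : ∃ D : ℝ, D * (2 * n) = r ^ 2 * (n + 1) := ⟨r ^ 2 * (n + 1) / (2 * n), by
    field_simp⟩
  have hD0 : 0 < D := by
    have : 0 < D * (2 * n) := by
      rw [hD]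
      positivity
    exact pos_of_mul_pos_left this (by positivity)
  have hμD : μ = 2 * D := by
    refine mul_right_cancel₀ hn0.ne' ?_
    rw [hμn, hcard2]
    linarith
  have hheight : ∀ y ∈ O, ∀ i, S.height i y ≠ 0 → S.height i y ^ 2 = D := by
    intro y hy i hi
    have h1 : simpleReflection S.α i y ≠ y := fun h0 => hi ((S.reflection_eq_self_iff i y).1 h0)
    have h2 := hinner y hy _ (hO i y hy) h1
    rw [real_inner_comm, inner_reflection, hr y hy] at h2
    refine mul_right_cancel₀ (by positivity : (2 * (n : ℝ)) ≠ 0) ?_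
    linarith
  obtain ⟨p, hp, hp0⟩ : ∃ p ∈ O, S.height ⟨0, by omega⟩ p ≠ 0 := by
    by_contra! hcon
    have h1 := sum_height_sq hO hμ ⟨0, by omega⟩
    rw [Finset.sum_eq_zero fun y hy => by rw [hcon y hy]; ring] at h1
    linarith
  have hq := hO ⟨0, by omega⟩ p hp
  set q := simpleReflection S.α ⟨0, by omega⟩ p with hqdef
  have hq0 : S.height ⟨0, by omega⟩ q = -S.height ⟨0, by omega⟩ p := S.height_reflection_self _ _
  have hpq : p ≠ q := by
    intro h0
    rw [← h0] at hq0
    exact hp0 (by linarith)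
  have hq1 : S.height ⟨1, by omega⟩ q = S.height ⟨1, by omega⟩ p + S.height ⟨0, by omega⟩ p := by
    rw [hqdef, S.height_reflection, hM.two_cos_pred rfl]
    split_ifs <;> ring
  have hfar : ∀ j : Fin n, 2 ≤ (j : ℕ) → S.height j p = 0 ∧ S.height j q = 0 := by
    intro j hj
    have hjq : S.height j q = S.height j p := by
      rw [hqdef, S.height_reflection, hM.two_cos_far (Or.inr (by simp only; omega))]
      ring
    rw [hjq, and_self]
    by_contra h0
    -- otherwise the `j`-th reflection would move three elements
    have h1 := sum_height_sq hO hμ j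
    have hs := S.height_reflection_self j p
    have hsp := hO j p hp
    set s := simpleReflection S.α j p
    have hne1 : s ≠ p := by
      intro h2
      rw [h2] at hs
      exact h0 (by linarith)
    have hne2 : s ≠ q := by
      intro h2
      rw [h2, hjq] at hs
      exact h0 (by linarith)
    have h2 : ∑ y ∈ {p, q, s}, S.height j y ^ 2 ≤ ∑ y ∈ O, S.height j y ^ 2 := by
      refine Finset.sum_le_sum_of_subset_of_nonneg ?_ fun y _ _ => sq_nonneg _
      intro y hy
      simp only [Finset.mem_insert, Finset.mem_singleton] at hy
      rcases hy with rfl | rfl | rfl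
      exacts [hp, hq, hsp]
    rw [h1, Finset.sum_insert (by simp [hpq, hne1.symm]), Finset.sum_pair hne2.symm, hjq, hs,
      neg_sq, hheight p hp j h0] at h2
    linarith
  have hend : S.height ⟨1, by omega⟩ p = 0 ∨ S.height ⟨1, by omega⟩ q = 0 := by
    by_contra! hcon
    have h1 := hheight p hp _ hcon.1
    have h2 := hheight q hq _ hcon.2
    have h3 := hheight p hp _ hp0
    rw [hq1] at h2
    have h4 : S.height ⟨0, by omega⟩ p * (2 * S.height ⟨1, by omega⟩ p +
      S.height ⟨0, by omega⟩ p) = 0 := by linear_combination h2 - h1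
    have h5 := (mul_eq_zero.1 h4).resolve_left hp0
    have h6 : S.height ⟨0, by omega⟩ p = -2 * S.height ⟨1, by omega⟩ p := by linarith
    rw [h6] at h3
    linarith
  have hall : ∀ y, S.height ⟨1, by omega⟩ y = 0 → (∀ j : Fin n, 2 ≤ (j : ℕ) → S.height j y = 0) →
      ∀ j : Fin n, (j : ℕ) ≠ 0 → S.height j y = 0 := by
    intro y h1 h2 j hj
    by_cases hj1 : (j : ℕ) = 1
    · rwa [show j = ⟨1, by omega⟩ from Fin.ext hj1]
    · exact h2 j (by omega)
  rcases hend with h1 | h1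
  · exact ⟨p, hp, hall p h1 fun j hj => (hfar j hj).1⟩
  · exact ⟨q, hq, hall q h1 fun j hj => (hfar j hj).2⟩

omit hO in
theorem eq_smul_of_height_sq {i : Fin n} {y : V} (hy : S.height i y ^ 2 = ‖y‖ ^ 2) :
    y = (S.height i y / ‖S.α i‖) • S.α i := by
  have hi := (S.norm_pos i).ne'
  rw [← sub_eq_zero, ← norm_eq_zero, ← sq_eq_zero_iff, @norm_sub_sq_real, ← hy, inner_smul_right,
    norm_smul, mul_pow, Real.norm_eq_abs, sq_abs, real_inner_comm,
    show inner ℝ (S.α i) y = S.height i y * ‖S.α i‖ by rw [SimpleSystem.height]; field_simp]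
  field_simp
  ring

/-- A small centrally symmetric stable set in type `B` of rank at least three contains a multiple of
the last simple root. Its elements have norm `r` and lie on orthogonal lines, so that a reflection
maps an element to itself, its negative or an orthogonal vector. Unless a multiple of the last simple
root occurs, this restricts the heights over the last two mirrors to `0` and `± r / √2`, and the sum of
the products of these two heights is an integral multiple of `r ^ 2 / 2`. The frame operator evaluates
the sum to `-√2 * r ^ 2`, contrary to the irrationality of `√2`. -/
theorem exists_mem_of_card_le_B (hM : IsString M √2) (hn : 3 ≤ n) {r : ℝ}
    (hr : ∀ y ∈ O, ‖y‖ = r) (hr0 : 0 < r) (hne : O.Nonempty) (hcard : O.card ≤ 2 * n)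
    (hneg : ∀ y ∈ O, -y ∈ O) :
    ∃ (i : Fin n) (t : ℝ), (i : ℕ) + 1 = n ∧ t • S.α i ∈ O := by
  classical
  have hn0 : (0 : ℝ) < n := by exact_mod_cast (by omega : 0 < n)
  obtain ⟨μ, hμn, hμ⟩ := exists_frame_eq_smul hO (fun i j => hM.inner_succ_ne_zero S) (by omega) hr
  have hμle : μ ≤ 2 * r ^ 2 := by
    have hcard' : (O.card : ℝ) ≤ 2 * n := by exact_mod_cast hcard
    refine le_of_mul_le_mul_right ?_ hn0
    rw [hμn]
    nlinarith [sq_nonneg r]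
  have hsum : ∀ y ∈ O, ∑ z ∈ O, inner ℝ z y * inner ℝ z y = μ * r ^ 2 := fun y hy => by
    rw [← inner_frame, hμ, inner_smul_right, real_inner_self_eq_norm_sq, hr y hy]
  have hyne : ∀ y ∈ O, y ≠ -y := by
    intro y hy h0
    have h1 : y = 0 := by
      rwa [eq_neg_iff_add_eq_zero, ← two_smul ℝ, smul_eq_zero_iff_right two_ne_zero] at h0
    have h2 := hr y hy
    rw [h1, norm_zero] at h2
    exact hr0.ne h2
  have horth : ∀ y ∈ O, ∀ z ∈ O, z ≠ y → z ≠ -y → inner ℝ z y = (0 : ℝ) := by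
    intro y hy z hz h1 h2
    have h3 : ∑ w ∈ {y, -y, z}, inner ℝ w y * inner ℝ w y ≤ (μ * r ^ 2 : ℝ) := by
      rw [← hsum y hy]
      refine Finset.sum_le_sum_of_subset_of_nonneg ?_ fun w _ _ => mul_self_nonneg _
      intro w hw
      simp only [Finset.mem_insert, Finset.mem_singleton] at hw
      rcases hw with rfl | rfl | rfl
      exacts [hy, hneg _ hy, hz]
    rw [Finset.sum_insert (by simp [hyne y hy, h1.symm]), Finset.sum_pair h2.symm,
      inner_neg_left, real_inner_self_eq_norm_sq, hr y hy] at h3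
    have h4 : inner ℝ z y * inner ℝ z y ≤ (0 : ℝ) := by nlinarith [sq_nonneg r]
    exact mul_self_eq_zero.1 (le_antisymm h4 (mul_self_nonneg _))
  have hμeq : μ = 2 * r ^ 2 := by
    refine le_antisymm hμle ?_
    obtain ⟨y, hy⟩ := hne
    have h3 : ∑ w ∈ {y, -y}, inner ℝ w y * inner ℝ w y ≤ (μ * r ^ 2 : ℝ) := by
      rw [← hsum y hy]
      refine Finset.sum_le_sum_of_subset_of_nonneg ?_ fun w _ _ => mul_self_nonneg _
      intro w hw
      simp only [Finset.mem_insert, Finset.mem_singleton] at hw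
      rcases hw with rfl | rfl
      exacts [hy, hneg _ hy]
    rw [Finset.sum_pair (hyne y hy), inner_neg_left, real_inner_self_eq_norm_sq, hr y hy] at h3
    refine le_of_mul_le_mul_right ?_ (by positivity : 0 < r ^ 2)
    linarith
  have hheight : ∀ y ∈ O, ∀ i, S.height i y = 0 ∨ S.height i y ^ 2 = r ^ 2 ∨
      2 * S.height i y ^ 2 = r ^ 2 := by
    intro y hy i
    by_cases h1 : simpleReflection S.α i y = y
    · exact Or.inl ((S.reflection_eq_self_iff i y).1 h1)
    have h3 := inner_reflection (S := S) i y
    rw [hr y hy] at h3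
    by_cases h2 : simpleReflection S.α i y = -y
    · rw [h2, inner_neg_right, real_inner_self_eq_norm_sq, hr y hy] at h3
      exact Or.inr (Or.inl (by linarith))
    · rw [real_inner_comm, horth y hy _ (hO i y hy) h1 h2] at h3
      exact Or.inr (Or.inr (by linarith))
  obtain ⟨m, rfl⟩ : ∃ m, n = m + 3 := ⟨n - 3, by omega⟩
  by_contra! hcon
  have hr2 : 0 < r ^ 2 := by positivity
  -- the heights over the last two mirrors
  have hlast : ∀ y ∈ O, S.height ⟨m + 2, by omega⟩ y = 0 ∨
      2 * S.height ⟨m + 2, by omega⟩ y ^ 2 = r ^ 2 := by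
    intro y hy
    rcases hheight y hy ⟨m + 2, by omega⟩ with h1 | h1 | h1
    · exact Or.inl h1
    · rw [← hr y hy] at h1
      refine absurd ?_ (hcon ⟨m + 2, by omega⟩ (S.height ⟨m + 2, by omega⟩ y /
        ‖S.α ⟨m + 2, by omega⟩‖) rfl)
      rw [← eq_smul_of_height_sq h1]
      exact hy
    · exact Or.inr h1
  have hprev : ∀ y ∈ O, S.height ⟨m + 1, by omega⟩ y = 0 ∨
      2 * S.height ⟨m + 1, by omega⟩ y ^ 2 = r ^ 2 := by
    intro y hy
    rcases hheight y hy ⟨m + 1, by omega⟩ with h1 | h1 | h1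
    · exact Or.inl h1
    · exfalso
      have h2 := h1
      rw [← hr y hy] at h2
      have h3 : S.height ⟨m, by omega⟩ y = -(S.height ⟨m + 1, by omega⟩ y / 2) := by
        have h4 := hM.two_cos_succ (i := ⟨m, by omega⟩) (j := ⟨m + 1, by omega⟩) rfl
        rw [if_neg (by simp)] at h4
        have h5 := (S.norm_pos ⟨m + 1, by omega⟩).ne'
        nth_rewrite 1 [eq_smul_of_height_sq h2]
        rw [S.height_smul, S.height_basis]
        field_simp
        linear_combination -S.height ⟨m + 1, by omega⟩ y * h4
      have h4 : S.height ⟨m, by omega⟩ y ^ 2 = r ^ 2 / 4 := by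
        rw [h3]
        linear_combination h1 / 4
      rcases hheight y hy ⟨m, by omega⟩ with h5 | h5 | h5
      · rw [h5] at h4
        linarith
      · linarith
      · linarith
    · exact Or.inr h1
  have hint : ∀ y ∈ O, ∃ k : ℤ, S.height ⟨m + 1, by omega⟩ y * S.height ⟨m + 2, by omega⟩ y =
      k * (r ^ 2 / 2) := by
    intro y hy
    rcases hlast y hy with h1 | h1
    · exact ⟨0, by rw [h1]; simp⟩
    rcases hprev y hy with h2 | h2
    · exact ⟨0, by rw [h2]; simp⟩
    have h3 : S.height ⟨m + 1, by omega⟩ y ^ 2 = S.height ⟨m + 2, by omega⟩ y ^ 2 := by linarith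
    rcases sq_eq_sq_iff_eq_or_eq_neg.1 h3 with h4 | h4
    · exact ⟨1, by rw [h4]; push_cast; linarith⟩
    · exact ⟨-1, by rw [h4]; push_cast; linarith⟩
  choose! k hk using hint
  have h1 := sum_height_mul_height hO hμ ⟨m + 1, by omega⟩ ⟨m + 2, by omega⟩
  rw [Finset.sum_congr rfl hk, ← Finset.sum_mul, ← Int.cast_sum, hμeq] at h1
  have h2 := hM.two_cos_succ (i := ⟨m + 1, by omega⟩) (j := ⟨m + 2, by omega⟩) rfl
  rw [if_pos rfl] at h2
  have h3 : √2 * 2 = -((∑ y ∈ O, k y : ℤ) : ℝ) := by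
    refine mul_right_cancel₀ hr2.ne' ?_
    linear_combination 2 * h1 - 2 * r ^ 2 * h2
  refine irrational_sqrt_two ⟨-(∑ y ∈ O, k y : ℤ) / 2, ?_⟩
  push_cast
  push_cast at h3
  linarith

end Frame

/-! ### Smallest orbits are paths -/

section Smallest

variable {n : ℕ} {M : CoxeterMatrix (Fin n)} {V : Type*} [NormedAddCommGroup V]
  [InnerProductSpace ℝ V] [FiniteDimensional ℝ V] {S : SimpleSystem M V} {o : Set V}

theorem zero_notMem_orbit {α : Module.Basis (Fin n) ℝ V} {x : V} (hx : x ≠ 0) :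
    (0 : V) ∉ orbit α x := by
  rintro ⟨g, -, h0⟩
  exact hx ((map_eq_zero_iff g g.injective).1 h0.symm)

/-- A finite orbit, as a finite set with the properties used for frames. -/
theorem exists_finset_orbit {x : V} (hx : x ≠ 0) {N : ℕ}
    (hcard : (orbit S.α x).encard ≤ N) : ∃ O : Finset V, (∀ y, y ∈ O ↔ y ∈ orbit S.α x) ∧
      (∀ i, ∀ y ∈ O, simpleReflection S.α i y ∈ O) ∧ (∀ y ∈ O, ‖y‖ = ‖x‖) ∧ 0 < ‖x‖ ∧
      O.Nonempty ∧ O.card ≤ N := by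
  have hfin : (orbit S.α x).Finite :=
    Set.encard_lt_top_iff.1 (hcard.trans_lt (ENat.natCast_lt_top N))
  have hmem : ∀ y, y ∈ hfin.toFinset ↔ y ∈ orbit S.α x := fun y => hfin.mem_toFinset
  refine ⟨hfin.toFinset, hmem, fun i y hy => ?_, fun y hy => ?_, norm_pos_iff.2 hx,
    ⟨x, (hmem x).2 (mem_orbit_self _ _)⟩, ?_⟩
  · rw [hmem] at hy ⊢
    exact apply_mem_orbit hy (simpleReflection_mem _ _)
  · obtain ⟨g, -, rfl⟩ := (hmem y).1 hy
    exact LinearIsometryEquiv.norm_map _ _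
  · rw [hfin.encard_eq_coe_toFinset_card] at hcard
    exact_mod_cast hcard

/-- A vector on all simple mirrors but the first. -/
theorem exists_fundamental (S : SimpleSystem M V) (hn : 0 < n) (g : ℝ) :
    ∃ y, (∀ j : Fin n, (j : ℕ) ≠ 0 → S.height j y = 0) ∧ S.height ⟨0, hn⟩ y = g := by
  obtain ⟨y, hy⟩ := S.exists_height fun i => if (i : ℕ) = 0 then g else 0
  exact ⟨y, fun j hj => by rw [hy, if_neg hj], by rw [hy, if_pos rfl]⟩

theorem ne_zero_of_height_ne_zero {i : Fin n} {y : V} (hy : S.height i y ≠ 0) : y ≠ 0 := by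
  rintro rfl
  exact hy (by simp [SimpleSystem.height])

theorem IsString.exists_pathA_of_isSmallestOrbit (hM : IsString M 1)
    (hM3 : ∀ i j : Fin n, (i : ℕ) + 1 = j → M i j = 3) (ho : S.IsSmallestOrbit o) :
    ∃ (Γ : OrbitPath S o (n + 1)) (c : ℝ), Γ.IsTypeA c := by
  obtain ⟨⟨x, hx, rfl⟩, hmin⟩ := ho
  have hn := hM.two_le
  obtain ⟨y₀, hy₀, hg⟩ := exists_fundamental S (by omega) 1
  have hy₀' : y₀ ≠ 0 := ne_zero_of_height_ne_zero (hg.trans_ne one_ne_zero)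
  obtain ⟨Γ₀, -⟩ := hM.exists_pathA hM3 hy₀' hy₀
  obtain ⟨O, hmem, hO, hr, hr0, hne, hcard⟩ :=
    exists_finset_orbit hx ((hmin y₀ hy₀').trans Γ₀.encard_le)
  obtain ⟨y, hyO, hy⟩ := exists_mem_of_card_le_A hO hM hr hr0 hne hcard
  have hyx := (hmem y).1 hyO
  rw [← orbit_eq_of_mem hyx]
  exact hM.exists_pathA hM3 (fun h0 => zero_notMem_orbit hx (h0 ▸ hyx)) hy

theorem IsString.exists_pathB_of_smul_mem (hM : IsString M √2) {x : V} (hx : x ≠ 0) {i : Fin n}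
    (hi : (i : ℕ) + 1 = n) {t : ℝ} (ht : t • S.α i ∈ orbit S.α x) :
    ∃ (Γ : OrbitPath S (orbit S.α x) (2 * n)) (c : ℝ), Γ.IsTypeB c := by
  have hn := hM.two_le
  have hsq : √2 ^ 2 = (2 : ℝ) := Real.sq_sqrt (by norm_num)
  have hsq0 : √2 ≠ 0 := by positivity
  have ht0 : t ≠ 0 := by
    rintro rfl
    rw [zero_smul] at ht
    exact zero_notMem_orbit hx ht
  obtain ⟨g, hg⟩ : ∃ g, √2 * g = t * ‖S.α i‖ := ⟨t * ‖S.α i‖ / √2, by field_simp⟩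
  have hg0 : g ≠ 0 := by
    rintro rfl
    rw [mul_zero, eq_comm, mul_eq_zero] at hg
    exact hg.elim ht0 (S.norm_pos i).ne'
  obtain ⟨y, hy, hyg⟩ := exists_fundamental S (by omega) g
  have hy0 : y ≠ 0 := ne_zero_of_height_ne_zero (hyg.trans_ne hg0)
  obtain ⟨Γ, c, hB, hΓ⟩ := hM.exists_pathB hy0 hy
  have hwalk : walk S y (n - 1) = t • S.α i := by
    refine S.ext_height fun j => ?_
    rw [hM.height_walk hy (g := g) (fun j hj => by
      rw [← hyg, show j = ⟨0, by omega⟩ from Fin.ext hj]) (by omega), S.height_smul,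
      S.height_basis]
    rcases (by omega : (j : ℕ) + 1 = n ∨ (j : ℕ) + 2 = n ∨ (j : ℕ) + 2 < n) with h1 | h1 | h1
    · rw [if_pos (by omega), if_pos (by omega), show j = i from Fin.ext (by omega), M.diagonal, hg]
      simp
    · rw [if_neg (by omega), if_pos (by omega)]
      have h2 := hM.two_cos_succ (i := j) (j := i) (by omega)
      rw [if_pos hi] at h2
      refine mul_left_cancel₀ hsq0 ?_
      linear_combination -hg + t * ‖S.α i‖ * √2 / 2 * h2 + t * ‖S.α i‖ / 2 * hsq
    · rw [if_neg (by omega), if_neg (by omega)]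
      have h2 := hM.two_cos_far (i := j) (j := i) (by omega)
      linear_combination t * ‖S.α i‖ / 2 * h2
  have hmem : t • S.α i ∈ orbit S.α y := by
    rw [← hwalk, ← hΓ]
    exact Γ.x_mem (by omega)
  rw [← orbit_eq_of_mem ht, orbit_eq_of_mem hmem]
  exact ⟨Γ, c, hB⟩

/-- In type `B` the central symmetry is a power of the Coxeter element. -/
theorem OrbitPath.IsTypeB.neg_mem {o' : Set V} {h : ℕ} {Γ : OrbitPath S o' h} {c : ℝ}
    (hB : Γ.IsTypeB c) {x y : V} (hy : y ∈ orbit S.α x) : -y ∈ orbit S.α x := by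
  have hh := hB.h_eq
  have h1 : ((Γ.turn ^ (n : ℤ) : V ≃ₗᵢ[ℝ] V).toLinearEquiv : V →ₗ[ℝ] V) = -LinearMap.id := by
    refine Γ.ext_of_eq_on fun k hk => ?_
    have h2 := Γ.turn_zpow_z n (zag k)
    have h3 : Γ.z (n + zag k) = -Γ.x k := by
      rw [← hB.neg_x k hk, ← Γ.z_zag (by omega), z_eq_iff]
      rcases Nat.mod_two_eq_zero_or_one k with h0 | h0
      · rw [zag_even h0, zag_odd (by omega)]
        exact ⟨0, by omega⟩
      · rw [zag_odd h0, zag_even (by omega)]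
        exact ⟨1, by omega⟩
    rw [h3, Γ.z_zag hk] at h2
    exact h2
  have h2 : (Γ.turn ^ (n : ℤ)) y = -y := LinearMap.congr_fun h1 y
  rw [← h2]
  exact apply_mem_orbit hy (zpow_mem (mul_mem (S.half_mem _) (S.half_mem _)) _)

theorem IsString.exists_pathB_of_isSmallestOrbit (hM : IsString M √2) (hn : 3 ≤ n)
    (ho : S.IsSmallestOrbit o) : ∃ (Γ : OrbitPath S o (2 * n)) (c : ℝ), Γ.IsTypeB c := by
  obtain ⟨⟨x, hx, rfl⟩, hmin⟩ := ho
  obtain ⟨y₀, hy₀, hg⟩ := exists_fundamental S (by omega) 1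
  have hy₀' : y₀ ≠ 0 := ne_zero_of_height_ne_zero (hg.trans_ne one_ne_zero)
  obtain ⟨Γ₀, c, hB, -⟩ := hM.exists_pathB hy₀' hy₀
  obtain ⟨O, hmem, hO, hr, hr0, hne, hcard⟩ :=
    exists_finset_orbit hx ((hmin y₀ hy₀').trans Γ₀.encard_le)
  obtain ⟨i, t, hi, ht⟩ := exists_mem_of_card_le_B hO hM hn hr hr0 hne hcard fun y hy =>
    (hmem _).2 (hB.neg_mem ((hmem y).1 hy))
  exact hM.exists_pathB_of_smul_mem hx hi ((hmem _).1 ht)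

/-- In rank two smallest orbits are paths. -/
theorem exists_path_rank_two_of_isSmallestOrbit {M : CoxeterMatrix (Fin 2)} {S : SimpleSystem M V}
    {m : ℕ} (hm : 3 ≤ m) (hM : M 0 1 = m) (ho : S.IsSmallestOrbit o) :
    Nonempty (OrbitPath S o m) := by
  obtain ⟨⟨x, hx, rfl⟩, hmin⟩ := ho
  obtain ⟨y₀, hy₀, hg⟩ := exists_fundamental S (by omega) 1
  have hy₀' : y₀ ≠ 0 := ne_zero_of_height_ne_zero (hg.trans_ne one_ne_zero)
  obtain ⟨Γ₀⟩ := exists_path_rank_two (i := 0) S hm hM (hy₀ _ (by decide)) hy₀'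
  obtain ⟨y, hyx, i, hy⟩ := Γ₀.exists_mem_mirror hx ((hmin y₀ hy₀').trans Γ₀.encard_le)
  rw [← orbit_eq_of_mem hyx]
  refine exists_path_rank_two (i := 1 - i) S hm hM ?_ fun h0 => zero_notMem_orbit hx (h0 ▸ hyx)
  rwa [sub_sub_cancel]

end Smallest

/-! ### The Coxeter matrices of the three types -/

theorem coxeterMatrixA_apply (n : ℕ) (i j : Fin n) : CoxeterMatrix.A n i j =
    if i = j then 1 else if (j : ℕ) + 1 = i ∨ (i : ℕ) + 1 = j then 3 else 2 := rfl

theorem coxeterMatrixB_apply (n : ℕ) (i j : Fin n) : CoxeterMatrix.B n i j =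
    if i = j then 1 else if (i : ℕ) = n - 1 ∧ (j : ℕ) = n - 2 ∨ (j : ℕ) = n - 1 ∧ (i : ℕ) = n - 2
      then 4 else if (j : ℕ) + 1 = i ∨ (i : ℕ) + 1 = j then 3 else 2 := rfl

theorem coxeterMatrixA_succ {n : ℕ} {i j : Fin n} (hij : (i : ℕ) + 1 = j) :
    CoxeterMatrix.A n i j = 3 := by
  rw [coxeterMatrixA_apply, if_neg (fun h0 => by rw [h0] at hij; omega), if_pos (Or.inr hij)]

theorem isString_A {n : ℕ} (hn : 2 ≤ n) : IsString (CoxeterMatrix.A n) 1 where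
  two_le := hn
  e_pos := one_pos
  far i j hij := by
    rw [coxeterMatrixA_apply, if_neg (fun h0 => by rw [h0] at hij; omega), if_neg (by omega)]
  mid i j hij _ := coxeterMatrixA_succ hij
  last i j hij _ := by
    rw [coxeterMatrixA_succ hij]
    push_cast
    rw [Real.cos_pi_div_three]
    norm_num

theorem isString_B {n : ℕ} (hn : 2 ≤ n) : IsString (CoxeterMatrix.B n) √2 where
  two_le := hn
  e_pos := by positivity
  far i j hij := by
    rw [coxeterMatrixB_apply, if_neg (fun h0 => by rw [h0] at hij; omega), if_neg (by omega),
      if_neg (by omega)]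
  mid i j hij hj := by
    rw [coxeterMatrixB_apply, if_neg (fun h0 => by rw [h0] at hij; omega), if_neg (by omega),
      if_pos (Or.inr hij)]
  last i j hij hj := by
    rw [coxeterMatrixB_apply, if_neg (fun h0 => by rw [h0] at hij; omega), if_pos (by omega)]
    push_cast
    rw [Real.cos_pi_div_four]
    ring

theorem nonempty_path_of_isTypeABI {V : Type*} [NormedAddCommGroup V] [InnerProductSpace ℝ V]
    [FiniteDimensional ℝ V] {n : ℕ} {M : CoxeterMatrix (Fin n)} {h : ℕ} (hM : IsTypeABI n M h)
    {S : SimpleSystem M V} {o : Set V} (ho : S.IsSmallestOrbit o) :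
    Nonempty (OrbitPath S o h) := by
  cases hM with
  | A n hn =>
    obtain ⟨Γ, -⟩ := (isString_A hn).exists_pathA_of_isSmallestOrbit
      (fun i j => coxeterMatrixA_succ) ho
    exact ⟨Γ⟩
  | B n hn =>
    by_cases h3 : 3 ≤ n
    · obtain ⟨Γ, -⟩ := (isString_B hn).exists_pathB_of_isSmallestOrbit h3 ho
      exact ⟨Γ⟩
    · obtain rfl : n = 2 := by omega
      exact exists_path_rank_two_of_isSmallestOrbit (by norm_num) rfl ho
  | I m hm =>
    refine exists_path_rank_two_of_isSmallestOrbit hm ?_ ho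
    change h - 2 + 2 = h
    omega

end CoxeterDiagrams

end

open CoxeterDiagrams in
theorem mainTheorem4 {V : Type*} [NormedAddCommGroup V] [InnerProductSpace ℝ V]
    [FiniteDimensional ℝ V] :
    -- the projected orbit is an `h`-gon, which expands to an `(h + 2)`-gon; each almost positive
    -- root has a uniquely determined diagram; and the diagrams describe compatibility
    (∀ (n : ℕ) (M : CoxeterMatrix (Fin n)) (h : ℕ), IsTypeABI n M h →
      ∀ (S : SimpleSystem M V) (o : Set V), S.IsSmallestOrbit o →
        S.coxeterNumber = h ∧ Module.finrank ℝ S.coxeterPlane = 2 ∧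
        Nonempty (OrbitPolygon S o) ∧
        (∀ (G : OrbitPolygon S o) (θ : ℝ), G.index h = h + 2 ∧
          ∃ E : Expansion S o, E.polygon = G ∧ E.θ = θ) ∧
        ∀ E : Expansion S o,
          Set.InjOn E.q o ∧ (∀ ε, ∃! ℓ, E.IsMirror ε ℓ) ∧
          (∃ Δ, E.IsDiagramMap Δ ∧
            ∀ Δ', E.IsDiagramMap Δ' → Set.EqOn Δ' Δ S.almostPositiveRoots) ∧
          (∃ R, S.IsCompatibility R) ∧
          ∀ Δ, E.IsDiagramMap Δ → ∀ R, S.IsCompatibility R →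
            ∀ β ∈ S.almostPositiveRoots, ∀ γ ∈ S.almostPositiveRoots, β ≠ γ →
              (R β γ ↔ ∀ d ∈ Δ β, ∀ e ∈ Δ γ, ¬ Crosses d e)) ∧
    -- type `A`
    (∀ n : ℕ, 2 ≤ n → ∀ (S : SimpleSystem (CoxeterMatrix.A n) V) (o : Set V),
      S.IsSmallestOrbit o → ∀ (E : Expansion S o) (Δ : V → Set (Sym2 V)),
        E.IsDiagramMap Δ → E.IsSnakeModelA Δ) ∧
    -- type `B`, for the orbit of the vectors proportional to `±e₁, …, ±eₙ`
    (∀ n : ℕ, 2 ≤ n → ∀ (S : SimpleSystem (CoxeterMatrix.B n) V) (o : Set V),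
      S.IsSmallestOrbit o → (∃ (i : Fin n) (t : ℝ), (i : ℕ) + 1 = n ∧ t • S.α i ∈ o) →
        ∀ (E : Expansion S o) (Δ : V → Set (Sym2 V)),
          E.IsDiagramMap Δ → E.IsSnakeModelB Δ) ∧
    -- type `I₂(m)`
    (∀ m : ℕ, 3 ≤ m → ∀ (S : SimpleSystem (CoxeterMatrix.I (m - 2)) V) (o : Set V),
      S.IsSmallestOrbit o → ∀ (E : Expansion S o) (Δ : V → Set (Sym2 V)),
        E.IsDiagramMap Δ →
          Set.BijOn Δ S.almostPositiveRoots E.maximalParallelFamilies ∧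
          S.almostPositiveRoots.ncard = m + 2) := by
  refine ⟨fun n M h hM S o ho => ?_, fun n hn S o ho E Δ hΔ => ?_,
    fun n hn S o ho hmem E Δ hΔ => ?_, fun m hm S o ho E Δ hΔ => ?_⟩
  · obtain ⟨Γ⟩ := nonempty_path_of_isTypeABI hM ho
    exact Γ.main
  · obtain ⟨Γ, c, hA⟩ := (isString_A hn).exists_pathA_of_isSmallestOrbit
      (fun i j => coxeterMatrixA_succ) ho
    obtain ⟨L⟩ := Γ.nonempty_labelling E
    exact L.isSnakeModelA hA hΔ
  · obtain ⟨⟨x, hx, rfl⟩, -⟩ := ho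
    obtain ⟨i, t, hi, ht⟩ := hmem
    obtain ⟨Γ, c, hB⟩ := (isString_B hn).exists_pathB_of_smul_mem hx hi ht
    obtain ⟨L⟩ := Γ.nonempty_labelling E
    exact L.isSnakeModelB hB hΔ
  · obtain ⟨Γ⟩ := nonempty_path_of_isTypeABI (IsTypeABI.I m hm) ho
    obtain ⟨L⟩ := Γ.nonempty_labelling E
    exact ⟨L.bijOn_maximalParallelFamilies hΔ, L.ncard_almostPositiveRoots⟩
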